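/- **Setting.** Let $\mathcal S,\mathcal S^d,\mathcal X,\mathcal Y$ be finite alphabets, $p_S$ a p.m.f. on $\mathcal S$, $h:\mathcal S\to\mathcal S^d$ a map (write $S^d=h(S)$; public fingerprinting is the case of a one-point $\mathcal S^d$, private fingerprinting the case $h=\mathrm{id}$), $d:\mathcal S\times\mathcal X\to[0,\infty)$ a distortion function, $D_1\in\mathbb R$, and $K\ge1$. Write $\mathcal K=\{1,\dots,K\}$. Logarithms are to base 2. *Codes.* A randomized code of length $N$ and rate $R$ consists of a key $V$ with some law on a finite alphabet $\mathcal V_N$, an encoder $f_N:\mathcal S^N\times\mathcal V_N\times\{1,\dots,M\}\to\mathcal X^N$ and a decoder $g_N$ that maps $\mathcal Y^N\times(\mathcal S^d)^N\times\mathcal V_N$ to subsets of $\{1,\dots,M\}$, where $M=\lceil 2^{NR}\rceil$. It has embedding distortion $D_1$ if $\frac1N\sum_i d(s_i,x_i)\le D_1$ for $\mathbf x=f_N(\mathbf s,v,m)$ and all $\mathbf s,v,m$. The host $\mathbf S$ is i.i.d. $p_S$ and independent of $V$. *Collusion channels.* Let $\mathscr W_K$ be a nonempty convex set of conditional p.m.f.s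 $p_{Y|X_{\mathcal K}}$ from $\mathcal X^K$ to $\mathcal Y$. A collusion channel $p_{\mathbf Y|\mathbf X_{\mathcal K}}$ of length $N$ (with arbitrary memory) is feasible if, for every input $\mathbf x_{\mathcal K}\in(\mathcal X^N)^K$, the conditional type $p_{\mathbf y|\mathbf x_{\mathcal K}}$ of the output belongs to $\mathscr W_K$ with probability one, i.e. agrees with some element of $\mathscr W_K$ on the letter tuples that occur in $\mathbf x_{\mathcal K}$. Assume that the elements of $\mathscr W_K$ are approximated by conditional types in $\mathscr W_K$: for every $p\in\mathscr W_K$ and $\varepsilon>0$ there is $N_0$ such that for all $N\ge N_0$ and all $\mathbf x_{\mathcal K}\in(\mathcal X^N)^K$ there is $\mathbf y\in\mathcal Y^N$ with $p_{\mathbf y|\mathbf x_{\mathcal K}}\in\mathscr W_K$ and $|p_{\mathbf x_{\mathcal K}\mathbf y}(a,b)-p_{\mathbf x_{\mathcal K}}(a)\,p(b|a)|\le\varepsilon$ for all $a\in\mathcal X^K$, $b\in\mathcal Y$. *Detect-all capacity.* A rate $R$ is achievable if there are codes of every length $N$, of rate $R$ and embedding distortion $D_1$, such that both $\Pr[\text{coalition}\not\subseteq\hat{\mathcal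 K}]$ and $\Pr[\hat{\mathcal K}\setminus\text{coalition}\ne\emptyset]$, where $\hat{\mathcal K}=g_N(\mathbf Y,\mathbf S^d,V)$, tend to $0$ as $N\to\infty$ uniformly over all coalitions of $K$ users and all feasible collusion channels (a supremum over an empty set of coalitions or channels being $0$). The capacity $C^{all}(D_1,\mathscr W_K)$ is the supremum of all achievable rates ($-\infty$ if there are none). *Bound.* For $L_w,L_u\in\mathbb N$ let $\overline C^{all}_{L_w,L_u}(D_1,\mathscr W_K)$ be $$\sup_{p_{(XU)_{\mathcal K}W|S}}\ \inf_{p_{Y|X_{\mathcal K}}\in\mathscr W_K}\ \min_{\emptyset\ne A\subseteq\mathcal K}\ \frac1{|A|}\Big[I(U_A;Y,S^d\,|\,U_{\mathcal K\setminus A})-I(U_A;S\,|\,U_{\mathcal K\setminus A})\Big],$$ where $W$ has values in $\{1,\dots,L_w\}$, each $U_k$ has values in $\{1,\dots,L_u\}$, the supremum is over all $p_{(XU)_{\mathcal K}W|S}=p_W\big(\prod_{k\in\mathcal K}p_{X_k|SW}\big)p_{U_{\mathcal K}|X_{\mathcal K}SW}$ with $p_{X_1|SW}=\dots=p_{X_K|SW}$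 and $\mathbb E[d(S,X_1)]\le D_1$ (it is $0$ if there are none), and the joint law of $(S,W,X_{\mathcal K},U_{\mathcal K},Y)$ is $p_S\,p_{(XU)_{\mathcal K}W|S}\,p_{Y|X_{\mathcal K}}$. **Theorem.** The limit $\overline C^{all}(D_1,\mathscr W_K)=\lim_{L_w,L_u\to\infty}\overline C^{all}_{L_w,L_u}(D_1,\mathscr W_K)$ exists and is finite, and $$C^{all}(D_1,\mathscr W_K)\le\overline C^{all}(D_1,\mathscr W_K).$$ -/

import Mathlib

open Filter Topology

namespace BlindFP

noncomputable section

/-! ### Information measures of finite random variables (base 2)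

`P` is a probability mass function on a finite sample space `Ω`; random variables are functions
on `Ω` with values in finite sets. -/

section Information

variable {Ω α β γ : Type*} [Fintype Ω] [Fintype α] [Fintype β] [Fintype γ]

open scoped Classical in
/-- The law of the random variable `f`: `a ↦ Pr[f = a]`. -/
def law (P : Ω → ℝ) (f : Ω → α) (a : α) : ℝ :=
  ∑ ω with f ω = a, P ω

/-- Shannon entropy `H(f)` in bits. -/
def entropy (P : Ω → ℝ) (f : Ω → α) : ℝ :=
  ∑ a, Real.negMulLog (law P f a) / Real.log 2

/-- Conditional entropy `H(f | g) = H(f, g) - H(g)`. -/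
def condEntropy (P : Ω → ℝ) (f : Ω → α) (g : Ω → β) : ℝ :=
  entropy P (fun ω => (f ω, g ω)) - entropy P g

/-- Conditional mutual information `I(f ; g | e) = H(f | e) - H(f | g, e)`. -/
def condMutualInfo (P : Ω → ℝ) (f : Ω → α) (g : Ω → β) (e : Ω → γ) : ℝ :=
  condEntropy P f e - condEntropy P f (fun ω => (g ω, e ω))

end Information

/-! ### Collusion channels -/

/-- A conditional probability mass function on `B` given `A`. -/
def IsChannel {A B : Type*} [Fintype B] (p : A → B → ℝ) : Prop :=
  ∀ a, p a ∈ stdSimplex ℝ B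

section Types

variable {X Y : Type*} {K N : ℕ}

open scoped Classical in
/-- Number of positions at which the tuple of marked copies shows the letters `a`. -/
def inputCount (x : Fin K → Fin N → X) (a : Fin K → X) : ℕ :=
  (Finset.univ.filter fun i : Fin N => (fun k => x k i) = a).card

open scoped Classical in
/-- Number of positions at which the tuple of marked copies shows the letters `a` and the
pirated copy shows the letter `b`. -/
def jointCount (x : Fin K → Fin N → X) (y : Fin N → Y) (a : Fin K → X) (b : Y) : ℕ :=
  (Finset.univ.filter fun i : Fin N => (fun k => x k i) = a ∧ y i = b).card

/-- The conditional type of `y` given `x` belongs to `𝒲`. The conditional type is determined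
only at those letter tuples that occur in `x`, so this says that some member of `𝒲` agrees
with it there. -/
def CondTypeMem (𝒲 : Set ((Fin K → X) → Y → ℝ)) (x : Fin K → Fin N → X) (y : Fin N → Y) : Prop :=
  ∃ p ∈ 𝒲, ∀ a b, (jointCount x y a b : ℝ) = inputCount x a * p a b

/-- A collusion channel (with arbitrary memory) of block length `N` for `K` colluders is feasible
for the class `𝒲` if the conditional type of its output given its inputs belongs to `𝒲` with
probability one. -/
def IsFeasibleAttack [Fintype Y] (𝒲 : Set ((Fin K → X) → Y → ℝ))
    (q : (Fin K → Fin N → X) → (Fin N → Y) → ℝ) : Prop :=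
  IsChannel q ∧ ∀ x y, 0 < q x y → CondTypeMem 𝒲 x y

end Types

/-- Every member `p` of the class `𝒲` is approximated by conditional types in `𝒲`: for every
`ε > 0` and all sufficiently large `N`, every `K`-tuple `x` of sequences of length `N` admits a
sequence `y` whose conditional type given `x` belongs to `𝒲` and whose joint type with `x` is
within `ε` of (type of `x`) × `p`. -/
def TypeApproximable {X Y : Type*} {K : ℕ} (𝒲 : Set ((Fin K → X) → Y → ℝ)) : Prop :=
  ∀ p ∈ 𝒲, ∀ ε : ℝ, 0 < ε → ∃ N₀ : ℕ, ∀ N : ℕ, N₀ ≤ N → ∀ x : Fin K → Fin N → X,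
    ∃ y : Fin N → Y, CondTypeMem 𝒲 x y ∧
      ∀ a b, |(jointCount x y a b : ℝ) / N - (inputCount x a : ℝ) / N * p a b| ≤ ε

/-! ### Fingerprinting codes, error probabilities, detect-all capacity -/

/-- A randomized fingerprinting code of length `N` for `M` users. The secret key has an arbitrary
finite alphabet and an arbitrary law, and is shared by the encoder and the decoder; the decoder
sees the pirated copy, the degraded host and the key, and outputs a set of accused users. -/
structure FPCode (S Sd X Y : Type*) (N M : ℕ) where
  keyCard : ℕ
  keyLaw : Fin keyCard → ℝ
  keyLaw_mem : keyLaw ∈ stdSimplex ℝ (Fin keyCard)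
  enc : (Fin N → S) → Fin keyCard → Fin M → (Fin N → X)
  dec : (Fin N → Y) → (Fin N → Sd) → Fin keyCard → Finset (Fin M)

namespace FPCode

variable {S Sd X Y : Type*} {N M K : ℕ}

/-- Every marked copy is within per-letter distortion `D₁` of the host sequence. -/
def HasDistortion (c : FPCode S Sd X Y N M) (d : S → X → NNReal) (D₁ : ℝ) : Prop :=
  ∀ s v m, (∑ i, (d (s i) (c.enc s v m i) : ℝ)) / N ≤ D₁

variable [Fintype S] [Fintype Y]

open scoped Classical in
/-- Probability that the decoder output is in the set `E`, when the host is i.i.d. `pS`, the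
coalition is `m 0, …, m (K-1)` and the collusion channel is `q`. -/
def outputProb (c : FPCode S Sd X Y N M) (pS : S → ℝ) (h : S → Sd) (m : Fin K ↪ Fin M)
    (q : (Fin K → Fin N → X) → (Fin N → Y) → ℝ) (E : Set (Finset (Fin M))) : ℝ :=
  ∑ s : Fin N → S, ∑ v : Fin c.keyCard, ∑ y : Fin N → Y,
    if c.dec y (fun i => h (s i)) v ∈ E then
      (∏ i, pS (s i)) * c.keyLaw v * q (fun k => c.enc s v (m k)) y
    else 0

/-- The set of colluders. -/
def coalition (m : Fin K ↪ Fin M) : Finset (Fin M) := Finset.univ.map m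

/-- Worst-case probability, over coalitions of size `K` and feasible collusion channels, of
failing to catch the full coalition. -/
def errAll (c : FPCode S Sd X Y N M) (pS : S → ℝ) (h : S → Sd)
    (𝒲 : Set ((Fin K → X) → Y → ℝ)) : ℝ :=
  ⨆ (m : Fin K ↪ Fin M)
    (q : {q : (Fin K → Fin N → X) → (Fin N → Y) → ℝ // IsFeasibleAttack 𝒲 q}),
    c.outputProb pS h m q.1 {J | ¬ coalition m ⊆ J}

/-- Worst-case probability, over coalitions of size `K` and feasible collusion channels, of
accusing an innocent user. -/
def errFP (c : FPCode S Sd X Y N M) (pS : S → ℝ) (h : S → Sd)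
    (𝒲 : Set ((Fin K → X) → Y → ℝ)) : ℝ :=
  ⨆ (m : Fin K ↪ Fin M)
    (q : {q : (Fin K → Fin N → X) → (Fin N → Y) → ℝ // IsFeasibleAttack 𝒲 q}),
    c.outputProb pS h m q.1 {J | (J \ coalition m).Nonempty}

end FPCode

section Capacity

variable {S Sd X Y : Type*} [Fintype S] [Fintype Y] {K : ℕ}

/-- `R` is achievable for embedding distortion `D₁` and class `𝒲` under the detect-all
criterion. -/
def AchievableAll (pS : S → ℝ) (h : S → Sd) (d : S → X → NNReal) (D₁ : ℝ)
    (𝒲 : Set ((Fin K → X) → Y → ℝ)) (R : ℝ) : Prop :=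
  ∃ c : (N : ℕ) → FPCode S Sd X Y N ⌈(2 : ℝ) ^ ((N : ℝ) * R)⌉₊,
    (∀ N, (c N).HasDistortion d D₁) ∧
    Tendsto (fun N => (c N).errAll pS h 𝒲) atTop (𝓝 0) ∧
    Tendsto (fun N => (c N).errFP pS h 𝒲) atTop (𝓝 0)

/-- Detect-all fingerprinting capacity: the supremum, in the extended reals, of the achievable
rates. -/
def capacityAll (pS : S → ℝ) (h : S → Sd) (d : S → X → NNReal) (D₁ : ℝ)
    (𝒲 : Set ((Fin K → X) → Y → ℝ)) : EReal :=
  ⨆ R ∈ {R : ℝ | AchievableAll pS h d D₁ 𝒲 R}, (R : EReal)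

end Capacity

/-! ### The single-letter bound -/

section SingleLetter

variable {S Sd X Y : Type*} [Fintype S] [Fintype Sd] [Fintype X] [Fintype Y] {K Lw Lu : ℕ}

/-- Sample space of `(S, W, X_𝒦, U_𝒦, Y)`, with `W` and each `U_k` ranging over alphabets of
sizes `Lw` and `Lu`. -/
abbrev Sample (S X Y : Type*) (K Lw Lu : ℕ) : Type _ :=
  S × Fin Lw × (Fin K → X) × (Fin K → Fin Lu) × Y

/-- An element `p_W (∏ₖ p_{X_k|SW}) p_{U_𝒦|X_𝒦 S W}` of the outer set of conditional laws given
`S`, all the `p_{X_k|SW}` being equal to `pX`. -/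
structure OuterLaw (S X : Type*) [Fintype X] (K Lw Lu : ℕ) where
  pW : Fin Lw → ℝ
  pX : S → Fin Lw → X → ℝ
  pU : (Fin K → X) → S → Fin Lw → (Fin K → Fin Lu) → ℝ
  pW_mem : pW ∈ stdSimplex ℝ (Fin Lw)
  pX_mem : ∀ s w, pX s w ∈ stdSimplex ℝ X
  pU_mem : ∀ x s w, pU x s w ∈ stdSimplex ℝ (Fin K → Fin Lu)

/-- Expected embedding distortion `E[d(S, X₁)]`. -/
def OuterLaw.distortion (θ : OuterLaw S X K Lw Lu) (pS : S → ℝ) (d : S → X → NNReal) : ℝ :=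
  ∑ s, ∑ w, ∑ x, pS s * θ.pW w * θ.pX s w x * (d s x : ℝ)

/-- Joint law of `(S, W, X_𝒦, U_𝒦, Y)`. -/
def OuterLaw.joint (θ : OuterLaw S X K Lw Lu) (pS : S → ℝ) (p : (Fin K → X) → Y → ℝ) :
    Sample S X Y K Lw Lu → ℝ :=
  fun ⟨s, w, x, u, y⟩ => pS s * θ.pW w * (∏ k, θ.pX s w (x k)) * θ.pU x s w u * p x y

/-- `J_A = (1/|A|) [I(U_A ; Y, S^d | U_{𝒦∖A}) - I(U_A ; S | U_{𝒦∖A})]`. -/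
def OuterLaw.J (θ : OuterLaw S X K Lw Lu) (pS : S → ℝ) (h : S → Sd) (p : (Fin K → X) → Y → ℝ)
    (A : Finset (Fin K)) : ℝ :=
  let U (B : Finset (Fin K)) : Sample S X Y K Lw Lu → (B → Fin Lu) :=
    fun ω k => ω.2.2.2.1 k
  (1 / (A.card : ℝ)) *
    (condMutualInfo (θ.joint pS p) (U A) (fun ω => (ω.2.2.2.2, h ω.1)) (U Aᶜ)
      - condMutualInfo (θ.joint pS p) (U A) (fun ω => ω.1) (U Aᶜ))

/-- The max-min bound with alphabet sizes `Lw`, `Lu`: supremum over the outer laws of expected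
distortion at most `D₁` of the infimum over `p ∈ 𝒲` and nonempty `A ⊆ {1, …, K}` of `J_A`.
All values of `J_A` lie in one bounded interval, and the supremum over an empty set of laws
is `0`. -/
def outerBound (pS : S → ℝ) (h : S → Sd) (d : S → X → NNReal) (D₁ : ℝ)
    (𝒲 : Set ((Fin K → X) → Y → ℝ)) (Lw Lu : ℕ) : ℝ :=
  sSup {r : ℝ | ∃ θ : OuterLaw S X K Lw Lu, θ.distortion pS d ≤ D₁ ∧
    r = ⨅ (p : 𝒲) (A : {A : Finset (Fin K) // A.Nonempty}), θ.J pS h p.1 A.1}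

end SingleLetter

end

end BlindFP

/-!
The two claims meet in one quantity. For a law of `(S, W, X_𝒦, V)` with a single auxiliary variable
`V` (`AuxLaw`), let `gpGain` be its Gel'fand–Pinsker gain `I(V ; Y, S^d) - I(V ; S)` against a
channel. The bound is `1/K` times the max-min of this gain, and an achievable rate is at most that.

*The bound.* The coalition `A = 𝒦` in the bound, with `V = U_𝒦`, gives `1/K` times the gain of `V`
(`OuterLaw.J_univ`). Conversely, any `V` can be split into `K` shares `U_k`, uniform given that
their sum is `V`. All shares but those of `A` are then uniform and independent of `(S, Y)`, so every
coalition sees the same gain, and its value is the gain of `V` divided by `|A|` (`J_eq_of_shares`);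
when the gain is nonnegative, this is smallest for `A = 𝒦`. A nonnegative value attained with some
alphabets is therefore attained with all larger ones; the gain is at most `H(Y, S^d)`, which is
bounded; so the limit exists and is the supremum (`exists_tendsto_outerBound`).

*Minimax.* The gain is convex and continuous in the channel, and time sharing makes it concave in
the law: a mixture of laws, with `V` and `W` revealing the index, gains at least the average
(`AuxLaw.le_mix_gain`). Hence Sion's theorem on the compact closure of the class, applied to a
finite subcover, shows that if each channel separately is beaten by some law, then one law beats
them all (`exists_auxLaw_forall_channel`). It remains to treat one channel `p` in the closure of the
class.

*One channel.* Let the colluders have independent uniform messages and pass their copies through the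
memoryless channel `p`. Its output `z` need not be feasible, but since the elements of the class are
approximated by conditional types in it, changing an expected `o(N)` letters of `z` makes it
feasible (`exists_feasible_coupling`). To this feasible attack the error probabilities of the code
apply, so the messages can be guessed from `z`, the degraded host and the key: guess the feasible
output letter by letter, decode it, and guess a tuple with the accused set of values. The
logarithmic loss of this guess bounds the equivocation of the messages by `o(N)`
(`FPCode.condEntropy_messages_le`). On the other hand, with `V` at time `i` consisting of the
messages, the key, the past observations and the future host letters, a telescoping sum shows that
the single-letter gains add up to at least the `K log M` bits of the messages minus their
equivocation (`FPCode.le_sum_gain_auxLaw`). Take `W` to be the key together with an independent copy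
of the host sequence, in which `S` is substituted for the `i`-th letter: given `(S, W)` the letters
of the colluders are i.i.d., so these are admissible laws; time sharing over `i` yields one law of
gain almost `K R` (`exists_auxLaw_of_achievable`).
-/

namespace BlindFP

noncomputable section

set_option linter.unusedSectionVars false

/-! ### Entropy of finite random variables -/

section Entropy

variable {Ω α β : Type*} [Fintype Ω]

lemma law_nonneg {P : Ω → ℝ} (hP : ∀ ω, 0 ≤ P ω) (f : Ω → α) (a : α) : 0 ≤ law P f a :=
  Finset.sum_nonneg fun ω _ => hP ω

lemma le_law {P : Ω → ℝ} (hP : ∀ ω, 0 ≤ P ω) (f : Ω → α) (ω : Ω) : P ω ≤ law P f (f ω) := by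
  classical
  unfold law
  exact Finset.single_le_sum (f := P) (fun ω _ => hP ω) (by simp)

lemma law_eq_sum_ite (P : Ω → ℝ) (f : Ω → α) (a : α) [DecidableEq α] :
    law P f a = ∑ ω, if f ω = a then P ω else 0 := by
  unfold law
  rw [Finset.sum_filter]
  refine Finset.sum_congr rfl fun ω _ => ?_
  congr

variable [Fintype α] [Fintype β]

lemma sum_law_mul (P : Ω → ℝ) (f : Ω → α) (c : α → ℝ) :
    ∑ a, law P f a * c a = ∑ ω, P ω * c (f ω) := by
  classical
  rw [← Finset.sum_fiberwise_of_maps_to (s := Finset.univ) (t := Finset.univ) (g := f) (by simp)]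
  refine Finset.sum_congr rfl fun a _ => ?_
  unfold law
  rw [Finset.sum_mul]
  refine Finset.sum_congr (by ext; simp) fun ω hω => ?_
  simp only [Finset.mem_filter, Finset.mem_univ, true_and] at hω
  rw [hω]

lemma sum_law (P : Ω → ℝ) (f : Ω → α) : ∑ a, law P f a = ∑ ω, P ω := by
  simpa using sum_law_mul P f (fun _ => 1)

lemma law_comp {γ : Type*} (P : Ω → ℝ) (f : Ω → α) (g : α → γ) :
    law (law P f) g = law P (fun ω => g (f ω)) := by
  classical
  funext b
  rw [law_eq_sum_ite, law_eq_sum_ite]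
  have := sum_law_mul P f (fun a => if g a = b then 1 else 0)
  simpa using this

lemma law_mem_stdSimplex {P : Ω → ℝ} (hP : P ∈ stdSimplex ℝ Ω) (f : Ω → α) :
    law P f ∈ stdSimplex ℝ α :=
  ⟨law_nonneg hP.1 f, by rw [sum_law, hP.2]⟩

lemma law_id (P : Ω → ℝ) : law P (fun ω => ω) = P := by
  classical
  funext ω
  simp [law_eq_sum_ite]

/-- Entropy as the expected value of the information content `-log law(f(ω))`. -/
lemma entropy_eq_neg_sum (P : Ω → ℝ) (f : Ω → α) :
    entropy P f = -(∑ ω, P ω * Real.log (law P f (f ω))) / Real.log 2 := by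
  unfold entropy
  rw [← Finset.sum_div, ← sum_law_mul P f (fun a => Real.log (law P f a)), ← Finset.sum_neg_distrib]
  simp [Real.negMulLog]

/-- Entropy depends only on the partition of the sample space that the random variable induces. -/
lemma entropy_congr (P : Ω → ℝ) {f : Ω → α} {g : Ω → β} (h : ∀ ω ω', f ω = f ω' ↔ g ω = g ω') :
    entropy P f = entropy P g := by
  classical
  rw [entropy_eq_neg_sum, entropy_eq_neg_sum]
  congr 2
  refine Finset.sum_congr rfl fun ω _ => ?_
  congr 2
  rw [law_eq_sum_ite, law_eq_sum_ite]
  exact Finset.sum_congr rfl fun ω' _ => by simp [h ω' ω]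

lemma entropy_law (P : Ω → ℝ) (f : Ω → α) (g : α → β) :
    entropy (law P f) g = entropy P (fun ω => g (f ω)) := by
  unfold entropy
  rw [law_comp]

lemma log_two_pos : 0 < Real.log 2 := Real.log_pos (by norm_num)

/-- Gibbs' inequality for conditional entropy: coding `f` given `g` with a (sub)probability kernel
`Q` costs at least `H(f | g)` bits on average. -/
lemma condEntropy_le_cross {P : Ω → ℝ} (hP : ∀ ω, 0 ≤ P ω) (f : Ω → α) (g : Ω → β)
    (Q : α → β → ℝ) (hQ0 : ∀ a b, 0 ≤ Q a b) (hQ1 : ∀ b, ∑ a, Q a b ≤ 1)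
    (hQ : ∀ ω, 0 < P ω → 0 < Q (f ω) (g ω)) :
    condEntropy P f g ≤ -(∑ ω, P ω * Real.log (Q (f ω) (g ω))) / Real.log 2 := by
  classical
  unfold condEntropy
  rw [entropy_eq_neg_sum, entropy_eq_neg_sum, ← sub_div]
  refine div_le_div_of_nonneg_right ?_ log_two_pos.le
  set F : Ω → α × β := fun ω => (f ω, g ω) with hF
  have key : ∀ ω, P ω - P ω * (law P g (g ω) * Q (f ω) (g ω) / law P F (F ω)) ≤
      P ω * Real.log (law P F (F ω)) - P ω * Real.log (law P g (g ω))
        - P ω * Real.log (Q (f ω) (g ω)) := by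
    intro ω
    rcases (hP ω).eq_or_lt with h0 | h0
    · simp [← h0]
    · have h1 : 0 < law P F (F ω) := h0.trans_le (le_law hP F ω)
      have h2 : 0 < law P g (g ω) := h0.trans_le (le_law hP g ω)
      have h3 := hQ ω h0
      have h4 := Real.log_le_sub_one_of_pos (div_pos (mul_pos h2 h3) h1)
      rw [Real.log_div (mul_pos h2 h3).ne' h1.ne', Real.log_mul h2.ne' h3.ne'] at h4
      nlinarith
  have hsum := Finset.sum_le_sum fun ω (_ : ω ∈ Finset.univ) => key ω
  simp only [Finset.sum_sub_distrib] at hsum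
  have hb : ∑ ω, P ω * (law P g (g ω) * Q (f ω) (g ω) / law P F (F ω)) ≤ ∑ ω, P ω := by
    have e := sum_law_mul P F (fun c => law P g c.2 * Q c.1 c.2 / law P F c)
    simp only [hF] at e ⊢
    rw [← e]
    calc _ ≤ ∑ c : α × β, law P g c.2 * Q c.1 c.2 := by
          refine Finset.sum_le_sum fun c _ => ?_
          have hn : 0 ≤ law P g c.2 * Q c.1 c.2 := mul_nonneg (law_nonneg hP _ _) (hQ0 _ _)
          rcases eq_or_ne (law P (fun ω => (f ω, g ω)) c) 0 with h | h
          · simpa [h] using hn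
          · rw [mul_div_cancel₀ _ h]
      _ = ∑ b, law P g b * ∑ a, Q a b := by
          rw [Fintype.sum_prod_type_right]
          simp only [Finset.mul_sum]
      _ ≤ ∑ b, law P g b := Finset.sum_le_sum fun b _ =>
          mul_le_of_le_one_right (law_nonneg hP _ _) (hQ1 b)
      _ = ∑ ω, P ω := sum_law _ _
  linarith

lemma condEntropy_const {P : Ω → ℝ} (hP : P ∈ stdSimplex ℝ Ω) (f : Ω → α) :
    condEntropy P f (fun _ => ()) = entropy P f := by
  have h0 : entropy P (fun _ : Ω => ()) = 0 := by
    classical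
    rw [entropy_eq_neg_sum]
    have : ∀ ω : Ω, law P (fun _ : Ω => ()) () = 1 := by
      intro ω; rw [law_eq_sum_ite]; simpa using hP.2
    simp only [law_eq_sum_ite]
    simp [hP.2]
  unfold condEntropy
  rw [h0, sub_zero]
  exact entropy_congr P (by simp)

/-- Gibbs' inequality. -/
lemma entropy_le_cross {P : Ω → ℝ} (hP : P ∈ stdSimplex ℝ Ω) (f : Ω → α) (Q : α → ℝ)
    (hQ0 : ∀ a, 0 ≤ Q a) (hQ1 : ∑ a, Q a ≤ 1) (hQ : ∀ ω, 0 < P ω → 0 < Q (f ω)) :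
    entropy P f ≤ -(∑ ω, P ω * Real.log (Q (f ω))) / Real.log 2 := by
  rw [← condEntropy_const hP f]
  exact condEntropy_le_cross hP.1 f _ (fun a _ => Q a) (fun a _ => hQ0 a) (fun _ => hQ1) hQ

lemma entropy_pair_le {P : Ω → ℝ} (hP : P ∈ stdSimplex ℝ Ω) (f : Ω → α) (g : Ω → β) :
    entropy P (fun ω => (f ω, g ω)) ≤ entropy P f + entropy P g := by
  have := condEntropy_le_cross hP.1 f g (fun a _ => law P f a) (fun a _ => law_nonneg hP.1 _ _)
    (fun _ => by rw [sum_law, hP.2]) (fun ω h => h.trans_le (le_law hP.1 f ω))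
  rw [← entropy_eq_neg_sum] at this
  unfold condEntropy at this
  linarith

lemma entropy_pi_le {ι : Type*} [Fintype ι] [DecidableEq ι] {P : Ω → ℝ}
    (hP : P ∈ stdSimplex ℝ Ω) (f : Ω → ι → α) :
    entropy P f ≤ ∑ i, entropy P (fun ω => f ω i) := by
  have hpos : ∀ ω, 0 < P ω → ∀ i, 0 < law P (fun ω => f ω i) (f ω i) := fun ω h i =>
    h.trans_le (le_law hP.1 (fun ω => f ω i) ω)
  have := entropy_le_cross hP f (fun a => ∏ i, law P (fun ω => f ω i) (a i))
    (fun a => Finset.prod_nonneg fun i _ => law_nonneg hP.1 _ _)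
    (by rw [← Fintype.prod_sum]; simp [sum_law, hP.2])
    (fun ω h => Finset.prod_pos fun i _ => hpos ω h i)
  refine this.trans (le_of_eq ?_)
  simp only [entropy_eq_neg_sum]
  rw [← Finset.sum_div, Finset.sum_neg_distrib, Finset.sum_comm]
  congr 2
  refine Finset.sum_congr rfl fun ω _ => ?_
  rw [← Finset.mul_sum]
  rcases (hP.1 ω).eq_or_lt with h | h
  · simp [← h]
  · rw [Real.log_prod fun i _ => (hpos ω h i).ne']

lemma entropy_mono {P : Ω → ℝ} (hP : ∀ ω, 0 ≤ P ω) {f : Ω → α} {g : Ω → β}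
    (h : ∀ ω ω', f ω = f ω' → g ω = g ω') : entropy P g ≤ entropy P f := by
  classical
  rw [entropy_eq_neg_sum, entropy_eq_neg_sum]
  refine div_le_div_of_nonneg_right (neg_le_neg (Finset.sum_le_sum fun ω _ => ?_)) log_two_pos.le
  rcases (hP ω).eq_or_lt with h0 | h0
  · simp [← h0]
  · refine mul_le_mul_of_nonneg_left (Real.log_le_log (h0.trans_le (le_law hP f ω)) ?_) h0.le
    rw [law_eq_sum_ite, law_eq_sum_ite]
    refine Finset.sum_le_sum fun ω' _ => ?_
    by_cases h1 : f ω' = f ω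
    · simp [h1, h _ _ h1]
    · rw [if_neg h1]; split_ifs <;> simp [hP]

lemma entropy_nonneg {P : Ω → ℝ} (hP : P ∈ stdSimplex ℝ Ω) (f : Ω → α) : 0 ≤ entropy P f := by
  unfold entropy
  exact Finset.sum_nonneg fun a _ => div_nonneg (Real.negMulLog_nonneg (law_nonneg hP.1 _ _)
    ((law_mem_stdSimplex hP f).2 ▸ Finset.single_le_sum
      (fun b _ => law_nonneg hP.1 f b) (Finset.mem_univ a))) log_two_pos.le

lemma entropy_le_log_card {P : Ω → ℝ} (hP : P ∈ stdSimplex ℝ Ω) (f : Ω → α) :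
    entropy P f ≤ Real.log (Fintype.card α) / Real.log 2 := by
  have hne : Nonempty α := by
    by_contra hc
    rw [not_nonempty_iff] at hc
    have := (law_mem_stdSimplex hP f).2
    simp at this
  have := entropy_le_cross hP f (fun _ => 1 / (Fintype.card α : ℝ)) (fun _ => by positivity)
    (by simp) (fun _ _ => by positivity)
  refine this.trans (le_of_eq ?_)
  rw [← Finset.sum_mul, hP.2]
  simp

/-- Conditional entropy is concave in the underlying mass function: code `f` given `g` with the
conditional law under the mixture. -/
lemma condEntropy_convexCombo {P₁ P₂ : Ω → ℝ} (h₁ : ∀ ω, 0 ≤ P₁ ω) (h₂ : ∀ ω, 0 ≤ P₂ ω) {a b : ℝ}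
    (ha : 0 < a) (hb : 0 < b) (f : Ω → α) (g : Ω → β) :
    a * condEntropy P₁ f g + b * condEntropy P₂ f g ≤
      condEntropy (fun ω => a * P₁ ω + b * P₂ ω) f g := by
  classical
  set P : Ω → ℝ := fun ω => a * P₁ ω + b * P₂ ω with hPdef
  have hP : ∀ ω, 0 ≤ P ω := fun ω => add_nonneg (mul_nonneg ha.le (h₁ ω)) (mul_nonneg hb.le (h₂ ω))
  set F : Ω → α × β := fun ω => (f ω, g ω) with hF
  set Q : α → β → ℝ := fun x y => law P F (x, y) / law P g y with hQdef
  have hQ0 : ∀ x y, 0 ≤ Q x y := fun x y => div_nonneg (law_nonneg hP _ _) (law_nonneg hP _ _)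
  have hmarg : ∀ y, ∑ x, law P F (x, y) = law P g y := by
    intro y
    simp only [law_eq_sum_ite, hF, Prod.mk.injEq]
    rw [Finset.sum_comm]
    refine Finset.sum_congr rfl fun ω _ => ?_
    by_cases h : g ω = y <;> simp [h]
  have hQ1 : ∀ y, ∑ x, Q x y ≤ 1 := by
    intro y
    simp only [hQdef]
    rw [← Finset.sum_div, hmarg]
    exact div_self_le_one _
  have hQpos : ∀ ω, 0 < P ω → 0 < Q (f ω) (g ω) := fun ω h =>
    div_pos (h.trans_le (le_law hP F ω)) (h.trans_le (le_law hP g ω))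
  have e₁ := condEntropy_le_cross h₁ f g Q hQ0 hQ1 fun ω h => hQpos ω (by
    have := mul_nonneg hb.le (h₂ ω); have := mul_pos ha h; simp only [hPdef]; linarith)
  have e₂ := condEntropy_le_cross h₂ f g Q hQ0 hQ1 fun ω h => hQpos ω (by
    have := mul_nonneg ha.le (h₁ ω); have := mul_pos hb h; simp only [hPdef]; linarith)
  refine (add_le_add (mul_le_mul_of_nonneg_left e₁ ha.le)
    (mul_le_mul_of_nonneg_left e₂ hb.le)).trans (le_of_eq ?_)
  have e : condEntropy P f g = -(∑ ω, P ω * Real.log (Q (f ω) (g ω))) / Real.log 2 := by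
    unfold condEntropy
    rw [entropy_eq_neg_sum, entropy_eq_neg_sum, ← sub_div, ← neg_sub_neg, neg_neg, neg_neg,
      ← Finset.sum_sub_distrib, ← Finset.sum_neg_distrib]
    congr 1
    refine Finset.sum_congr rfl fun ω _ => ?_
    rcases (hP ω).eq_or_lt with h | h
    · simp [← h]
    · simp only [hQdef]
      rw [Real.log_div (h.trans_le (le_law hP F ω)).ne' (h.trans_le (le_law hP g ω)).ne']
      ring
  rw [e]
  simp only [hPdef, add_mul, Finset.sum_add_distrib, mul_assoc, ← Finset.mul_sum]
  ring

end Entropy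

/-! ### Laws with a single auxiliary variable and their Gel'fand–Pinsker gain -/

section AuxLaws

variable {S Sd X Y : Type*} [Fintype S] [Fintype Sd] [Fintype X] [Fintype Y] {K : ℕ}

/-- A law of `(S, W, X_𝒦, V)` in which `W` is independent of `S`, the `X_k` are i.i.d. given
`(S, W)`, and the single auxiliary variable `V` is arbitrary. The alphabets `W`, `V` are arbitrary
finite types. The joint law `Q` is part of the data, in place of the conditional law of `V`, so
that conditioning on events of probability zero does not arise. -/
structure AuxLaw (pS : S → ℝ) (X : Type*) [Fintype X] (K : ℕ) (W V : Type*) [Fintype W]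
    [Fintype V] where
  pW : W → ℝ
  pX : S → W → X → ℝ
  Q : S → W → (Fin K → X) → V → ℝ
  pW_mem : pW ∈ stdSimplex ℝ W
  pX_mem : ∀ s w, pX s w ∈ stdSimplex ℝ X
  Q_nonneg : ∀ s w x v, 0 ≤ Q s w x v
  Q_sum : ∀ s w x, ∑ v, Q s w x v = pS s * pW w * ∏ k, pX s w (x k)

namespace AuxLaw

variable {pS : S → ℝ} {W V : Type*} [Fintype W] [Fintype V]

/-- Expected embedding distortion `E[d(S, X₁)]`. -/
def distortion (q : AuxLaw pS X K W V) (d : S → X → NNReal) : ℝ :=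
  ∑ s, ∑ w, ∑ x, pS s * q.pW w * q.pX s w x * (d s x : ℝ)

/-- Joint law of `(S, X_𝒦, V, Y)` when `Y` is produced from `X_𝒦` by the channel `p`. -/
def out (q : AuxLaw pS X K W V) (p : (Fin K → X) → Y → ℝ) : S × (Fin K → X) × V × Y → ℝ :=
  fun ω => (∑ w, q.Q ω.1 w ω.2.1 ω.2.2.1) * p ω.2.1 ω.2.2.2

end AuxLaw

/-- The Gel'fand–Pinsker functional `I(V ; Y, S^d) - I(V ; S)`, written as
`H(V | S) - H(V | Y, S^d)`, of a law of `(S, X_𝒦, V, Y)`. -/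
def gpGain {V : Type*} [Fintype V] (h : S → Sd) (P : S × (Fin K → X) × V × Y → ℝ) : ℝ :=
  condEntropy P (fun ω => ω.2.2.1) (fun ω => ω.1)
    - condEntropy P (fun ω => ω.2.2.1) (fun ω => (ω.2.2.2, h ω.1))

namespace AuxLaw

variable {pS : S → ℝ} {W V : Type*} [Fintype W] [Fintype V]

lemma sum_Q (q : AuxLaw pS X K W V) (s : S) : ∑ x, ∑ v, ∑ w, q.Q s w x v = pS s := by
  have h1 : ∀ x, ∑ v, ∑ w, q.Q s w x v = ∑ w, pS s * q.pW w * ∏ k, q.pX s w (x k) := by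
    intro x
    rw [Finset.sum_comm]
    exact Finset.sum_congr rfl fun w _ => q.Q_sum s w x
  simp only [h1]
  rw [Finset.sum_comm]
  have h2 : ∀ w, ∑ x : Fin K → X, pS s * q.pW w * ∏ k, q.pX s w (x k) = pS s * q.pW w := by
    intro w
    rw [← Finset.mul_sum, ← Fintype.prod_sum]
    simp [(q.pX_mem s w).2]
  simp only [h2]
  rw [← Finset.mul_sum, q.pW_mem.2, mul_one]

lemma out_nonneg (q : AuxLaw pS X K W V) {p : (Fin K → X) → Y → ℝ} (hp : IsChannel p) (ω) :
    0 ≤ q.out p ω :=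
  mul_nonneg (Finset.sum_nonneg fun _ _ => q.Q_nonneg _ _ _ _) ((hp _).1 _)

lemma law_out_input (q : AuxLaw pS X K W V) {p : (Fin K → X) → Y → ℝ} (hp : IsChannel p)
    (c : S × (Fin K → X) × V) :
    law (q.out p) (fun ω => (ω.1, ω.2.1, ω.2.2.1)) c = ∑ w, q.Q c.1 w c.2.1 c.2.2 := by
  classical
  obtain ⟨s, x, v⟩ := c
  rw [law_eq_sum_ite]
  simp only [Fintype.sum_prod_type, Prod.mk.injEq]
  rw [Finset.sum_eq_single s, Finset.sum_eq_single x, Finset.sum_eq_single v]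
  · simp [out, ← Finset.mul_sum, (hp x).2]
  · intro b _ hb; simp [hb]
  · simp
  · intro b _ hb; simp [hb]
  · simp
  · intro b _ hb; simp [hb]
  · simp

lemma law_out_host (q : AuxLaw pS X K W V) {p : (Fin K → X) → Y → ℝ} (hp : IsChannel p) :
    law (q.out p) (fun ω => ω.1) = pS := by
  classical
  have := law_comp (q.out p) (fun ω => (ω.1, ω.2.1, ω.2.2.1)) (fun c => c.1)
  rw [← this]
  funext s
  rw [law_eq_sum_ite]
  simp only [q.law_out_input hp, Fintype.sum_prod_type]
  rw [Finset.sum_eq_single s]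
  · simp [q.sum_Q]
  · intro b _ hb; simp [hb]
  · simp

lemma out_mem (hpS : pS ∈ stdSimplex ℝ S) (q : AuxLaw pS X K W V) {p : (Fin K → X) → Y → ℝ}
    (hp : IsChannel p) : q.out p ∈ stdSimplex ℝ (S × (Fin K → X) × V × Y) :=
  ⟨q.out_nonneg hp, by rw [← sum_law _ (fun ω => ω.1), q.law_out_host hp, hpS.2]⟩

lemma condEntropy_host_eq (q : AuxLaw pS X K W V) {p p' : (Fin K → X) → Y → ℝ} (hp : IsChannel p)
    (hp' : IsChannel p') :
    condEntropy (q.out p) (fun ω => ω.2.2.1) (fun ω => ω.1) =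
      condEntropy (q.out p') (fun ω => ω.2.2.1) (fun ω => ω.1) := by
  have e : law (q.out p) (fun ω => (ω.1, ω.2.1, ω.2.2.1)) =
      law (q.out p') (fun ω => (ω.1, ω.2.1, ω.2.2.1)) := by
    funext c
    rw [q.law_out_input hp, q.law_out_input hp']
  unfold condEntropy
  have h1 := entropy_law (q.out p) (fun ω => (ω.1, ω.2.1, ω.2.2.1)) (fun c => (c.2.2, c.1))
  have h2 := entropy_law (q.out p) (fun ω => (ω.1, ω.2.1, ω.2.2.1)) (fun c => c.1)
  have h3 := entropy_law (q.out p') (fun ω => (ω.1, ω.2.1, ω.2.2.1)) (fun c => (c.2.2, c.1))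
  have h4 := entropy_law (q.out p') (fun ω => (ω.1, ω.2.1, ω.2.2.1)) (fun c => c.1)
  simp only at h1 h2 h3 h4
  rw [← h1, ← h2, ← h3, ← h4, e]

/-- The gain is a convex function of the collusion channel: the input law being fixed, only the
equivocation `H(V | Y, S^d)` varies, and conditional entropy is concave in the joint law. -/
lemma convexOn_gpGain (q : AuxLaw pS X K W V) (h : S → Sd) {C : Set ((Fin K → X) → Y → ℝ)}
    (hC : Convex ℝ C) (hCp : ∀ p ∈ C, IsChannel p) :
    ConvexOn ℝ C (fun p => gpGain h (q.out p)) := by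
  rw [convexOn_iff_forall_pos]
  refine ⟨hC, fun p hp p' hp' a b ha hb hab => ?_⟩
  have hm := hC hp hp' ha.le hb.le hab
  have e1 := q.condEntropy_host_eq (hCp _ hp) (hCp _ hm)
  have e2 := q.condEntropy_host_eq (hCp _ hp') (hCp _ hm)
  have hout : q.out (a • p + b • p') = fun ω => a * q.out p ω + b * q.out p' ω := by
    funext ω
    simp only [out, Pi.add_apply, Pi.smul_apply, smul_eq_mul]
    ring
  have key := condEntropy_convexCombo (q.out_nonneg (hCp _ hp)) (q.out_nonneg (hCp _ hp')) ha hb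
    (fun ω => ω.2.2.1) (fun ω => (ω.2.2.2, h ω.1))
  rw [← hout] at key
  simp only [gpGain, smul_eq_mul]
  rw [e1, e2, mul_sub, mul_sub]
  have : ∀ z : ℝ, a * z + b * z = z := fun z => by rw [← add_mul, hab, one_mul]
  linarith [this (condEntropy (q.out (a • p + b • p')) (fun ω => ω.2.2.1) (fun ω => ω.1))]

lemma continuous_entropy {Ω α T : Type*} [Fintype Ω] [Fintype α] [TopologicalSpace T]
    {P : T → Ω → ℝ} (hP : Continuous P) (f : Ω → α) : Continuous fun t => entropy (P t) f := by
  unfold entropy law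
  refine continuous_finsetSum _ fun a _ => Continuous.div_const ?_ _
  exact Real.continuous_negMulLog.comp
    (continuous_finsetSum _ fun ω _ => (continuous_apply ω).comp hP)

lemma continuous_gpGain (q : AuxLaw pS X K W V) (h : S → Sd) :
    Continuous fun p : (Fin K → X) → Y → ℝ => gpGain h (q.out p) := by
  have hP : Continuous fun p : (Fin K → X) → Y → ℝ => q.out p := by
    refine continuous_pi fun ω => ?_
    unfold out
    fun_prop
  unfold gpGain condEntropy
  exact ((continuous_entropy hP _).sub (continuous_entropy hP _)).sub
    ((continuous_entropy hP _).sub (continuous_entropy hP _))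

lemma nonempty_W (q : AuxLaw pS X K W V) : Nonempty W := by
  by_contra hc
  rw [not_nonempty_iff] at hc
  simpa using q.pW_mem.2

/-- Injective relabelling of the two auxiliary alphabets. Letters of the larger alphabet of `W`
outside the range of `ι` have probability zero; the law of `X_k` there is a dummy. -/
def relabel [Nonempty W] (q : AuxLaw pS X K W V) {W' V' : Type*} [Fintype W'] [Fintype V']
    (ι : W ↪ W') (κ : V ↪ V') : AuxLaw pS X K W' V' where
  pW := law q.pW ι
  pX s w' := q.pX s (Function.invFun ι w')
  Q s w' x := law (fun v => law (fun w => q.Q s w x v) ι w') κ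
  pW_mem := law_mem_stdSimplex q.pW_mem _
  pX_mem s w' := q.pX_mem _ _
  Q_nonneg s w x v := law_nonneg (fun v => law_nonneg (fun w => q.Q_nonneg _ _ _ _) _ _) _ _
  Q_sum s w' x := by
    classical
    rw [sum_law]
    simp only [law_eq_sum_ite]
    rw [Finset.sum_comm]
    have : ∀ w, ∑ v, (if ι w = w' then q.Q s w x v else 0) =
        if ι w = w' then pS s * q.pW w * ∏ k, q.pX s w (x k) else 0 := by
      intro w
      split_ifs with hw
      · exact q.Q_sum s w x
      · simp
    simp only [this]
    rw [Finset.mul_sum, Finset.sum_mul]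
    refine Finset.sum_congr rfl fun w _ => ?_
    split_ifs with hw
    · rw [← hw, Function.leftInverse_invFun ι.injective w]
    · simp

section Relabel

variable [Nonempty W] (q : AuxLaw pS X K W V) {W' V' : Type*} [Fintype W'] [Fintype V']
    (ι : W ↪ W') (κ : V ↪ V')

lemma relabel_distortion (d : S → X → NNReal) :
    (q.relabel ι κ).distortion d = q.distortion d := by
  simp only [distortion, relabel]
  refine Finset.sum_congr rfl fun s _ => ?_
  have := sum_law_mul q.pW ι (fun w' => ∑ x, pS s * q.pX s (Function.invFun ι w') x * (d s x : ℝ))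
  simp only [Function.leftInverse_invFun ι.injective _, Finset.mul_sum] at this
  simp only [mul_comm (pS s), mul_assoc] at this ⊢
  exact this

lemma relabel_out (p : (Fin K → X) → Y → ℝ) :
    (q.relabel ι κ).out p =
      law (q.out p) (fun ω => (ω.1, ω.2.1, κ ω.2.2.1, ω.2.2.2)) := by
  classical
  funext ⟨s, x, v', y⟩
  rw [law_eq_sum_ite]
  simp only [Fintype.sum_prod_type, Prod.mk.injEq, out, relabel]
  rw [Finset.sum_eq_single s, Finset.sum_eq_single x]
  · simp only [true_and, ite_and]
    have : ∀ v, ∑ y', (if κ v = v' then if y' = y then (∑ w, q.Q s w x v) * p x y' else 0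
        else 0) = (if κ v = v' then (∑ w, q.Q s w x v) else 0) * p x y := by
      intro v
      split_ifs
      · simp
      · simp
    simp only [this]
    rw [← Finset.sum_mul]
    congr 1
    simp only [law_eq_sum_ite]
    rw [Finset.sum_comm]
    refine Finset.sum_congr rfl fun v _ => ?_
    split_ifs
    · rw [Finset.sum_comm]; simp
    · simp
  · intro b _ hb; simp [hb]
  · simp
  · intro b _ hb; simp [hb]
  · simp

lemma relabel_gain (h : S → Sd) (p : (Fin K → X) → Y → ℝ) :
    gpGain h ((q.relabel ι κ).out p) = gpGain h (q.out p) := by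
  rw [relabel_out]
  simp only [gpGain, condEntropy, entropy_law]
  congr 2
  · exact entropy_congr _ (by simp [Prod.ext_iff])
  · exact entropy_congr _ (by simp [Prod.ext_iff])

end Relabel

/-- Time sharing: the law that draws an index `j` with probability `c j` and then follows `q j`.
Both `W` and the auxiliary variable carry the index. -/
def mix {ι : Type*} [Fintype ι] [DecidableEq ι] (c : ι → ℝ) (hc : c ∈ stdSimplex ℝ ι)
    (q : ι → AuxLaw pS X K W V) : AuxLaw pS X K (ι × W) (ι × V) where
  pW w := c w.1 * (q w.1).pW w.2
  pX s w := (q w.1).pX s w.2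
  Q s w x v := if w.1 = v.1 then c w.1 * (q w.1).Q s w.2 x v.2 else 0
  pW_mem := ⟨fun w => mul_nonneg (hc.1 _) ((q _).pW_mem.1 _), by
    rw [Fintype.sum_prod_type]
    simp only [← Finset.mul_sum, (q _).pW_mem.2, mul_one]
    exact hc.2⟩
  pX_mem s w := (q _).pX_mem _ _
  Q_nonneg s w x v := by
    split_ifs
    · exact mul_nonneg (hc.1 _) ((q _).Q_nonneg _ _ _ _)
    · exact le_rfl
  Q_sum s w x := by
    rw [Fintype.sum_prod_type, Finset.sum_eq_single w.1]
    · simp only [if_true, ← Finset.mul_sum, (q _).Q_sum]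
      ring
    · intro b _ hb
      simp [Ne.symm hb]
    · simp

section Mix

variable {ι : Type*} [Fintype ι] [DecidableEq ι] (c : ι → ℝ) (hc : c ∈ stdSimplex ℝ ι)
    (q : ι → AuxLaw pS X K W V)

lemma mix_distortion (d : S → X → NNReal) :
    (mix c hc q).distortion d = ∑ j, c j * (q j).distortion d := by
  simp only [distortion, mix, Finset.mul_sum, Fintype.sum_prod_type]
  rw [Finset.sum_comm]
  refine Finset.sum_congr rfl fun j _ => Finset.sum_congr rfl fun s _ =>
    Finset.sum_congr rfl fun w _ => Finset.sum_congr rfl fun x _ => ?_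
  ring

lemma mix_out (p : (Fin K → X) → Y → ℝ) (s : S) (x : Fin K → X) (j : ι) (v : V) (y : Y) :
    (mix c hc q).out p (s, x, (j, v), y) = c j * (q j).out p (s, x, v, y) := by
  simp only [out, mix, Fintype.sum_prod_type]
  rw [Finset.sum_eq_single j]
  · simp only [if_true, ← Finset.mul_sum]
    ring
  · intro b _ hb
    simp [hb]
  · simp

lemma sum_mix_out_mul (p : (Fin K → X) → Y → ℝ) (F : S × (Fin K → X) × (ι × V) × Y → ℝ) :
    ∑ ω, (mix c hc q).out p ω * F ω =
      ∑ j, c j * ∑ ω, (q j).out p ω * F (ω.1, ω.2.1, (j, ω.2.2.1), ω.2.2.2) := by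
  simp only [Fintype.sum_prod_type, mix_out, Finset.mul_sum]
  rw [Finset.sum_congr rfl fun s _ => Finset.sum_comm, Finset.sum_comm]
  refine Finset.sum_congr rfl fun j _ => Finset.sum_congr rfl fun s _ =>
    Finset.sum_congr rfl fun w _ => Finset.sum_congr rfl fun x _ =>
    Finset.sum_congr rfl fun y _ => ?_
  ring

lemma law_mix_out_pair (p : (Fin K → X) → Y → ℝ) {β : Type*} [Fintype β] (g : S → Y → β) (j : ι)
    (v : V) (b : β) :
    law ((mix c hc q).out p) (fun ω => (ω.2.2.1, g ω.1 ω.2.2.2)) ((j, v), b) =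
      c j * law ((q j).out p) (fun ω => (ω.2.2.1, g ω.1 ω.2.2.2)) (v, b) := by
  classical
  rw [law_eq_sum_ite, law_eq_sum_ite]
  have := sum_mix_out_mul c hc q p
    (fun ω => if (ω.2.2.1, g ω.1 ω.2.2.2) = ((j, v), b) then 1 else 0)
  simp only [mul_ite, mul_one, mul_zero, Prod.mk.injEq] at this ⊢
  rw [this, Finset.sum_eq_single j]
  · simp
  · intro i _ hi; simp [hi]
  · simp

lemma law_mix_out (p : (Fin K → X) → Y → ℝ) {β : Type*} [Fintype β] (g : S → Y → β) (b : β) :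
    law ((mix c hc q).out p) (fun ω => g ω.1 ω.2.2.2) b =
      ∑ j, c j * law ((q j).out p) (fun ω => g ω.1 ω.2.2.2) b := by
  classical
  simp only [law_eq_sum_ite]
  have := sum_mix_out_mul c hc q p (fun ω => if g ω.1 ω.2.2.2 = b then 1 else 0)
  simpa only [mul_ite, mul_one, mul_zero] using this

lemma entropy_mix_out_pair (hpS : pS ∈ stdSimplex ℝ S) {p : (Fin K → X) → Y → ℝ}
    (hp : IsChannel p) {β : Type*} [Fintype β] (g : S → Y → β) :
    entropy ((mix c hc q).out p) (fun ω => (ω.2.2.1, g ω.1 ω.2.2.2)) =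
      ∑ j, c j * (entropy ((q j).out p) (fun ω => (ω.2.2.1, g ω.1 ω.2.2.2))
        - Real.log (c j) / Real.log 2) := by
  simp only [entropy_eq_neg_sum]
  rw [sum_mix_out_mul, ← Finset.sum_neg_distrib, Finset.sum_div]
  refine Finset.sum_congr rfl fun j _ => ?_
  rcases (hc.1 j).eq_or_lt with h0 | h0
  · simp [← h0]
  simp only [law_mix_out_pair]
  have : ∀ ω, (q j).out p ω * Real.log (c j *
      law ((q j).out p) (fun ω => (ω.2.2.1, g ω.1 ω.2.2.2)) (ω.2.2.1, g ω.1 ω.2.2.2)) =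
      (q j).out p ω * Real.log (c j) + (q j).out p ω * Real.log
        (law ((q j).out p) (fun ω => (ω.2.2.1, g ω.1 ω.2.2.2)) (ω.2.2.1, g ω.1 ω.2.2.2)) := by
    intro ω
    rcases ((q j).out_nonneg hp ω).eq_or_lt with h1 | h1
    · simp [← h1]
    · rw [Real.log_mul h0.ne' (h1.trans_le (le_law ((q j).out_nonneg hp)
        (fun ω => (ω.2.2.1, g ω.1 ω.2.2.2)) ω)).ne']
      ring
  simp only [this, Finset.sum_add_distrib]
  rw [← Finset.sum_mul, ((q j).out_mem hpS hp).2]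
  ring

lemma le_entropy_mix_out (hpS : pS ∈ stdSimplex ℝ S) {p : (Fin K → X) → Y → ℝ}
    (hp : IsChannel p) {β : Type*} [Fintype β] (g : S → Y → β) :
    ∑ j, c j * entropy ((q j).out p) (fun ω => g ω.1 ω.2.2.2) ≤
      entropy ((mix c hc q).out p) (fun ω => g ω.1 ω.2.2.2) := by
  rw [entropy_eq_neg_sum ((mix c hc q).out p), sum_mix_out_mul, ← Finset.sum_neg_distrib,
    Finset.sum_div]
  refine Finset.sum_le_sum fun j _ => ?_
  rcases (hc.1 j).eq_or_lt with h0 | h0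
  · simp [← h0]
  have := entropy_le_cross ((q j).out_mem hpS hp) (fun ω => g ω.1 ω.2.2.2)
    (law ((mix c hc q).out p) (fun ω => g ω.1 ω.2.2.2))
    (law_nonneg ((mix c hc q).out_nonneg hp) _)
    (by rw [sum_law, ((mix c hc q).out_mem hpS hp).2])
    (fun ω hω => by
      rw [law_mix_out]
      refine (mul_pos h0 (hω.trans_le (le_law ((q j).out_nonneg hp)
        (fun ω => g ω.1 ω.2.2.2) ω))).trans_le ?_
      exact Finset.single_le_sum
        (f := fun j => c j * law ((q j).out p) (fun ω => g ω.1 ω.2.2.2) (g ω.1 ω.2.2.2))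
        (fun i _ => mul_nonneg (hc.1 i) (law_nonneg ((q i).out_nonneg hp) _ _))
        (Finset.mem_univ j))
  refine (mul_le_mul_of_nonneg_left this h0.le).trans (le_of_eq ?_)
  ring

/-- Time sharing does not decrease the gain: the index is independent of `S` and is part of the
auxiliary variable. -/
lemma le_mix_gain (hpS : pS ∈ stdSimplex ℝ S) (h : S → Sd) {p : (Fin K → X) → Y → ℝ}
    (hp : IsChannel p) :
    ∑ j, c j * gpGain h ((q j).out p) ≤ gpGain h ((mix c hc q).out p) := by
  have hS : entropy ((mix c hc q).out p) (fun ω => ω.1) =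
      ∑ j, c j * entropy ((q j).out p) (fun ω => ω.1) := by
    simp only [entropy, law_out_host _ hp]
    rw [← Finset.sum_mul, hc.2, one_mul]
  have hY := le_entropy_mix_out c hc q hpS hp (fun s y => (y, h s))
  have h1 := entropy_mix_out_pair c hc q hpS hp (fun s _ => s)
  have h2 := entropy_mix_out_pair c hc q hpS hp (fun s y => (y, h s))
  simp only [gpGain, condEntropy]
  rw [h1, h2, hS]
  simp only [mul_sub, Finset.sum_sub_distrib] at *
  linarith

end Mix

end AuxLaw

end AuxLaws

/-! ### Secret sharing -/

section SecretSharing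

variable {β G : Type*} [Fintype β] [Fintype G] [AddCommGroup G] {K : ℕ}

/-- Splits the second coordinate of a pair into `K` shares: given the pair, the shares are uniform
among the `K`-tuples with that sum. -/
def shareLaw (K : ℕ) (P : β × G → ℝ) : β × (Fin K → G) → ℝ :=
  fun ω => P (ω.1, ∑ k, ω.2 k) / (Fintype.card G : ℝ) ^ (K - 1)

lemma card_restrict_fiber (B : Finset (Fin K)) (c : B → G) [DecidableEq G] :
    (∑ u : Fin K → G, if (fun k : B => u k) = c then (1 : ℝ) else 0) =
      (Fintype.card G : ℝ) ^ (K - B.card) := by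
  rw [← (Equiv.piEquivPiSubtypeProd (fun k => k ∈ B) (fun _ => G)).symm.sum_comp,
    Fintype.sum_prod_type, Finset.sum_eq_single c]
  · have : ∀ r : {k // k ∉ B} → G, (fun k : B =>
        (Equiv.piEquivPiSubtypeProd (fun k => k ∈ B) (fun _ => G)).symm (c, r) k) = c := by
      intro r; funext k; simp
    simp only [this, if_true]
    simp [Fintype.card_subtype_compl]
  · intro b _ hb
    have : ∀ r : {k // k ∉ B} → G, (fun k : B =>
        (Equiv.piEquivPiSubtypeProd (fun k => k ∈ B) (fun _ => G)).symm (b, r) k) = b := by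
      intro r; funext k; simp
    simp [hb]
  · simp

/-- Any proper subtuple of shares says nothing about the secret: all of its values are compatible
with equally many completions to each secret. -/
lemma sum_shares_restrict (B : Finset (Fin K)) {k₀ : Fin K} (hk₀ : k₀ ∉ B) (c : B → G)
    (f : G → ℝ) [DecidableEq G] :
    (∑ u : Fin K → G, if (fun k : B => u k) = c then f (∑ k, u k) else 0) =
      (Fintype.card G : ℝ) ^ (K - B.card - 1) * ∑ v, f v := by
  set T := ∑ u : Fin K → G, if (fun k : B => u k) = c then f (∑ k, u k) else 0 with hT
  have hshift : ∀ t : G, T = ∑ u : Fin K → G,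
      if (fun k : B => u k) = c then f (∑ k, u k + t) else 0 := by
    intro t
    rw [hT, ← Fintype.sum_equiv (Equiv.addRight (Pi.single k₀ t : Fin K → G)) _ _ fun _ => rfl]
    refine Finset.sum_congr rfl fun u _ => ?_
    have h1 : (fun k : B => (Equiv.addRight (Pi.single k₀ t : Fin K → G)) u k) =
        fun k : B => u k := by
      funext k
      have : (k : Fin K) ≠ k₀ := fun h => hk₀ (h ▸ k.2)
      simp [this]
    rw [h1]
    simp [Finset.sum_add_distrib]
  have hcard : (Fintype.card G : ℝ) * T = (Fintype.card G : ℝ) ^ (K - B.card) * ∑ v, f v := by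
    calc (Fintype.card G : ℝ) * T = ∑ t : G, T := by simp
      _ = ∑ t : G, ∑ u : Fin K → G, if (fun k : B => u k) = c then f (∑ k, u k + t) else 0 :=
          Finset.sum_congr rfl fun t _ => hshift t
      _ = ∑ u : Fin K → G, if (fun k : B => u k) = c then ∑ v, f v else 0 := by
          rw [Finset.sum_comm]
          refine Finset.sum_congr rfl fun u _ => ?_
          split_ifs
          · exact Fintype.sum_equiv (Equiv.addLeft (∑ k, u k)) _ _ fun _ => rfl
          · simp
      _ = _ := by
          rw [← card_restrict_fiber B c, Finset.sum_mul]
          simp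
  have hlt : B.card < K := by simpa using Finset.card_lt_univ_of_notMem hk₀
  have hG : (Fintype.card G : ℝ) ≠ 0 := by simp
  obtain ⟨n, hn⟩ : ∃ n, K - B.card = n + 1 := ⟨K - B.card - 1, by omega⟩
  rw [hn, pow_succ] at hcard
  rw [hn, Nat.add_sub_cancel]
  apply mul_left_cancel₀ hG
  rw [hcard]
  ring

lemma sum_shares (hK : 1 ≤ K) (f : G → ℝ) :
    ∑ u : Fin K → G, f (∑ k, u k) = (Fintype.card G : ℝ) ^ (K - 1) * ∑ v, f v := by
  classical
  have h := sum_shares_restrict (G := G) (∅ : Finset (Fin K)) (k₀ := ⟨0, hK⟩) (by simp)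
    (fun _ => 0) f
  have : ∀ u : Fin K → G, ((fun k : (∅ : Finset (Fin K)) => u k) = fun _ => 0) :=
    fun u => Subsingleton.elim _ _
  simpa only [this, if_true, Finset.card_empty, Nat.sub_zero] using h

lemma mul_negMulLog_div (x : ℝ) {t : ℝ} (ht : 0 < t) :
    t * Real.negMulLog (x / t) = Real.negMulLog x + x * Real.log t := by
  rcases eq_or_ne x 0 with rfl | hx
  · simp
  · rw [Real.negMulLog, Real.negMulLog, Real.log_div hx ht.ne']
    field_simp
    ring

lemma law_shareLaw_restrict {P : β × G → ℝ} (B : Finset (Fin K)) {k₀ : Fin K} (hk₀ : k₀ ∉ B)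
    (b : β) (c : B → G) :
    law (shareLaw K P) (fun ω => (ω.1, fun k : B => ω.2 k)) (b, c) =
      law P Prod.fst b / (Fintype.card G : ℝ) ^ B.card := by
  classical
  rw [law_eq_sum_ite, law_eq_sum_ite]
  simp only [Fintype.sum_prod_type, shareLaw, Prod.mk.injEq]
  rw [Finset.sum_eq_single b, Finset.sum_eq_single b]
  · simp only [true_and, if_true]
    rw [sum_shares_restrict B hk₀ c (fun v => P (b, v) / (Fintype.card G : ℝ) ^ (K - 1)),
      ← Finset.sum_div]
    have hlt : B.card < K := by simpa using Finset.card_lt_univ_of_notMem hk₀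
    have hG : (Fintype.card G : ℝ) ≠ 0 := by simp
    have : K - 1 = (K - B.card - 1) + B.card := by omega
    rw [this, pow_add]
    field_simp
  · intro a _ ha; simp [ha]
  · simp
  · intro a _ ha; simp [ha]
  · simp

/-- A proper subtuple of the shares is uniform and independent of the first coordinate. -/
lemma entropy_shareLaw_restrict {P : β × G → ℝ} (hP : P ∈ stdSimplex ℝ (β × G))
    (B : Finset (Fin K)) {k₀ : Fin K} (hk₀ : k₀ ∉ B) :
    entropy (shareLaw K P) (fun ω => (ω.1, fun k : B => ω.2 k)) =
      entropy P Prod.fst + B.card * (Real.log (Fintype.card G) / Real.log 2) := by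
  classical
  have hG : (0 : ℝ) < (Fintype.card G : ℝ) ^ B.card := by positivity
  have h1 : ∑ b, law P Prod.fst b = 1 := by rw [sum_law, hP.2]
  simp only [entropy, ← Finset.sum_div, Fintype.sum_prod_type, law_shareLaw_restrict B hk₀]
  simp only [Finset.sum_const, Finset.card_univ, Fintype.card_fun, Fintype.card_coe, nsmul_eq_mul,
    Nat.cast_pow, mul_negMulLog_div _ hG, Finset.sum_add_distrib, ← Finset.sum_mul, h1,
    Real.log_pow]
  ring

lemma entropy_shareLaw (hK : 1 ≤ K) {P : β × G → ℝ} (hP : P ∈ stdSimplex ℝ (β × G)) :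
    entropy (shareLaw K P) (fun ω => ω) =
      entropy P (fun ω => ω) + ((K - 1 : ℕ) : ℝ) * (Real.log (Fintype.card G) / Real.log 2) := by
  have hG : (0 : ℝ) < (Fintype.card G : ℝ) ^ (K - 1) := by positivity
  have h1 : ∑ b, ∑ v, P (b, v) = 1 := by rw [← Fintype.sum_prod_type, hP.2]
  simp only [entropy, ← Finset.sum_div, Fintype.sum_prod_type, law_id, shareLaw]
  have h2 := fun b => sum_shares hK
    (fun v => Real.negMulLog (P (b, v) / (Fintype.card G : ℝ) ^ (K - 1)))
  simp only [h2, Finset.mul_sum, mul_negMulLog_div _ hG, Finset.sum_add_distrib, ← Finset.sum_mul,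
    h1, Real.log_pow]
  ring

end SecretSharing

/-! ### The bound for variables that are shares of a secret -/

section Realization

variable {S Sd X Y : Type*} [Fintype S] [Fintype Sd] [Fintype X] [Fintype Y] {K : ℕ}
  {pS : S → ℝ}

/-- Normalization to a conditional law, which is a dummy when the total mass is zero. -/
lemma exists_condLaw {V : Type*} [Fintype V] [Nonempty V] (Q : V → ℝ) (hQ : ∀ v, 0 ≤ Q v) :
    ∃ t ∈ stdSimplex ℝ V, ∀ v, Q v = (∑ v, Q v) * t v := by
  classical
  rcases eq_or_ne (∑ v, Q v) 0 with h | h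
  · obtain ⟨v₀⟩ := ‹Nonempty V›
    refine ⟨Pi.single v₀ 1, single_mem_stdSimplex ℝ v₀, fun v => ?_⟩
    rw [h, zero_mul]
    exact (Finset.sum_eq_zero_iff_of_nonneg fun v _ => hQ v).1 h v (Finset.mem_univ v)
  · refine ⟨fun v => Q v / ∑ v, Q v, ⟨fun v => div_nonneg (hQ v)
      (Finset.sum_nonneg fun v _ => hQ v), by rw [← Finset.sum_div, div_self h]⟩, fun v => ?_⟩
    field_simp

section

variable {Lw n : ℕ} {θ : OuterLaw S X K Lw (n + 1)} {q : AuxLaw pS X K (Fin Lw) (Fin (n + 1))}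
  {p : (Fin K → X) → Y → ℝ}

lemma law_joint_of_shares
    (hθ : ∀ s w x u y, θ.joint pS p (s, w, x, u, y) =
      q.Q s w x (∑ k, u k) * p x y / (Fintype.card (Fin (n + 1)) : ℝ) ^ (K - 1))
    {β : Type*} [Fintype β] (g : S → Y → β) :
    law (θ.joint pS p) (fun ω => (g ω.1 ω.2.2.2.2, ω.2.2.2.1)) =
      shareLaw K (law (q.out p) (fun ω => (g ω.1 ω.2.2.2, ω.2.2.1))) := by
  classical
  funext ⟨b, u⟩
  simp only [shareLaw]
  rw [law_eq_sum_ite, law_eq_sum_ite, Finset.sum_div]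
  simp only [Fintype.sum_prod_type, Prod.mk.injEq, hθ, AuxLaw.out]
  refine Finset.sum_congr rfl fun s _ => ?_
  rw [Finset.sum_comm]
  refine Finset.sum_congr rfl fun x _ => ?_
  have h1 : ∀ w : Fin Lw, ∑ u' : Fin K → Fin (n + 1), ∑ y, (if g s y = b ∧ u' = u then
      q.Q s w x (∑ k, u' k) * p x y / (Fintype.card (Fin (n + 1)) : ℝ) ^ (K - 1) else 0) =
      ∑ y, if g s y = b then
        q.Q s w x (∑ k, u k) * p x y / (Fintype.card (Fin (n + 1)) : ℝ) ^ (K - 1) else 0 := by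
    intro w
    rw [Finset.sum_eq_single u]
    · simp
    · intro u' _ hu; simp [hu]
    · simp
  simp only [h1]
  rw [Finset.sum_comm, Finset.sum_eq_single (∑ k, u k)]
  · refine Finset.sum_congr rfl fun y _ => ?_
    by_cases hg : g s y = b
    · simp [hg, ← Finset.sum_div, Finset.sum_mul]
    · simp [hg]
  · intro v _ hv; simp [hv]
  · simp

lemma entropy_joint_full (hK : 1 ≤ K) (hpS : pS ∈ stdSimplex ℝ S) (hp : IsChannel p)
    (hθ : ∀ s w x u y, θ.joint pS p (s, w, x, u, y) =
      q.Q s w x (∑ k, u k) * p x y / (Fintype.card (Fin (n + 1)) : ℝ) ^ (K - 1))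
    {β : Type*} [Fintype β] (g : S → Y → β) (A : Finset (Fin K)) :
    entropy (θ.joint pS p) (fun ω => ((fun k : A => ω.2.2.2.1 k),
        (g ω.1 ω.2.2.2.2, fun k : ↥(Aᶜ) => ω.2.2.2.1 k))) =
      entropy (q.out p) (fun ω => (ω.2.2.1, g ω.1 ω.2.2.2)) +
        ((K - 1 : ℕ) : ℝ) * (Real.log (Fintype.card (Fin (n + 1))) / Real.log 2) := by
  have h1 := entropy_law (θ.joint pS p) (fun ω => (g ω.1 ω.2.2.2.2, ω.2.2.2.1)) (fun c => c)
  have h2 := entropy_law (q.out p) (fun ω => (g ω.1 ω.2.2.2, ω.2.2.1)) (fun c => c)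
  rw [law_joint_of_shares hθ, entropy_shareLaw hK (law_mem_stdSimplex (q.out_mem hpS hp) _),
    h2] at h1
  rw [entropy_congr (q.out p) (g := fun ω => (g ω.1 ω.2.2.2, ω.2.2.1))
    (fun ω ω' => by simp only [Prod.mk.injEq]; tauto), h1]
  refine entropy_congr _ fun ω ω' => ?_
  simp only [Prod.mk.injEq, funext_iff, Subtype.forall, Finset.mem_compl]
  constructor
  · rintro ⟨hA, hg, hAc⟩
    exact ⟨hg, fun k => if hk : k ∈ A then hA k hk else hAc k hk⟩
  · rintro ⟨hg, hu⟩
    exact ⟨fun k _ => hu k, hg, fun k _ => hu k⟩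

lemma entropy_joint_restrict (hpS : pS ∈ stdSimplex ℝ S) (hp : IsChannel p)
    (hθ : ∀ s w x u y, θ.joint pS p (s, w, x, u, y) =
      q.Q s w x (∑ k, u k) * p x y / (Fintype.card (Fin (n + 1)) : ℝ) ^ (K - 1))
    {β : Type*} [Fintype β] (g : S → Y → β) (B : Finset (Fin K)) {k₀ : Fin K} (hk₀ : k₀ ∉ B) :
    entropy (θ.joint pS p) (fun ω => (g ω.1 ω.2.2.2.2, fun k : B => ω.2.2.2.1 k)) =
      entropy (q.out p) (fun ω => g ω.1 ω.2.2.2) +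
        B.card * (Real.log (Fintype.card (Fin (n + 1))) / Real.log 2) := by
  have h1 := entropy_law (θ.joint pS p) (fun ω => (g ω.1 ω.2.2.2.2, ω.2.2.2.1))
    (fun c => (c.1, fun k : B => c.2 k))
  have h2 := entropy_law (q.out p) (fun ω => (g ω.1 ω.2.2.2, ω.2.2.1)) Prod.fst
  rw [law_joint_of_shares hθ,
    entropy_shareLaw_restrict (law_mem_stdSimplex (q.out_mem hpS hp) _) B hk₀, h2] at h1
  exact h1.symm

/-- When the `U_k` are shares of `V`, every coalition sees the same information about `V`: the
tuple of the other shares carries none of it. -/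
lemma J_eq_of_shares (hK : 1 ≤ K) (hpS : pS ∈ stdSimplex ℝ S) (hp : IsChannel p)
    (hθ : ∀ s w x u y, θ.joint pS p (s, w, x, u, y) =
      q.Q s w x (∑ k, u k) * p x y / (Fintype.card (Fin (n + 1)) : ℝ) ^ (K - 1))
    (h : S → Sd) {A : Finset (Fin K)} (hA : A.Nonempty) :
    θ.J pS h p A = 1 / (A.card : ℝ) * gpGain h (q.out p) := by
  obtain ⟨k₀, hk₀⟩ := hA
  have hk₀' : k₀ ∉ Aᶜ := by simpa using hk₀
  have h1 := entropy_joint_full hK hpS hp hθ (fun s _ => s) A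
  have h2 := entropy_joint_full hK hpS hp hθ (fun s y => (y, h s)) A
  have h3 := entropy_joint_restrict hpS hp hθ (fun s _ => s) Aᶜ hk₀'
  have h4 := entropy_joint_restrict hpS hp hθ (fun s y => (y, h s)) Aᶜ hk₀'
  simp only [OuterLaw.J, condMutualInfo, gpGain, condEntropy, h1, h2, h3, h4]
  ring

end

/-- The variables of the max-min bound obtained by splitting the auxiliary variable into `K`
shares. -/
lemma exists_outerLaw (hK : 1 ≤ K) (hpS : pS ∈ stdSimplex ℝ S) {Lw n : ℕ}
    (q : AuxLaw pS X K (Fin Lw) (Fin (n + 1))) :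
    ∃ θ : OuterLaw S X K Lw (n + 1), (∀ d, θ.distortion pS d = q.distortion d) ∧
      ∀ (h : S → Sd) (p : (Fin K → X) → Y → ℝ), IsChannel p → ∀ A : Finset (Fin K), A.Nonempty →
        θ.J pS h p A = 1 / (A.card : ℝ) * gpGain h (q.out p) := by
  choose t ht htQ using fun (s : S) (w : Fin Lw) (x : Fin K → X) =>
    exists_condLaw (q.Q s w x) (q.Q_nonneg s w x)
  have hL : (Fintype.card (Fin (n + 1)) : ℝ) ^ (K - 1) ≠ 0 := by
    rw [Fintype.card_fin]; positivity
  refine ⟨⟨q.pW, q.pX, fun x s w u => t s w x (∑ k, u k) /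
      (Fintype.card (Fin (n + 1)) : ℝ) ^ (K - 1), q.pW_mem,
    q.pX_mem, fun x s w => ⟨fun u => div_nonneg ((ht _ _ _).1 _) (by positivity), ?_⟩⟩,
    fun d => rfl, ?_⟩
  · rw [← Finset.sum_div, sum_shares hK, (ht _ _ _).2, mul_one, div_self hL]
  · intro h p hp A hA
    refine J_eq_of_shares hK hpS hp (fun s w x u y => ?_) h hA
    simp only [OuterLaw.joint]
    rw [htQ, q.Q_sum]
    ring

lemma AuxLaw.nonempty_V {W V : Type*} [Fintype W] [Fintype V] (q : AuxLaw pS X K W V)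
    (hpS : pS ∈ stdSimplex ℝ S) : Nonempty V := by
  by_contra hc
  rw [not_nonempty_iff] at hc
  have := hpS.2
  simp [← q.sum_Q] at this

/-- An auxiliary law is realized within the max-min bound for all sufficiently large alphabets. -/
lemma exists_outerLaw_of_card_le (hK : 1 ≤ K) (hpS : pS ∈ stdSimplex ℝ S) {W V : Type*} [Fintype W]
    [Fintype V] (q : AuxLaw pS X K W V) {Lw Lu : ℕ} (hLw : Fintype.card W ≤ Lw)
    (hLu : Fintype.card V ≤ Lu) :
    ∃ θ : OuterLaw S X K Lw Lu, (∀ d, θ.distortion pS d = q.distortion d) ∧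
      ∀ (h : S → Sd) (p : (Fin K → X) → Y → ℝ), IsChannel p → ∀ A : Finset (Fin K), A.Nonempty →
        θ.J pS h p A = 1 / (A.card : ℝ) * gpGain h (q.out p) := by
  have hW := q.nonempty_W
  have hV := q.nonempty_V hpS
  obtain ⟨n, rfl⟩ : ∃ n, Lu = n + 1 :=
    ⟨Lu - 1, by have := Fintype.card_pos (α := V); omega⟩
  obtain ⟨ι⟩ := Function.Embedding.nonempty_of_card_le (α := W) (β := Fin Lw) (by simpa using hLw)
  obtain ⟨κ⟩ := Function.Embedding.nonempty_of_card_le (α := V) (β := Fin (n + 1))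
    (by simpa using hLu)
  obtain ⟨θ, h1, h2⟩ := exists_outerLaw (Sd := Sd) (Y := Y) hK hpS (q.relabel ι κ)
  refine ⟨θ, fun d => by rw [h1, q.relabel_distortion], fun h p hp A hA => ?_⟩
  rw [h2 h p hp A hA, q.relabel_gain]

end Realization

/-! ### The max-min bound: minimax and the limit of large alphabets -/

section Bound

variable {S Sd X Y : Type*} [Fintype S] [Fintype Sd] [Fintype X] [Fintype Y] {K : ℕ}
  {pS : S → ℝ}

lemma entropy_le_log_card_sample {Ω α : Type*} [Fintype Ω] [Fintype α] {P : Ω → ℝ}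
    (hP : P ∈ stdSimplex ℝ Ω) (f : Ω → α) :
    entropy P f ≤ Real.log (Fintype.card Ω) / Real.log 2 :=
  (entropy_mono hP.1 fun _ _ h => congrArg f h).trans (entropy_le_log_card hP (fun ω => ω))

/-- An outer law, with the whole tuple `U_𝒦` as the single auxiliary variable. -/
def OuterLaw.toAux {Lw Lu : ℕ} (θ : OuterLaw S X K Lw Lu) (hpS : pS ∈ stdSimplex ℝ S) :
    AuxLaw pS X K (Fin Lw) (Fin K → Fin Lu) where
  pW := θ.pW
  pX := θ.pX
  Q s w x u := pS s * θ.pW w * (∏ k, θ.pX s w (x k)) * θ.pU x s w u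
  pW_mem := θ.pW_mem
  pX_mem := θ.pX_mem
  Q_nonneg s w x u := mul_nonneg (mul_nonneg (mul_nonneg (hpS.1 s) (θ.pW_mem.1 w))
    (Finset.prod_nonneg fun k _ => (θ.pX_mem s w).1 _)) ((θ.pU_mem x s w).1 u)
  Q_sum s w x := by rw [← Finset.mul_sum, (θ.pU_mem x s w).2, mul_one]

namespace OuterLaw

variable {Lw Lu : ℕ} (θ : OuterLaw S X K Lw Lu) (hpS : pS ∈ stdSimplex ℝ S)

lemma law_joint (p : (Fin K → X) → Y → ℝ) :
    law (θ.joint pS p) (fun ω => (ω.1, ω.2.2.1, ω.2.2.2.1, ω.2.2.2.2)) = (θ.toAux hpS).out p := by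
  classical
  funext ⟨s, x, u, y⟩
  rw [law_eq_sum_ite]
  simp only [Fintype.sum_prod_type, Prod.mk.injEq, AuxLaw.out, joint, toAux]
  rw [Finset.sum_eq_single s]
  · rw [Finset.sum_mul]
    refine Finset.sum_congr rfl fun w _ => ?_
    rw [Finset.sum_eq_single x, Finset.sum_eq_single u, Finset.sum_eq_single y]
    · simp
    · intro b _ hb; simp [hb]
    · simp
    · intro b _ hb; simp [hb]
    · simp
    · intro b _ hb; simp [hb]
    · simp
  · intro b _ hb; simp [hb]
  · simp

include hpS in
lemma joint_mem {p : (Fin K → X) → Y → ℝ} (hp : IsChannel p) :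
    θ.joint pS p ∈ stdSimplex ℝ (Sample S X Y K Lw Lu) :=
  ⟨fun ω => mul_nonneg ((θ.toAux hpS).Q_nonneg ω.1 ω.2.1 ω.2.2.1 ω.2.2.2.1) ((hp _).1 _), by
    rw [← sum_law _ (fun ω : Sample S X Y K Lw Lu => (ω.1, ω.2.2.1, ω.2.2.2.1, ω.2.2.2.2)),
      θ.law_joint hpS, ((θ.toAux hpS).out_mem hpS hp).2]⟩

lemma J_univ (h : S → Sd) (p : (Fin K → X) → Y → ℝ) :
    θ.J pS h p Finset.univ = 1 / (K : ℝ) * gpGain h ((θ.toAux hpS).out p) := by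
  rw [← θ.law_joint hpS]
  simp only [OuterLaw.J, condMutualInfo, gpGain, condEntropy, entropy_law, Finset.card_univ,
    Fintype.card_fin]
  have he : IsEmpty ↥((Finset.univ : Finset (Fin K))ᶜ) :=
    ⟨fun k => Finset.mem_compl.1 k.2 (Finset.mem_univ _)⟩
  have hu : ∀ u u' : Fin K → Fin Lu, ((fun k : (Finset.univ : Finset (Fin K)) => u k) =
      fun k : (Finset.univ : Finset (Fin K)) => u' k) ↔ u = u' := fun u u' => by
    simp [funext_iff]
  have h1 : entropy (θ.joint pS p) (fun ω => ((fun k : (Finset.univ : Finset (Fin K)) =>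
      ω.2.2.2.1 k), ((ω.2.2.2.2, h ω.1), fun k : ↥((Finset.univ : Finset (Fin K))ᶜ) =>
      ω.2.2.2.1 k))) = entropy (θ.joint pS p) (fun ω => (ω.2.2.2.1, ω.2.2.2.2, h ω.1)) :=
    entropy_congr _ fun ω ω' => by simp [hu, eq_iff_true_of_subsingleton]
  have h2 : entropy (θ.joint pS p) (fun ω => ((fun k : (Finset.univ : Finset (Fin K)) =>
      ω.2.2.2.1 k), (ω.1, fun k : ↥((Finset.univ : Finset (Fin K))ᶜ) =>
      ω.2.2.2.1 k))) = entropy (θ.joint pS p) (fun ω => (ω.2.2.2.1, ω.1)) :=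
    entropy_congr _ fun ω ω' => by simp [hu, eq_iff_true_of_subsingleton]
  have h3 : entropy (θ.joint pS p) (fun ω => (ω.1, fun k : ↥((Finset.univ : Finset (Fin K))ᶜ) =>
      ω.2.2.2.1 k)) = entropy (θ.joint pS p) (fun ω => ω.1) :=
    entropy_congr _ fun ω ω' => by simp [eq_iff_true_of_subsingleton]
  have h4 : entropy (θ.joint pS p) (fun ω => ((ω.2.2.2.2, h ω.1),
      fun k : ↥((Finset.univ : Finset (Fin K))ᶜ) => ω.2.2.2.1 k)) =
      entropy (θ.joint pS p) (fun ω => (ω.2.2.2.2, h ω.1)) :=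
    entropy_congr _ fun ω ω' => by simp [eq_iff_true_of_subsingleton]
  rw [h1, h2, h3, h4]
  ring

include hpS in
/-- A bound uniform in the channel and in `A`, so that the infima in the max-min bound are taken
over sets bounded below. -/
lemma neg_log_card_le_J (h : S → Sd) {p : (Fin K → X) → Y → ℝ} (hp : IsChannel p)
    {A : Finset (Fin K)} (hA : A.Nonempty) :
    -(Real.log (Fintype.card (Sample S X Y K Lw Lu)) / Real.log 2) ≤ θ.J pS h p A := by
  have hP := θ.joint_mem hpS hp
  have hA1 : (1 : ℝ) ≤ A.card := by exact_mod_cast hA.card_pos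
  have hA2 : 1 / (A.card : ℝ) ≤ 1 := by rw [div_le_one (by linarith)]; exact hA1
  have hA3 : 0 ≤ 1 / (A.card : ℝ) := by positivity
  simp only [OuterLaw.J, condMutualInfo, condEntropy]
  have h1 := entropy_le_log_card_sample hP (fun ω => ((fun k : A => ω.2.2.2.1 k),
    ((ω.2.2.2.2, h ω.1), fun k : ↥(Aᶜ) => ω.2.2.2.1 k)))
  have h2 := entropy_nonneg hP (fun ω => ((ω.2.2.2.2, h ω.1), fun k : ↥(Aᶜ) => ω.2.2.2.1 k))
  have h3 : entropy (θ.joint pS p) (fun ω => (ω.1, fun k : ↥(Aᶜ) => ω.2.2.2.1 k)) ≤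
      entropy (θ.joint pS p) (fun ω => ((fun k : A => ω.2.2.2.1 k),
        (ω.1, fun k : ↥(Aᶜ) => ω.2.2.2.1 k))) :=
    entropy_mono hP.1 fun _ _ h => (Prod.ext_iff.1 h).2
  have h4 := (entropy_nonneg hP (fun ω => ω.1)).trans
    (entropy_le_log_card_sample hP (fun ω => ω.1))
  refine le_trans (b := 1 / (A.card : ℝ) *
    -(Real.log (Fintype.card (Sample S X Y K Lw Lu)) / Real.log 2)) ?_
    (mul_le_mul_of_nonneg_left (by linarith) hA3)
  nlinarith

end OuterLaw

/-- The gain is at most `H(Y, S^d)`. -/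
lemma gpGain_le {W V : Type*} [Fintype W] [Fintype V] (q : AuxLaw pS X K W V)
    (hpS : pS ∈ stdSimplex ℝ S) (h : S → Sd) {p : (Fin K → X) → Y → ℝ} (hp : IsChannel p) :
    gpGain h (q.out p) ≤ Real.log (Fintype.card (Y × Sd)) / Real.log 2 := by
  have hP := q.out_mem hpS hp
  have h1 := entropy_pair_le hP (fun ω => ω.2.2.1) (fun ω => ω.1)
  have h2 : entropy (q.out p) (fun ω => ω.2.2.1) ≤
      entropy (q.out p) (fun ω => (ω.2.2.1, ω.2.2.2, h ω.1)) :=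
    entropy_mono hP.1 fun _ _ h => (Prod.ext_iff.1 h).1
  have h3 := entropy_le_log_card hP (fun ω => (ω.2.2.2, h ω.1))
  simp only [gpGain, condEntropy]
  linarith

/-- The law with the auxiliary variable dropped. -/
def AuxLaw.forget {W V : Type*} [Fintype W] [Fintype V] (q : AuxLaw pS X K W V) :
    AuxLaw pS X K W Unit where
  pW := q.pW
  pX := q.pX
  Q s w x _ := ∑ v, q.Q s w x v
  pW_mem := q.pW_mem
  pX_mem := q.pX_mem
  Q_nonneg s w x _ := Finset.sum_nonneg fun v _ => q.Q_nonneg s w x v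
  Q_sum s w x := by simpa using q.Q_sum s w x

lemma gpGain_forget {W V : Type*} [Fintype W] [Fintype V] (q : AuxLaw pS X K W V) (h : S → Sd)
    (p : (Fin K → X) → Y → ℝ) : gpGain h (q.forget.out p) = 0 := by
  simp only [gpGain, condEntropy]
  rw [entropy_congr (q.forget.out p) (f := fun ω => (ω.2.2.1, ω.1)) (g := fun ω => ω.1) (by simp),
    entropy_congr (q.forget.out p) (f := fun ω => (ω.2.2.1, ω.2.2.2, h ω.1))
      (g := fun ω => (ω.2.2.2, h ω.1)) (by simp)]
  ring

/-- Minimax: against a compact convex class of channels, if every channel is beaten by some law,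
then one time-sharing mixture of finitely many of these laws beats them all. -/
lemma exists_auxLaw_forall_channel (hpS : pS ∈ stdSimplex ℝ S) (h : S → Sd) (d : S → X → NNReal)
    (D₁ : ℝ) {C : Set ((Fin K → X) → Y → ℝ)} (hC : IsCompact C) (hCc : Convex ℝ C)
    (hne : C.Nonempty) (hCp : ∀ p ∈ C, IsChannel p) (c : ℝ)
    (hbeat : ∀ p ∈ C, ∃ (a b : ℕ) (q : AuxLaw pS X K (Fin a) (Fin b)), q.distortion d ≤ D₁ ∧
      c < gpGain h (q.out p)) :
    ∃ (a b : ℕ) (q : AuxLaw pS X K (Fin a) (Fin b)), q.distortion d ≤ D₁ ∧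
      ∀ p ∈ C, c ≤ gpGain h (q.out p) := by
  classical
  choose a b q hqd hqc using fun p : C => hbeat p p.2
  obtain ⟨t, hcov⟩ := hC.elim_nhds_subcover' (fun p hp => {p' | c < gpGain h ((q ⟨p, hp⟩).out p')})
    fun p hp => (isOpen_lt continuous_const
      ((q ⟨p, hp⟩).continuous_gpGain h)).mem_nhds (hqc ⟨p, hp⟩)
  have htne : Nonempty t := by
    obtain ⟨p, hp⟩ := hne
    obtain ⟨x, hx, -⟩ := Set.mem_iUnion₂.1 (hcov hp)
    exact ⟨⟨x, hx⟩⟩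
  have hWne : ∀ p, Nonempty (Fin (a p)) := fun p => (q p).nonempty_W
  have hA : ∀ j : t, a j ≤ t.sup a := fun j => Finset.le_sup j.2
  have hB : ∀ j : t, b j ≤ t.sup b := fun j => Finset.le_sup j.2
  set A := t.sup a
  set B := t.sup b
  -- All the laws of the finite subcover, on common alphabets.
  set r : t → AuxLaw pS X K (Fin A) (Fin B) := fun j => (q j).relabel
    (Fin.castLEEmb (hA j)) (Fin.castLEEmb (hB j)) with hr
  have hrg : ∀ (j : t) (p : (Fin K → X) → Y → ℝ),
      gpGain h ((r j).out p) = gpGain h ((q j).out p) := fun j p =>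
    (q j).relabel_gain (Fin.castLEEmb (hA j)) (Fin.castLEEmb (hB j)) h p
  have hcont : Continuous fun z : ((Fin K → X) → Y → ℝ) × (t → ℝ) =>
      ∑ j, z.2 j * gpGain h ((r j).out z.1) :=
    continuous_finsetSum _ fun j _ => ((continuous_apply j).comp continuous_snd).mul
      (((r j).continuous_gpGain h).comp continuous_fst)
  obtain ⟨p₀, hp₀, c₀, hc₀, hsad⟩ := Sion.exists_isSaddlePointOn (X := C) (Y := stdSimplex ℝ t)
    (f := fun p c' => ∑ j, c' j * gpGain h ((r j).out p)) hne hCc hC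
    (fun c' _ => (hcont.comp (Continuous.prodMk_left c')).continuousOn.lowerSemicontinuousOn)
    (fun c' hc' => by
      refine ConvexOn.quasiconvexOn ⟨hCc, fun p hp p' hp' α β hα hβ hαβ => ?_⟩
      have hj : ∀ j, c' j * gpGain h ((r j).out (α • p + β • p')) ≤
          α * (c' j * gpGain h ((r j).out p)) + β * (c' j * gpGain h ((r j).out p')) := by
        intro j
        have := ((r j).convexOn_gpGain h hCc hCp).2 hp hp' hα hβ hαβ
        simp only [smul_eq_mul] at this
        nlinarith [mul_le_mul_of_nonneg_left this (hc'.1 j)]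
      simp only [smul_eq_mul, Finset.mul_sum, ← Finset.sum_add_distrib]
      exact Finset.sum_le_sum fun j _ => hj j)
    (convex_stdSimplex ℝ t) ⟨_, single_mem_stdSimplex ℝ htne.some⟩ (isCompact_stdSimplex ℝ t)
    (fun p _ => (hcont.comp (Continuous.prodMk_right p)).continuousOn.upperSemicontinuousOn)
    (fun p _ => by
      refine ConcaveOn.quasiconcaveOn ⟨convex_stdSimplex ℝ t, fun x _ x' _ α β _ _ _ => ?_⟩
      simp only [smul_eq_mul, Finset.mul_sum, ← Finset.sum_add_distrib, Pi.add_apply,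
        Pi.smul_apply]
      exact Finset.sum_le_sum fun j _ => by nlinarith)
  set m := AuxLaw.mix c₀ hc₀ r with hm
  have hmW := m.nonempty_W
  refine ⟨_, _, m.relabel (Fintype.equivFin _).toEmbedding (Fintype.equivFin _).toEmbedding,
    ?_, fun p hp => ?_⟩
  · rw [m.relabel_distortion, AuxLaw.mix_distortion]
    have : ∀ j, c₀ j * (r j).distortion d ≤ c₀ j * D₁ := fun j =>
      mul_le_mul_of_nonneg_left (((q j).relabel_distortion (Fin.castLEEmb (hA j))
        (Fin.castLEEmb (hB j)) d).trans_le (hqd j)) (hc₀.1 j)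
    refine (Finset.sum_le_sum fun j _ => this j).trans ?_
    rw [← Finset.sum_mul, hc₀.2, one_mul]
  -- At the saddle point `(p₀, c₀)`, the weights `c₀` do at least as well against any `p` as the
  -- law that covers `p₀` does against `p₀`.
  · rw [m.relabel_gain]
    refine le_trans ?_ (AuxLaw.le_mix_gain c₀ hc₀ r hpS h (hCp p hp))
    obtain ⟨j, hj, hjc⟩ := Set.mem_iUnion₂.1 (hcov hp₀)
    have := hsad p hp (Pi.single ⟨j, hj⟩ 1) (single_mem_stdSimplex ℝ _)
    refine le_trans ?_ this
    simp only [hrg]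
    rw [Finset.sum_eq_single ⟨j, hj⟩]
    · simpa using le_of_lt hjc
    · intro i _ hi; simp [hi]
    · simp

section Limit

variable (hK : 1 ≤ K) (hpS : pS ∈ stdSimplex ℝ S) (h : S → Sd) (d : S → X → NNReal) (D₁ : ℝ)
  {𝒲 : Set ((Fin K → X) → Y → ℝ)} (h𝒲 : ∀ p ∈ 𝒲, IsChannel p) (hne : 𝒲.Nonempty)

include hK hpS h𝒲

lemma iInf_J_le {Lw Lu : ℕ} (θ : OuterLaw S X K Lw Lu) {p : (Fin K → X) → Y → ℝ} (hp : p ∈ 𝒲) :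
    (⨅ (p : 𝒲) (A : {A : Finset (Fin K) // A.Nonempty}), θ.J pS h p.1 A.1) ≤
      1 / (K : ℝ) * gpGain h ((θ.toAux hpS).out p) := by
  have hKne : (Finset.univ : Finset (Fin K)).Nonempty := ⟨⟨0, hK⟩, Finset.mem_univ _⟩
  have hA : Nonempty {A : Finset (Fin K) // A.Nonempty} := ⟨⟨_, hKne⟩⟩
  rw [← θ.J_univ hpS]
  have hbdd : BddBelow (Set.range fun p : 𝒲 =>
      ⨅ A : {A : Finset (Fin K) // A.Nonempty}, θ.J pS h p.1 A.1) := by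
    refine ⟨-(Real.log (Fintype.card (Sample S X Y K Lw Lu)) / Real.log 2), ?_⟩
    rintro _ ⟨p, rfl⟩
    exact le_ciInf fun A => θ.neg_log_card_le_J hpS h (h𝒲 _ p.2) A.2
  have hbdd' : BddBelow (Set.range fun A : {A : Finset (Fin K) // A.Nonempty} =>
      θ.J pS h p A.1) := by
    refine ⟨-(Real.log (Fintype.card (Sample S X Y K Lw Lu)) / Real.log 2), ?_⟩
    rintro _ ⟨A, rfl⟩
    exact θ.neg_log_card_le_J hpS h (h𝒲 _ hp) A.2
  exact (ciInf_le hbdd ⟨p, hp⟩).trans (ciInf_le hbdd' ⟨_, hKne⟩)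

include hne

lemma bddAbove_outerBound_set (Lw Lu : ℕ) :
    BddAbove {r : ℝ | ∃ θ : OuterLaw S X K Lw Lu, θ.distortion pS d ≤ D₁ ∧
      r = ⨅ (p : 𝒲) (A : {A : Finset (Fin K) // A.Nonempty}), θ.J pS h p.1 A.1} := by
  refine ⟨1 / (K : ℝ) * (Real.log (Fintype.card (Y × Sd)) / Real.log 2), ?_⟩
  rintro _ ⟨θ, -, rfl⟩
  obtain ⟨p, hp⟩ := hne
  exact (iInf_J_le hK hpS h h𝒲 θ hp).trans (mul_le_mul_of_nonneg_left
    (gpGain_le _ hpS h (h𝒲 p hp)) (by positivity))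

lemma le_outerBound {W V : Type*} [Fintype W] [Fintype V] (q : AuxLaw pS X K W V)
    (hqd : q.distortion d ≤ D₁) {c : ℝ} (hc : 0 ≤ c) (hcq : ∀ p ∈ 𝒲, c ≤ gpGain h (q.out p))
    {Lw Lu : ℕ} (hLw : Fintype.card W ≤ Lw) (hLu : Fintype.card V ≤ Lu) :
    c / K ≤ outerBound pS h d D₁ 𝒲 Lw Lu := by
  obtain ⟨θ, h1, h2⟩ := exists_outerLaw_of_card_le (Sd := Sd) (Y := Y) hK hpS q hLw hLu
  have hKne : (Finset.univ : Finset (Fin K)).Nonempty := ⟨⟨0, hK⟩, Finset.mem_univ _⟩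
  have hA : Nonempty {A : Finset (Fin K) // A.Nonempty} := ⟨⟨_, hKne⟩⟩
  have hW : Nonempty 𝒲 := hne.to_subtype
  refine le_trans ?_ (le_csSup (bddAbove_outerBound_set hK hpS h d D₁ h𝒲 hne Lw Lu)
    ⟨θ, (h1 d).trans_le hqd, rfl⟩)
  refine le_ciInf fun p => le_ciInf fun A => ?_
  rw [h2 h p (h𝒲 _ p.2) A A.2, one_div_mul_eq_div]
  have hApos : (0 : ℝ) < A.1.card := by exact_mod_cast A.2.card_pos
  have hAK : (A.1.card : ℝ) ≤ K := by
    exact_mod_cast (Finset.card_le_univ A.1).trans_eq (Fintype.card_fin K)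
  exact (div_le_div_of_nonneg_left hc hApos hAK).trans
    (div_le_div_of_nonneg_right (hcq p p.2) hApos.le)

lemma outerBound_nonneg (Lw Lu : ℕ) : 0 ≤ outerBound pS h d D₁ 𝒲 Lw Lu := by
  rcases Set.eq_empty_or_nonempty {r : ℝ | ∃ θ : OuterLaw S X K Lw Lu, θ.distortion pS d ≤ D₁ ∧
      r = ⨅ (p : 𝒲) (A : {A : Finset (Fin K) // A.Nonempty}), θ.J pS h p.1 A.1} with he | he
  · rw [outerBound, he, Real.sSup_empty]
  · obtain ⟨_, θ, hθ, -⟩ := he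
    obtain ⟨u⟩ := (θ.toAux hpS).nonempty_V hpS
    have hLu : 1 ≤ Lu := (Nat.zero_le _).trans_lt (u ⟨0, hK⟩).2
    have := le_outerBound hK hpS h d D₁ h𝒲 hne (θ.toAux hpS).forget hθ le_rfl
      (fun p _ => (gpGain_forget _ h p).ge) (Lw := Lw) (Lu := Lu) (by simp) (by simpa using hLu)
    simpa using this

/-- The max-min bounds converge, since any value attained with some alphabets is attained with all
larger ones. -/
lemma exists_tendsto_outerBound :
    ∃ C : ℝ, Tendsto (fun L : ℕ × ℕ => outerBound pS h d D₁ 𝒲 L.1 L.2) atTop (𝓝 C) ∧ 0 ≤ C ∧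
      ∀ L : ℕ × ℕ, outerBound pS h d D₁ 𝒲 L.1 L.2 ≤ C := by
  have hbdd : BddAbove (Set.range fun L : ℕ × ℕ => outerBound pS h d D₁ 𝒲 L.1 L.2) := by
    refine ⟨max 0 (1 / (K : ℝ) * (Real.log (Fintype.card (Y × Sd)) / Real.log 2)), ?_⟩
    rintro _ ⟨L, rfl⟩
    refine Real.sSup_le ?_ (le_max_left _ _)
    rintro _ ⟨θ, -, rfl⟩
    obtain ⟨p, hp⟩ := hne
    exact (iInf_J_le hK hpS h h𝒲 θ hp).trans ((mul_le_mul_of_nonneg_left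
      (gpGain_le _ hpS h (h𝒲 p hp)) (by positivity)).trans (le_max_right _ _))
  have hle : ∀ L : ℕ × ℕ, outerBound pS h d D₁ 𝒲 L.1 L.2 ≤
      ⨆ L : ℕ × ℕ, outerBound pS h d D₁ 𝒲 L.1 L.2 := fun L => le_ciSup hbdd L
  refine ⟨⨆ L : ℕ × ℕ, outerBound pS h d D₁ 𝒲 L.1 L.2, ?_,
    (outerBound_nonneg hK hpS h d D₁ h𝒲 hne 0 0).trans (hle (0, 0)), hle⟩
  refine tendsto_order.2 ⟨fun a ha => ?_, fun a ha => Eventually.of_forall fun L =>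
    (hle L).trans_lt ha⟩
  rcases lt_or_ge a 0 with ha0 | ha0
  · exact Eventually.of_forall fun L => ha0.trans_le (outerBound_nonneg hK hpS h d D₁ h𝒲 hne _ _)
  obtain ⟨L₀, hL₀⟩ := exists_lt_of_lt_ciSup ha
  have hset : {r : ℝ | ∃ θ : OuterLaw S X K L₀.1 L₀.2, θ.distortion pS d ≤ D₁ ∧
      r = ⨅ (p : 𝒲) (A : {A : Finset (Fin K) // A.Nonempty}), θ.J pS h p.1 A.1}.Nonempty := by
    by_contra hc
    rw [Set.not_nonempty_iff_eq_empty] at hc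
    simp only [outerBound, hc, Real.sSup_empty] at hL₀
    linarith
  obtain ⟨_, ⟨θ, hθ, rfl⟩, hr⟩ := exists_lt_of_lt_csSup hset hL₀
  set r := ⨅ (p : 𝒲) (A : {A : Finset (Fin K) // A.Nonempty}), θ.J pS h p.1 A.1
  have hK0 : (0 : ℝ) < K := by exact_mod_cast hK
  have hgain : ∀ p ∈ 𝒲, K * r ≤ gpGain h ((θ.toAux hpS).out p) := by
    intro p hp
    have := iInf_J_le hK hpS h h𝒲 θ hp
    rwa [one_div_mul_eq_div, le_div_iff₀ hK0, mul_comm] at this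
  filter_upwards [eventually_ge_atTop (Fintype.card (Fin L₀.1), Fintype.card (Fin K → Fin L₀.2))]
    with L hL
  have := le_outerBound hK hpS h d D₁ h𝒲 hne (θ.toAux hpS) hθ
    (mul_nonneg hK0.le (ha0.trans hr.le)) hgain hL.1 hL.2
  rw [mul_div_cancel_left₀ _ hK0.ne'] at this
  exact hr.trans_le this

end Limit

end Bound

/-! ### Product laws -/

section ProductLaw

variable {ι β : Type*} [Fintype ι] [DecidableEq ι] [Fintype β]

lemma prod_update_mul (w : ι → β → ℝ) (z : ι → β) (i : ι) (b : β) :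
    (∏ j, w j (Function.update z i b j)) * w i (z i) = (∏ j, w j (z j)) * w i b := by
  rw [Fintype.prod_eq_mul_prod_compl i, Fintype.prod_eq_mul_prod_compl i (fun j => w j (z j))]
  have : ∏ j ∈ ({i}ᶜ : Finset ι), w j (Function.update z i b j) =
      ∏ j ∈ ({i}ᶜ : Finset ι), w j (z j) :=
    Finset.prod_congr rfl fun j hj => by
      rw [Function.update_of_ne (by simpa using hj)]
  rw [this, Function.update_self]
  ring

/-- Exchanging coordinate `i` of a vector with a spare letter. -/
def swapCoord (ι β : Type*) [DecidableEq ι] (i : ι) : (ι → β) × β ≃ (ι → β) × β where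
  toFun c := (Function.update c.1 i c.2, c.1 i)
  invFun c := (Function.update c.1 i c.2, c.1 i)
  left_inv c := by simp
  right_inv c := by simp

/-- Under a product law, a coordinate may be redrawn independently. -/
lemma sum_prod_mul_resample (w : ι → β → ℝ) (i : ι) (hw : ∑ b, w i b = 1) (f : (ι → β) → ℝ) :
    ∑ z, (∏ j, w j (z j)) * f z =
      ∑ z, (∏ j, w j (z j)) * ∑ b, w i b * f (Function.update z i b) := by
  have h1 : ∑ z : ι → β, (∏ j, w j (z j)) * ∑ b, w i b * f (Function.update z i b) =
      ∑ c : (ι → β) × β, (∏ j, w j (c.1 j)) * w i c.2 * f (Function.update c.1 i c.2) := by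
    rw [Fintype.sum_prod_type]
    simp only [Finset.mul_sum, mul_assoc]
  have h2 : ∑ z : ι → β, (∏ j, w j (z j)) * f z =
      ∑ c : (ι → β) × β, (∏ j, w j (c.1 j)) * w i c.2 * f c.1 := by
    rw [Fintype.sum_prod_type]
    refine Finset.sum_congr rfl fun z _ => ?_
    have : ∀ b, (∏ j, w j (z j)) * w i b * f z = (∏ j, w j (z j)) * f z * w i b := fun b => by ring
    simp only [this, ← Finset.mul_sum, hw, mul_one]
  rw [h1, h2]
  refine Fintype.sum_equiv (swapCoord ι β i) _ _ fun c => ?_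
  simp only [swapCoord, Equiv.coe_fn_mk, Function.update_idem, Function.update_eq_self]
  rw [prod_update_mul]

lemma sum_prod_eq_one (w : ι → β → ℝ) (hw : ∀ i, ∑ b, w i b = 1) :
    ∑ z : ι → β, ∏ j, w j (z j) = 1 := by
  rw [← Fintype.prod_sum]
  simp [hw]

/-- Under a product law, a sum of `N` centred terms of absolute value at most `1`, each a function
of its own coordinate, has expected absolute value at most `√N`. -/
lemma sum_prod_mul_abs_le (w : ι → β → ℝ) (hw0 : ∀ i b, 0 ≤ w i b) (hw : ∀ i, ∑ b, w i b = 1)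
    (c : ι → β → ℝ) (hc : ∀ i, ∑ b, w i b * c i b = 0) (hc1 : ∀ i b, |c i b| ≤ 1) :
    ∑ z : ι → β, (∏ j, w j (z j)) * |∑ i, c i (z i)| ≤ √(Fintype.card ι) := by
  rcases Nat.eq_zero_or_pos (Fintype.card ι) with h0 | h0
  · have := Fintype.card_eq_zero_iff.1 h0
    simp
  have hoff : ∀ i j, i ≠ j → ∑ z : ι → β, (∏ k, w k (z k)) * (c i (z i) * c j (z j)) = 0 := by
    intro i j hij
    rw [sum_prod_mul_resample w i (hw i)]
    refine Finset.sum_eq_zero fun z _ => ?_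
    have : ∀ b, w i b * (c i (Function.update z i b i) * c j (Function.update z i b j)) =
        w i b * c i b * c j (z j) := fun b => by
      rw [Function.update_self, Function.update_of_ne hij.symm]; ring
    simp only [this, ← Finset.sum_mul, hc, zero_mul, mul_zero]
  have hsq : ∑ z : ι → β, (∏ j, w j (z j)) * (∑ i, c i (z i)) ^ 2 ≤ Fintype.card ι := by
    have e : ∀ z : ι → β, (∏ j, w j (z j)) * (∑ i, c i (z i)) ^ 2 =
        ∑ i, ∑ j, (∏ k, w k (z k)) * (c i (z i) * c j (z j)) := fun z => by
      rw [pow_two, Finset.sum_mul_sum]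
      simp only [Finset.mul_sum]
    simp only [e]
    rw [Finset.sum_comm]
    have : ∀ i, ∑ z : ι → β, ∑ j, (∏ k, w k (z k)) * (c i (z i) * c j (z j)) ≤ 1 := by
      intro i
      rw [Finset.sum_comm, Finset.sum_eq_single i (fun j _ hj => hoff i j hj.symm) (by simp)]
      calc _ ≤ ∑ z : ι → β, ∏ k, w k (z k) := by
            refine Finset.sum_le_sum fun z _ => mul_le_of_le_one_right
              (Finset.prod_nonneg fun k _ => hw0 _ _) ?_
            rw [← pow_two, ← sq_abs]
            exact pow_le_one₀ (abs_nonneg _) (hc1 _ _)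
        _ = 1 := sum_prod_eq_one w hw
    calc _ ≤ ∑ _i : ι, (1 : ℝ) := Finset.sum_le_sum fun i _ => this i
      _ = _ := by simp
  set r := √(Fintype.card ι : ℝ) with hr
  have hr0 : 0 < r := Real.sqrt_pos.2 (by exact_mod_cast h0)
  have hr2 : r ^ 2 = Fintype.card ι := Real.sq_sqrt (by positivity)
  have hpt : ∀ t : ℝ, |t| ≤ (t ^ 2 / r + r) / 2 := by
    intro t
    have : 0 ≤ (|t| - r) ^ 2 / r := by positivity
    have e : (|t| - r) ^ 2 / r = t ^ 2 / r + r - 2 * |t| := by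
      rw [sub_sq, sq_abs]; field_simp; ring
    linarith
  calc _ ≤ ∑ z : ι → β, (∏ j, w j (z j)) * (((∑ i, c i (z i)) ^ 2 / r + r) / 2) :=
        Finset.sum_le_sum fun z _ => mul_le_mul_of_nonneg_left (hpt _)
          (Finset.prod_nonneg fun k _ => hw0 _ _)
    _ = ((∑ z : ι → β, (∏ j, w j (z j)) * (∑ i, c i (z i)) ^ 2) / r +
          (∑ z : ι → β, ∏ j, w j (z j)) * r) / 2 := by
        rw [Finset.sum_div, Finset.sum_mul, ← Finset.sum_add_distrib, Finset.sum_div]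
        exact Finset.sum_congr rfl fun z _ => by ring
    _ ≤ (r ^ 2 / r + 1 * r) / 2 := by
        rw [sum_prod_eq_one w hw, hr2]
        gcongr
    _ = r := by field_simp; ring

end ProductLaw

/-! ### Joint types and Hamming distance -/

section Types

variable {X Y : Type*} [Fintype Y] [DecidableEq Y] {K N : ℕ}

lemma jointCount_comp_swap (x : Fin K → Fin N → X) (y : Fin N → Y) {i j : Fin N}
    (hij : (fun k => x k i) = fun k => x k j) (a : Fin K → X) (b : Y) :
    jointCount x (fun l => y (Equiv.swap i j l)) a b = jointCount x y a b := by
  classical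
  have hx : ∀ l, (fun k => x k (Equiv.swap i j l)) = fun k => x k l := by
    intro l
    rcases eq_or_ne l i with rfl | hi
    · rw [Equiv.swap_apply_left, hij]
    rcases eq_or_ne l j with rfl | hj
    · rw [Equiv.swap_apply_right, hij]
    rw [Equiv.swap_apply_of_ne_of_ne hi hj]
  unfold jointCount
  refine Finset.card_bij (fun l _ => Equiv.swap i j l) ?_ ?_ ?_
  · intro l hl
    simp only [Finset.mem_filter, Finset.mem_univ, true_and] at hl ⊢
    exact ⟨(hx l).trans hl.1, hl.2⟩
  · intro l _ l' _ h
    exact (Equiv.swap i j).injective h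
  · intro l hl
    simp only [Finset.mem_filter, Finset.mem_univ, true_and] at hl
    refine ⟨Equiv.swap i j l, ?_, by simp⟩
    simp only [Finset.mem_filter, Finset.mem_univ, true_and, Equiv.swap_apply_self]
    exact ⟨(hx l).trans hl.1, hl.2⟩

/-- A sequence of prescribed joint type with `x` can be found as close to `z`, in Hamming distance,
as the joint types allow. At the optimum no exchange of two positions with the same letters of `x`
gains an agreement, so in each cell either all letters `b` of `y` or all letters `b` of `z` are
matched. -/
lemma exists_jointCount_eq_hammingDist_le [Fintype X] (x : Fin K → Fin N → X) (y₀ z : Fin N → Y) :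
    ∃ y : Fin N → Y, (∀ a b, jointCount x y a b = jointCount x y₀ a b) ∧
      (hammingDist y z : ℝ) ≤ ∑ a, ∑ b, |(jointCount x z a b : ℝ) - jointCount x y₀ a b| := by
  classical
  obtain ⟨y, hy, hmin⟩ := Finset.exists_min_image
    (Finset.univ.filter fun y : Fin N → Y => ∀ a b, jointCount x y a b = jointCount x y₀ a b)
    (fun y => hammingDist y z) ⟨y₀, by simp⟩
  simp only [Finset.mem_filter, Finset.mem_univ, true_and] at hy hmin
  refine ⟨y, hy, ?_⟩
  have hcell : ∀ a b, ((Finset.univ.filter fun i => y i ≠ z i ∧ (fun k => x k i) = a ∧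
      z i = b).card : ℝ) ≤ |(jointCount x z a b : ℝ) - jointCount x y₀ a b| := by
    intro a b
    rcases Finset.eq_empty_or_nonempty (Finset.univ.filter fun i => y i ≠ z i ∧
      (fun k => x k i) = a ∧ z i = b) with he | ⟨i, hi⟩
    · rw [he]; simp
    simp only [Finset.mem_filter, Finset.mem_univ, true_and] at hi
    have hsub : ∀ j, (fun k => x k j) = a → y j = b → z j = b := by
      intro j hja hjb
      by_contra hne
      have hij : (fun k => x k i) = fun k => x k j := hi.2.1.trans hja.symm
      have hle := hmin (fun l => y (Equiv.swap i j l))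
        (fun a b => (jointCount_comp_swap x y hij a b).trans (hy a b))
      refine absurd hle (not_le.2 (Finset.card_lt_card ?_))
      rw [Finset.ssubset_iff_of_subset]
      · refine ⟨i, by simpa using hi.1, ?_⟩
        simp [hjb, hi.2.2]
      · intro l hl
        simp only [Finset.mem_filter, Finset.mem_univ, true_and] at hl ⊢
        rcases eq_or_ne l i with rfl | h1
        · exact hi.1
        rcases eq_or_ne l j with rfl | h2
        · rw [hjb]; exact Ne.symm hne
        rwa [Equiv.swap_apply_of_ne_of_ne h1 h2] at hl
    have hsum : (Finset.univ.filter fun i => y i ≠ z i ∧ (fun k => x k i) = a ∧ z i = b).card +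
        jointCount x y a b ≤ jointCount x z a b := by
      unfold jointCount
      rw [← Finset.card_union_of_disjoint]
      · refine Finset.card_le_card fun l hl => ?_
        simp only [Finset.mem_union, Finset.mem_filter, Finset.mem_univ, true_and] at hl ⊢
        rcases hl with hl | hl
        · exact hl.2
        · exact ⟨hl.1, hsub l hl.1 hl.2⟩
      · rw [Finset.disjoint_left]
        intro l hl hl'
        simp only [Finset.mem_filter, Finset.mem_univ, true_and] at hl hl'
        exact hl.1 (hl'.2.trans hl.2.2.symm)
    rw [← hy a b]
    refine le_trans ?_ (le_abs_self _)
    have : (((Finset.univ.filter fun i => y i ≠ z i ∧ (fun k => x k i) = a ∧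
        z i = b).card : ℝ)) + jointCount x y a b ≤ jointCount x z a b := by exact_mod_cast hsum
    linarith
  refine le_trans ?_ (Finset.sum_le_sum fun a _ => Finset.sum_le_sum fun b _ => hcell a b)
  have : hammingDist y z = ∑ a : Fin K → X, ∑ b : Y, (Finset.univ.filter fun i => y i ≠ z i ∧
      (fun k => x k i) = a ∧ z i = b).card := by
    simp only [hammingDist]
    simp only [Finset.card_filter]
    rw [Finset.sum_congr rfl fun a _ => Finset.sum_comm, Finset.sum_comm]
    refine Finset.sum_congr rfl fun i _ => ?_
    rw [Finset.sum_eq_single (fun k => x k i), Finset.sum_eq_single (z i)]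
    · simp
    · intro b _ hb; simp [Ne.symm hb]
    · simp
    · intro a _ ha; simp [Ne.symm ha]
    · simp
  rw [this]
  push_cast
  exact le_rfl

/-- Under the memoryless channel `p`, joint types with the input deviate from their means by an
expected amount of at most `√N`. -/
lemma sum_prod_mul_abs_jointCount_sub_le (x : Fin K → Fin N → X) {p : (Fin K → X) → Y → ℝ}
    (hp : IsChannel p) (a : Fin K → X) (b : Y) :
    ∑ z : Fin N → Y, (∏ i, p (fun k => x k i) (z i)) *
      |(jointCount x z a b : ℝ) - inputCount x a * p a b| ≤ √N := by
  classical
  have hpab : 0 ≤ p a b ∧ p a b ≤ 1 :=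
    ⟨(hp a).1 b, (hp a).2 ▸ Finset.single_le_sum (fun b _ => (hp a).1 b) (Finset.mem_univ b)⟩
  have := sum_prod_mul_abs_le (fun (i : Fin N) b => p (fun k => x k i) b) (fun i b => (hp _).1 b)
    (fun i => (hp _).2)
    (fun i b' => if (fun k => x k i) = a then (if b' = b then 1 else 0) - p a b else 0) ?_ ?_
  · rw [Fintype.card_fin] at this
    refine le_trans (le_of_eq ?_) this
    refine Finset.sum_congr rfl fun z _ => ?_
    congr 2
    unfold jointCount inputCount
    rw [Finset.card_filter, Finset.card_filter]
    push_cast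
    rw [Finset.sum_mul, ← Finset.sum_sub_distrib]
    refine Finset.sum_congr rfl fun i _ => ?_
    by_cases h1 : (fun k => x k i) = a <;> by_cases h2 : z i = b <;> simp [h1, h2]
  · intro i
    by_cases h1 : (fun k => x k i) = a
    · simp only [h1, if_true, mul_sub, Finset.sum_sub_distrib, ← Finset.sum_mul, (hp a).2]
      simp
    · simp [h1]
  · intro i b'
    split_ifs <;> rw [abs_le] <;> constructor <;> linarith

end Types

/-! ### Feasible attacks close to a memoryless channel -/

section Coupling

variable {X Y : Type*} [Fintype X] [Fintype Y] {K : ℕ}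

lemma isChannel_of_mem_closure {𝒲 : Set ((Fin K → X) → Y → ℝ)} (h𝒲 : ∀ p ∈ 𝒲, IsChannel p)
    {p : (Fin K → X) → Y → ℝ} (hp : p ∈ closure 𝒲) : IsChannel p := by
  have hcl : IsClosed {p : (Fin K → X) → Y → ℝ | IsChannel p} := by
    have : {p : (Fin K → X) → Y → ℝ | IsChannel p} = ⋂ a, {p | p a ∈ stdSimplex ℝ Y} := by
      ext p; simp [IsChannel]
    rw [this]
    exact isClosed_iInter fun a => (isClosed_stdSimplex ℝ Y).preimage (continuous_apply a)
  exact closure_minimal h𝒲 hcl hp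

lemma isCompact_closure_class {𝒲 : Set ((Fin K → X) → Y → ℝ)} (h𝒲 : ∀ p ∈ 𝒲, IsChannel p) :
    IsCompact (closure 𝒲) := by
  have hc : IsCompact (Set.univ.pi fun _ : Fin K → X => stdSimplex ℝ Y) :=
    isCompact_univ_pi fun _ => isCompact_stdSimplex ℝ Y
  refine hc.of_isClosed_subset isClosed_closure fun p hp a _ => ?_
  exact isChannel_of_mem_closure h𝒲 hp a

/-- A memoryless channel in the closure of the class can be turned into a feasible attack by
altering an expected number `o(N)` of its output letters. -/
lemma exists_feasible_coupling {𝒲 : Set ((Fin K → X) → Y → ℝ)} (h𝒲 : ∀ p ∈ 𝒲, IsChannel p)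
    (htypes : TypeApproximable 𝒲) {p : (Fin K → X) → Y → ℝ} (hp : p ∈ closure 𝒲) {ε : ℝ}
    (hε : 0 < ε) [DecidableEq Y] :
    ∃ N₀ : ℕ, ∀ N, N₀ ≤ N → ∃ φ : (Fin K → Fin N → X) → (Fin N → Y) → (Fin N → Y),
      (∀ x z, CondTypeMem 𝒲 x (φ x z)) ∧
      ∀ x, ∑ z : Fin N → Y, (∏ i, p (fun k => x k i) (z i)) * (hammingDist (φ x z) z : ℝ) ≤
        Fintype.card (Fin K → X) * (Fintype.card Y * (√N + ε * N)) := by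
  classical
  obtain ⟨p', hp', hdist⟩ := Metric.mem_closure_iff.1 hp (ε / 2) (by positivity)
  obtain ⟨N₀, hN₀⟩ := htypes p' hp' (ε / 2) (by positivity)
  have hpc := isChannel_of_mem_closure h𝒲 hp
  refine ⟨max N₀ 1, fun N hN => ?_⟩
  have hNpos : (0 : ℝ) < N := by exact_mod_cast (le_max_right _ _).trans hN
  have happ : ∀ x : Fin K → Fin N → X, ∃ y : Fin N → Y, CondTypeMem 𝒲 x y ∧
      ∀ a b, |(jointCount x y a b : ℝ) - inputCount x a * p a b| ≤ ε * N := by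
    intro x
    obtain ⟨y, hy, hyb⟩ := hN₀ N ((le_max_left _ _).trans hN) x
    refine ⟨y, hy, fun a b => ?_⟩
    have h1 := hyb a b
    have h2 : |p' a b - p a b| ≤ ε / 2 := by
      rw [← Real.dist_eq, dist_comm]
      exact ((dist_le_pi_dist _ _ b).trans (dist_le_pi_dist _ _ a)).trans hdist.le
    have h3 : (inputCount x a : ℝ) ≤ N := by
      have : inputCount x a ≤ N := (Finset.card_le_univ _).trans_eq (Fintype.card_fin N)
      exact_mod_cast this
    have h4 : |(jointCount x y a b : ℝ) - inputCount x a * p' a b| ≤ ε / 2 * N := by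
      have e : (jointCount x y a b : ℝ) - inputCount x a * p' a b =
          ((jointCount x y a b : ℝ) / N - (inputCount x a : ℝ) / N * p' a b) * N := by
        field_simp
      rw [e, abs_mul, abs_of_pos hNpos]
      exact mul_le_mul_of_nonneg_right h1 hNpos.le
    have h5 : |(inputCount x a : ℝ) * (p' a b - p a b)| ≤ ε / 2 * N := by
      rw [abs_mul, abs_of_nonneg (by positivity : (0 : ℝ) ≤ inputCount x a), mul_comm]
      exact mul_le_mul h2 h3 (by positivity) (by positivity)
    have := abs_add_le ((jointCount x y a b : ℝ) - inputCount x a * p' a b)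
      ((inputCount x a : ℝ) * (p' a b - p a b))
    calc _ = |((jointCount x y a b : ℝ) - inputCount x a * p' a b) +
        (inputCount x a : ℝ) * (p' a b - p a b)| := by congr 1; ring
      _ ≤ _ := by linarith
  -- `φ x z` is a feasible output closest to `z`.
  have hmin : ∀ (x : Fin K → Fin N → X) (z : Fin N → Y), ∃ y, CondTypeMem 𝒲 x y ∧
      ∀ y', CondTypeMem 𝒲 x y' → hammingDist y z ≤ hammingDist y' z := by
    intro x z
    obtain ⟨y₀, hy₀, -⟩ := happ x
    obtain ⟨y, hy, hm⟩ := Finset.exists_min_image (Finset.univ.filter fun y => CondTypeMem 𝒲 x y)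
      (fun y => hammingDist y z) ⟨y₀, by simpa using hy₀⟩
    exact ⟨y, by simpa using hy, fun y' hy' => hm y' (by simpa using hy')⟩
  choose φ hφ hφmin using hmin
  refine ⟨φ, hφ, fun x => ?_⟩
  obtain ⟨y₀, hy₀, hy₀b⟩ := happ x
  have hpt : ∀ z, (hammingDist (φ x z) z : ℝ) ≤
      ∑ a, ∑ b, (|(jointCount x z a b : ℝ) - inputCount x a * p a b| + ε * N) := by
    intro z
    obtain ⟨y, hyc, hyd⟩ := exists_jointCount_eq_hammingDist_le x y₀ z
    have hyW : CondTypeMem 𝒲 x y := by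
      obtain ⟨r, hr, hrb⟩ := hy₀
      exact ⟨r, hr, fun a b => by rw [hyc]; exact hrb a b⟩
    refine (Nat.cast_le.2 (hφmin x z y hyW)).trans (hyd.trans ?_)
    refine Finset.sum_le_sum fun a _ => Finset.sum_le_sum fun b _ => ?_
    have h1 := abs_sub_le (jointCount x z a b : ℝ) (inputCount x a * p a b) (jointCount x y₀ a b)
    have h2 := hy₀b a b
    rw [abs_sub_comm] at h2
    linarith
  have hw0 : ∀ z : Fin N → Y, 0 ≤ ∏ i, p (fun k => x k i) (z i) := fun z =>
    Finset.prod_nonneg fun i _ => (hpc _).1 _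
  have hw1 : ∑ z : Fin N → Y, ∏ i, p (fun k => x k i) (z i) = 1 :=
    sum_prod_eq_one (fun (i : Fin N) b => p (fun k => x k i) b) fun i => (hpc _).2
  calc _ ≤ ∑ z : Fin N → Y, (∏ i, p (fun k => x k i) (z i)) *
        ∑ a, ∑ b, (|(jointCount x z a b : ℝ) - inputCount x a * p a b| + ε * N) :=
        Finset.sum_le_sum fun z _ => mul_le_mul_of_nonneg_left (hpt z) (hw0 z)
    _ = ∑ a, ∑ b, ∑ z : Fin N → Y, (∏ i, p (fun k => x k i) (z i)) *
          (|(jointCount x z a b : ℝ) - inputCount x a * p a b| + ε * N) := by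
        simp only [Finset.mul_sum]
        rw [Finset.sum_comm]
        exact Finset.sum_congr rfl fun a _ => Finset.sum_comm
    _ ≤ ∑ _a : Fin K → X, ∑ _b : Y, (√N + ε * N) := by
        refine Finset.sum_le_sum fun a _ => Finset.sum_le_sum fun b _ => ?_
        simp only [mul_add, Finset.sum_add_distrib, ← Finset.sum_mul, hw1, one_mul]
        linarith [sum_prod_mul_abs_jointCount_sub_le x hpc a b]
    _ = _ := by simp; ring

end Coupling

/-! ### A telescoping sum of entropies -/

section Telescoping

variable {Ω α B S : Type*} [Fintype Ω] [Fintype α] [Fintype B] [Fintype S] {N : ℕ}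

/-- The sequence that shows the outputs `y'` before time `t` and the host letters `s` from time `t`
on. -/
def hybrid (y' : Fin N → B) (s : Fin N → S) (t : ℕ) : Fin N → B ⊕ S :=
  fun j => if (j : ℕ) < t then Sum.inl (y' j) else Sum.inr (s j)

/-- The Gel'fand–Pinsker auxiliary variable at time `i`, apart from the messages: the past outputs
and the future host letters. -/
def pastFuture (y' : Fin N → B) (s : Fin N → S) (i : Fin N) : Fin N → Option (B ⊕ S) :=
  fun j => if j = i then none else some (hybrid y' s i j)

/-- The differences `H(V_i, S_i) - H(V_i, Y'_i)` telescope along the hybrid sequences. -/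
lemma sum_entropy_pastFuture_sub (P : Ω → ℝ) (A : Ω → α) (s : Ω → Fin N → S)
    (y' : Ω → Fin N → B) :
    ∑ i, (entropy P (fun ω => ((A ω, pastFuture (y' ω) (s ω) i), s ω i)) -
      entropy P (fun ω => ((A ω, pastFuture (y' ω) (s ω) i), y' ω i))) =
      entropy P (fun ω => (A ω, s ω)) - entropy P (fun ω => (A ω, y' ω)) := by
  -- Both entropies at time `i` are those of a hybrid: the host letter, or the observation, at time
  -- `i` fills the gap that `pastFuture` leaves there.
  set G : ℕ → ℝ := fun t => entropy P (fun ω => (A ω, hybrid (y' ω) (s ω) t)) with hG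
  have h0 : entropy P (fun ω => (A ω, s ω)) = G 0 :=
    entropy_congr P fun ω ω' => by simp [hybrid, funext_iff]
  have hN : entropy P (fun ω => (A ω, y' ω)) = G N :=
    entropy_congr P fun ω ω' => by simp [hybrid, funext_iff]
  have h1 : ∀ i : Fin N, entropy P (fun ω => ((A ω, pastFuture (y' ω) (s ω) i), s ω i)) =
      G i := fun i => entropy_congr P fun ω ω' => by
    simp only [Prod.mk.injEq, pastFuture, funext_iff, and_assoc]
    refine and_congr_right fun _ => ⟨fun h j => ?_, fun h => ⟨fun j => ?_, ?_⟩⟩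
    · have := h.1 j
      by_cases hj : j = i
      · subst hj; simp [hybrid, h.2]
      · simpa [hj] using this
    · by_cases hj : j = i
      · simp [hj]
      · simp [hj, h j]
    · simpa [hybrid] using h i
  have h2 : ∀ i : Fin N, entropy P (fun ω => ((A ω, pastFuture (y' ω) (s ω) i), y' ω i)) =
      G (i + 1) := fun i => entropy_congr P fun ω ω' => by
    have hne : ∀ j : Fin N, j ≠ i → ∀ ω, hybrid (y' ω) (s ω) (i + 1) j =
        hybrid (y' ω) (s ω) i j := by
      intro j hj ω
      have : (j : ℕ) ≠ i := fun h => hj (Fin.ext h)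
      have : (j : ℕ) < i + 1 ↔ (j : ℕ) < i := by omega
      simp only [hybrid, this]
    simp only [Prod.mk.injEq, pastFuture, funext_iff, and_assoc]
    refine and_congr_right fun _ => ⟨fun h j => ?_, fun h => ⟨fun j => ?_, ?_⟩⟩
    · have := h.1 j
      by_cases hj : j = i
      · subst hj; simp [hybrid, h.2]
      · rw [hne j hj, hne j hj]; simpa [hj] using this
    · by_cases hj : j = i
      · simp [hj]
      · have := h j
        rw [hne j hj, hne j hj] at this
        simp [hj, this]
    · simpa [hybrid] using h i
  simp only [h1, h2]
  rw [h0, hN, Fin.sum_univ_eq_sum_range (fun t => G t - G (t + 1)), Finset.sum_range_sub']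

end Telescoping

/-! ### Single-letter laws of a code -/

section CodeLaw

variable {S Sd X Y : Type*} [Fintype S] [Fintype Sd] [Fintype X] [Fintype Y] {N M K : ℕ}

namespace FPCode

/-- Sample space of host, key, messages of the colluders, and pirated copy. -/
abbrev CodeSample (c : FPCode S Sd X Y N M) (K : ℕ) : Type _ :=
  (Fin N → S) × Fin c.keyCard × (Fin K → Fin M) × (Fin N → Y)

/-- The letters at time `i` of the copies with messages `m`. -/
def letters (c : FPCode S Sd X Y N M) (s : Fin N → S) (v : Fin c.keyCard) (m : Fin K → Fin M)
    (i : Fin N) : Fin K → X :=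
  fun k => c.enc s v (m k) i

/-- Joint law of host, key, messages and pirated copy when the messages are i.i.d. uniform
(coincidences allowed) and the pirated copy is produced by the memoryless channel `p`. -/
def codeLaw (c : FPCode S Sd X Y N M) (pS : S → ℝ) (p : (Fin K → X) → Y → ℝ) :
    c.CodeSample K → ℝ :=
  fun ω => (∏ i, pS (ω.1 i)) * (c.keyLaw ω.2.1 * (1 / (M : ℝ)) ^ K) *
    ∏ i, p (c.letters ω.1 ω.2.1 ω.2.2.1 i) (ω.2.2.2 i)

/-- What the decoder observes of the host and the pirated copy, letter by letter. -/
def observed (c : FPCode S Sd X Y N M) (h : S → Sd) (ω : c.CodeSample K) : Fin N → Y × Sd :=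
  fun j => (ω.2.2.2 j, h (ω.1 j))

/-- The Gel'fand–Pinsker auxiliary variable at time `i`: messages, key, past observations and
future host letters. -/
def auxVar (c : FPCode S Sd X Y N M) (h : S → Sd) (i : Fin N) (ω : c.CodeSample K) :
    ((Fin K → Fin M) × Fin c.keyCard) × (Fin N → Option ((Y × Sd) ⊕ S)) :=
  ((ω.2.2.1, ω.2.1), pastFuture (c.observed h ω) ω.1 i)

variable (c : FPCode S Sd X Y N M) {pS : S → ℝ} (hpS : pS ∈ stdSimplex ℝ S) (h : S → Sd)
  {p : (Fin K → X) → Y → ℝ} (hp : IsChannel p) (hM : 0 < M)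

include hp in
lemma sum_codeLaw_output (s : Fin N → S) (v : Fin c.keyCard) (m : Fin K → Fin M) :
    ∑ z, c.codeLaw pS p (s, v, m, z) =
      (∏ i, pS (s i)) * (c.keyLaw v * (1 / (M : ℝ)) ^ K) := by
  simp only [codeLaw]
  rw [← Finset.mul_sum, sum_prod_eq_one (fun i b => p (c.letters s v m i) b) fun i => (hp _).2,
    mul_one]

include hpS hp in
lemma codeLaw_nonneg (ω : c.CodeSample K) : 0 ≤ c.codeLaw pS p ω :=
  mul_nonneg (mul_nonneg (Finset.prod_nonneg fun i _ => hpS.1 _)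
    (mul_nonneg (c.keyLaw_mem.1 _) (by positivity))) (Finset.prod_nonneg fun i _ => (hp _).1 _)

include hM in
lemma uniform_mem : (fun _ : Fin M => 1 / (M : ℝ)) ∈ stdSimplex ℝ (Fin M) :=
  ⟨fun _ => by positivity, by simp; field_simp⟩

include hM in
lemma sum_messages : ∑ _m : Fin K → Fin M, (1 / (M : ℝ)) ^ K = 1 := by
  simp only [Finset.sum_const, Finset.card_univ, Fintype.card_fun, Fintype.card_fin, nsmul_eq_mul]
  push_cast
  rw [← mul_pow, mul_one_div_cancel (by positivity), one_pow]

include hpS hp hM in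
lemma codeLaw_mem : c.codeLaw pS p ∈ stdSimplex ℝ (c.CodeSample K) := by
  refine ⟨c.codeLaw_nonneg hpS hp, ?_⟩
  simp only [Fintype.sum_prod_type, c.sum_codeLaw_output hp, ← Finset.mul_sum, sum_messages hM,
    mul_one, c.keyLaw_mem.2]
  exact sum_prod_eq_one (fun _ s => pS s) fun _ => hpS.2

lemma auxVar_update_output (i : Fin N) (s : Fin N → S) (v : Fin c.keyCard) (m : Fin K → Fin M)
    (z : Fin N → Y) (b : Y) :
    c.auxVar h i (s, v, m, Function.update z i b) = c.auxVar h i (s, v, m, z) := by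
  simp only [auxVar, Prod.mk.injEq, true_and]
  funext j
  by_cases hj : j = i
  · simp [pastFuture, hj]
  · simp [pastFuture, hybrid, observed, hj]

open scoped Classical in
/-- The single-letter law at time `i`. The variable `W` is the key together with an independent
copy `s'` of the host sequence, whose `i`-th letter is replaced by `S`; given it, the copies of the
colluders differ only by their independent messages. -/
def auxLaw (i : Fin N) : AuxLaw pS X K (Fin c.keyCard × (Fin N → S))
    (((Fin K → Fin M) × Fin c.keyCard) × (Fin N → Option ((Y × Sd) ⊕ S))) where
  pW w := c.keyLaw w.1 * ∏ j, pS (w.2 j)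
  pX s w := law (fun _ => 1 / (M : ℝ)) fun m => c.enc (Function.update w.2 i s) w.1 m i
  Q s w x u := pS (w.2 i) * ∑ m, ∑ z,
    if c.letters (Function.update w.2 i s) w.1 m i = x ∧
        c.auxVar h i (Function.update w.2 i s, w.1, m, z) = u then
      c.codeLaw pS p (Function.update w.2 i s, w.1, m, z) else 0
  pW_mem := ⟨fun w => mul_nonneg (c.keyLaw_mem.1 _) (Finset.prod_nonneg fun j _ => hpS.1 _), by
    rw [Fintype.sum_prod_type]
    simp only [← Finset.mul_sum, sum_prod_eq_one (fun _ s => pS s) fun _ => hpS.2, mul_one]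
    exact c.keyLaw_mem.2⟩
  pX_mem s w := law_mem_stdSimplex (uniform_mem hM) _
  Q_nonneg s w x u := mul_nonneg (hpS.1 _) (Finset.sum_nonneg fun m _ =>
    Finset.sum_nonneg fun z _ => by
      split_ifs
      exacts [c.codeLaw_nonneg hpS hp _, le_rfl])
  Q_sum s w x := by
    have h1 : ∀ m : Fin K → Fin M, ∑ u, ∑ z,
        (if c.letters (Function.update w.2 i s) w.1 m i = x ∧
          c.auxVar h i (Function.update w.2 i s, w.1, m, z) = u then
          c.codeLaw pS p (Function.update w.2 i s, w.1, m, z) else 0) =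
        (∏ j, pS (Function.update w.2 i s j)) * c.keyLaw w.1 *
          ∏ k, if c.enc (Function.update w.2 i s) w.1 (m k) i = x k then 1 / (M : ℝ) else 0 := by
      intro m
      rw [Finset.sum_comm]
      by_cases hx : c.letters (Function.update w.2 i s) w.1 m i = x
      · have e := fun z => (Finset.sum_eq_single
            (f := fun u => if c.letters (Function.update w.2 i s) w.1 m i = x ∧
              c.auxVar h i (Function.update w.2 i s, w.1, m, z) = u then
              c.codeLaw pS p (Function.update w.2 i s, w.1, m, z) else 0)
            (c.auxVar h i (Function.update w.2 i s, w.1, m, z))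
            (fun u _ hu => if_neg fun h => hu h.2.symm)
            (fun h => absurd (Finset.mem_univ _) h)).trans (if_pos ⟨hx, rfl⟩)
        simp only [e, c.sum_codeLaw_output hp]
        have : ∀ k, c.enc (Function.update w.2 i s) w.1 (m k) i = x k := fun k => congrFun hx k
        simp [this, mul_assoc]
      · simp only [hx, false_and, if_false, Finset.sum_const_zero]
        obtain ⟨k, hk⟩ := Function.ne_iff.1 hx
        rw [Finset.prod_eq_zero (Finset.mem_univ k) (if_neg hk), mul_zero]
    rw [← Finset.mul_sum, Finset.sum_comm]
    simp only [h1]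
    rw [← Finset.mul_sum, ← Fintype.prod_sum
      (fun (k : Fin K) (m : Fin M) => if c.enc (Function.update w.2 i s) w.1 m i = x k then
        1 / (M : ℝ) else 0)]
    have h2 := prod_update_mul (fun _ s => pS s) w.2 i s
    simp only [law_eq_sum_ite]
    linear_combination (c.keyLaw w.1 * ∏ k, ∑ m, if c.enc (Function.update w.2 i s) w.1 m i = x k
      then 1 / (M : ℝ) else 0) * h2

/-- The single-letter law at time `i` is that of the letters at time `i`. -/
lemma law_codeLaw (i : Fin N) :
    law (c.codeLaw pS p) (fun ω => (ω.1 i, c.letters ω.1 ω.2.1 ω.2.2.1 i, c.auxVar h i ω,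
      ω.2.2.2 i)) = (c.auxLaw hpS h hp hM i).out p := by
  classical
  funext ⟨s, x, u, y⟩
  rw [law_eq_sum_ite]
  simp only [Fintype.sum_prod_type, Prod.mk.injEq, AuxLaw.out, auxLaw]
  -- The letter `y` is independent of the auxiliary variable given the letters `x`.
  have hz : ∀ t v m, ∑ z, (if t i = s ∧ c.letters t v m i = x ∧ c.auxVar h i (t, v, m, z) = u ∧
      z i = y then c.codeLaw pS p (t, v, m, z) else 0) =
      (∏ j, pS (t j)) * if t i = s then (∑ z, if c.letters t v m i = x ∧
        c.auxVar h i (t, v, m, z) = u then (c.keyLaw v * (1 / (M : ℝ)) ^ K) *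
          ∏ j, p (c.letters t v m j) (z j) else 0) * p x y else 0 := by
    intro t v m
    by_cases ht : t i = s
    · by_cases hx : c.letters t v m i = x
      · simp only [ht, hx, true_and, if_true, codeLaw]
        have := sum_prod_mul_resample (fun j b => p (c.letters t v m j) b) i (hp _).2
          (fun z => if c.auxVar h i (t, v, m, z) = u ∧ z i = y then 1 else 0)
        simp only [c.auxVar_update_output, Function.update_self, mul_ite, mul_one, mul_zero,
          ite_and, hx] at this
        have h3 : ∀ z, ∑ b, (if c.auxVar h i (t, v, m, z) = u then if b = y then p x b else 0
            else 0) = if c.auxVar h i (t, v, m, z) = u then p x y else 0 := by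
          intro z
          split_ifs <;> simp
        simp only [h3] at this
        simp only [ite_and]
        have h4 : ∀ z, (if c.auxVar h i (t, v, m, z) = u then if z i = y then
            (∏ j, pS (t j)) * (c.keyLaw v * (1 / (M : ℝ)) ^ K) *
              ∏ j, p (c.letters t v m j) (z j) else 0 else 0) =
            (∏ j, pS (t j)) * (c.keyLaw v * (1 / (M : ℝ)) ^ K) *
            (if c.auxVar h i (t, v, m, z) = u then if z i = y then
              ∏ j, p (c.letters t v m j) (z j) else 0 else 0) := by
          intro z; split_ifs <;> simp
        simp only [h4]
        rw [← Finset.mul_sum, this, Finset.sum_mul, Finset.mul_sum, Finset.mul_sum]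
        refine Finset.sum_congr rfl fun z _ => ?_
        split_ifs <;> ring
      · simp [hx]
    · simp [ht]
  simp only [hz]
  set g : (Fin N → S) → ℝ := fun t => ∑ v, ∑ m, ∑ z, if c.letters t v m i = x ∧
    c.auxVar h i (t, v, m, z) = u then (c.keyLaw v * (1 / (M : ℝ)) ^ K) *
      ∏ j, p (c.letters t v m j) (z j) else 0 with hg
  have hL : ∀ t, (∑ v, ∑ m, (∏ j, pS (t j)) * if t i = s then (∑ z,
      if c.letters t v m i = x ∧ c.auxVar h i (t, v, m, z) = u then
        (c.keyLaw v * (1 / (M : ℝ)) ^ K) * ∏ j, p (c.letters t v m j) (z j) else 0) * p x y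
      else 0) = (∏ j, pS (t j)) * if t i = s then g t * p x y else 0 := by
    intro t
    by_cases ht : t i = s
    · simp only [ht, if_true, hg, Finset.sum_mul, Finset.mul_sum]
    · simp [ht]
  have hR : ∑ v, ∑ t : Fin N → S, pS (t i) * ∑ m, ∑ z,
      (if c.letters (Function.update t i s) v m i = x ∧
        c.auxVar h i (Function.update t i s, v, m, z) = u then
        c.codeLaw pS p (Function.update t i s, v, m, z) else 0) =
      ∑ t, (∏ j, pS (t j)) * (pS s * g (Function.update t i s)) := by
    rw [Finset.sum_comm]
    refine Finset.sum_congr rfl fun t _ => ?_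
    have h2 := prod_update_mul (fun _ s => pS s) t i s
    rw [← mul_assoc, ← h2]
    simp only [hg, codeLaw, Finset.mul_sum, mul_ite, mul_zero]
    refine Finset.sum_congr rfl fun v _ => Finset.sum_congr rfl fun m _ =>
      Finset.sum_congr rfl fun z _ => ?_
    split_ifs
    · ring
    · rfl
  simp only [hL]
  rw [hR, sum_prod_mul_resample (fun _ s => pS s) i hpS.2, Finset.sum_mul]
  refine Finset.sum_congr rfl fun t _ => ?_
  simp only [Function.update_self, mul_ite, mul_zero]
  rw [Finset.sum_ite_eq' Finset.univ s]
  simp [mul_assoc]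

/-- The expected distortion of the single-letter law is that of the letters at time `i`. -/
lemma distortion_auxLaw (d : S → X → NNReal) (i : Fin N) :
    (c.auxLaw hpS h hp hM i).distortion d =
      ∑ v, c.keyLaw v * ∑ m : Fin M, 1 / (M : ℝ) *
        ∑ s : Fin N → S, (∏ j, pS (s j)) * (d (s i) (c.enc s v m i) : ℝ) := by
  have h1 : ∀ (s : S) (w : Fin c.keyCard × (Fin N → S)), ∑ x, pS s *
      (c.keyLaw w.1 * ∏ j, pS (w.2 j)) * law (fun _ : Fin M => 1 / (M : ℝ))
        (fun m => c.enc (Function.update w.2 i s) w.1 m i) x * (d s x : ℝ) =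
      ∑ m : Fin M, c.keyLaw w.1 * (1 / (M : ℝ)) * ((∏ j, pS (w.2 j)) * (pS s *
        (d (Function.update w.2 i s i) (c.enc (Function.update w.2 i s) w.1 m i) : ℝ))) := by
    intro s w
    have := sum_law_mul (fun _ : Fin M => 1 / (M : ℝ))
      (fun m => c.enc (Function.update w.2 i s) w.1 m i) (fun x => pS s *
      (c.keyLaw w.1 * ∏ j, pS (w.2 j)) * (d s x : ℝ))
    rw [Function.update_self]
    refine Eq.trans (Finset.sum_congr rfl fun x _ => by ring) (this.trans ?_)
    exact Finset.sum_congr rfl fun m _ => by ring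
  simp only [AuxLaw.distortion, auxLaw, h1, Fintype.sum_prod_type]
  rw [Finset.sum_comm]
  refine Finset.sum_congr rfl fun v _ => ?_
  rw [Finset.mul_sum, Finset.sum_congr rfl fun s _ => Finset.sum_comm, Finset.sum_comm]
  refine Finset.sum_congr rfl fun m _ => ?_
  rw [sum_prod_mul_resample (fun _ s => pS s) i hpS.2, Finset.sum_comm]
  simp only [Finset.mul_sum]
  exact Finset.sum_congr rfl fun s _ => Finset.sum_congr rfl fun b _ => by ring

/-- The single-letter laws meet the distortion constraint on average over time. -/
lemma sum_distortion_auxLaw_le (d : S → X → NNReal) {D₁ : ℝ} (hd : c.HasDistortion d D₁) :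
    ∑ i : Fin N, (1 / (N : ℝ)) * (c.auxLaw hpS h hp hM i).distortion d ≤ D₁ := by
  simp only [distortion_auxLaw]
  have e : ∑ i : Fin N, (1 / (N : ℝ)) * ∑ v, c.keyLaw v * ∑ m : Fin M, 1 / (M : ℝ) *
        ∑ s : Fin N → S, (∏ j, pS (s j)) * (d (s i) (c.enc s v m i) : ℝ) =
      ∑ v, c.keyLaw v * ∑ m : Fin M, 1 / (M : ℝ) *
        ∑ s : Fin N → S, (∏ j, pS (s j)) * ((∑ i, (d (s i) (c.enc s v m i) : ℝ)) / N) := by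
    simp only [Finset.mul_sum, Finset.sum_div]
    rw [Finset.sum_comm]
    refine Finset.sum_congr rfl fun v _ => ?_
    rw [Finset.sum_comm]
    refine Finset.sum_congr rfl fun m _ => ?_
    rw [Finset.sum_comm]
    exact Finset.sum_congr rfl fun s _ => Finset.sum_congr rfl fun i _ => by ring
  rw [e]
  calc _ ≤ ∑ v, c.keyLaw v * ∑ m : Fin M, 1 / (M : ℝ) *
        ∑ s : Fin N → S, (∏ j, pS (s j)) * D₁ := by
        refine Finset.sum_le_sum fun v _ => mul_le_mul_of_nonneg_left
          (Finset.sum_le_sum fun m _ => mul_le_mul_of_nonneg_left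
          (Finset.sum_le_sum fun s _ => mul_le_mul_of_nonneg_left (hd s v m)
          (Finset.prod_nonneg fun j _ => hpS.1 _)) (by positivity)) (c.keyLaw_mem.1 _)
    _ = D₁ := by
        simp only [← Finset.sum_mul, sum_prod_eq_one (fun _ s => pS s) fun _ => hpS.2, one_mul,
          (uniform_mem hM).2, c.keyLaw_mem.2]

end FPCode

end CodeLaw

/-! ### Information about the messages and single-letter gains -/

section Converse

variable {S Sd X Y : Type*} [Fintype S] [Fintype Sd] [Fintype X] [Fintype Y] {N M K : ℕ}

namespace FPCode

variable (c : FPCode S Sd X Y N M) {pS : S → ℝ} (hpS : pS ∈ stdSimplex ℝ S) (h : S → Sd)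
  {p : (Fin K → X) → Y → ℝ} (hp : IsChannel p) (hM : 0 < M)

include hp in
lemma law_codeLaw_inputs (s : Fin N → S) (v : Fin c.keyCard) (m : Fin K → Fin M) :
    law (c.codeLaw pS p) (fun ω => ((ω.2.2.1, ω.2.1), ω.1)) ((m, v), s) =
      (∏ i, pS (s i)) * (c.keyLaw v * (1 / (M : ℝ)) ^ K) := by
  classical
  rw [← c.sum_codeLaw_output hp s v m, law_eq_sum_ite]
  simp only [Fintype.sum_prod_type, Prod.mk.injEq]
  rw [Finset.sum_eq_single s, Finset.sum_eq_single v, Finset.sum_eq_single m]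
  · simp
  · intro b _ hb; simp [hb]
  · simp
  · intro b _ hb; simp [hb]
  · simp
  · intro b _ hb; simp [hb]
  · simp

include hpS hp hM in
lemma law_codeLaw_key :
    law (c.codeLaw pS p) (fun ω : c.CodeSample K => ω.2.1) = c.keyLaw := by
  classical
  funext v
  have := law_comp (c.codeLaw pS p) (fun ω : c.CodeSample K => ((ω.2.2.1, ω.2.1), ω.1))
    (fun a => a.1.2)
  rw [← this, law_eq_sum_ite]
  simp only [Fintype.sum_prod_type, c.law_codeLaw_inputs hp]
  have e : ∀ m : Fin K → Fin M, ∑ v', ∑ s : Fin N → S, (if v' = v then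
      (∏ i, pS (s i)) * (c.keyLaw v' * (1 / (M : ℝ)) ^ K) else 0) =
      c.keyLaw v * (1 / (M : ℝ)) ^ K := by
    intro m
    rw [Finset.sum_eq_single v]
    · simp only [if_true]
      rw [← Finset.sum_mul, sum_prod_eq_one (fun _ s => pS s) fun _ => hpS.2, one_mul]
    · intro b _ hb; simp [hb]
    · simp
  refine (Finset.sum_congr rfl fun m _ => e m).trans ?_
  rw [← Finset.mul_sum, sum_messages hM, mul_one]

include hpS hp hM in
lemma law_codeLaw_host (h : S → Sd) (i : Fin N) :
    law (c.codeLaw pS p) (fun ω : c.CodeSample K => ω.1 i) = pS := by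
  have h1 := law_comp (c.codeLaw pS p) (fun ω => (ω.1 i, c.letters ω.1 ω.2.1 ω.2.2.1 i,
    c.auxVar h i ω, ω.2.2.2 i)) Prod.fst
  rw [c.law_codeLaw hpS h hp hM i] at h1
  rw [← h1]
  exact (c.auxLaw hpS h hp hM i).law_out_host hp

include hpS hp hM in
/-- Host, key and messages are independent. -/
lemma entropy_codeLaw_inputs (h : S → Sd) :
    entropy (c.codeLaw pS p) (fun ω : c.CodeSample K => ((ω.2.2.1, ω.2.1), ω.1)) =
      ∑ i, entropy (c.codeLaw pS p) (fun ω : c.CodeSample K => ω.1 i) +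
        entropy (c.codeLaw pS p) (fun ω : c.CodeSample K => ω.2.1) +
        K * (Real.log M / Real.log 2) := by
  have hP := c.codeLaw_mem hpS hp hM
  simp only [entropy_eq_neg_sum]
  have hterm : ∀ ω : c.CodeSample K, c.codeLaw pS p ω * Real.log (law (c.codeLaw pS p)
      (fun ω : c.CodeSample K => ((ω.2.2.1, ω.2.1), ω.1)) ((ω.2.2.1, ω.2.1), ω.1)) =
      (∑ i, c.codeLaw pS p ω * Real.log (law (c.codeLaw pS p)
        (fun ω : c.CodeSample K => ω.1 i) (ω.1 i))) +
      c.codeLaw pS p ω * Real.log (law (c.codeLaw pS p)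
        (fun ω : c.CodeSample K => ω.2.1) ω.2.1) - c.codeLaw pS p ω * (K * Real.log M) := by
    intro ω
    rcases (hP.1 ω).eq_or_lt with h0 | h0
    · simp [← h0]
    have h1 := h0.trans_le (le_law hP.1 (fun ω : c.CodeSample K => ((ω.2.2.1, ω.2.1), ω.1)) ω)
    simp only [c.law_codeLaw_host hpS hp hM h, c.law_codeLaw_key hpS hp hM,
      c.law_codeLaw_inputs hp] at h1 ⊢
    have hne := h1.ne'
    rw [mul_ne_zero_iff, mul_ne_zero_iff] at hne
    rw [Real.log_mul hne.1 (mul_ne_zero hne.2.1 hne.2.2), Real.log_mul hne.2.1 hne.2.2,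
      Real.log_prod fun i hi => (Finset.prod_ne_zero_iff.1 hne.1) i hi, Real.log_pow,
      one_div, Real.log_inv, ← Finset.mul_sum]
    ring
  simp only [hterm, Finset.sum_add_distrib, Finset.sum_sub_distrib]
  rw [← Finset.sum_mul, hP.2, Finset.sum_comm, ← Finset.sum_div, Finset.sum_neg_distrib]
  ring

lemma gain_auxLaw (i : Fin N) :
    gpGain h ((c.auxLaw hpS h hp hM i).out p) =
      (entropy (c.codeLaw pS p) (fun ω => (c.auxVar h i ω, ω.1 i)) -
        entropy (c.codeLaw pS p) (fun ω => (c.auxVar h i ω, c.observed h ω i))) -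
      (entropy (c.codeLaw pS p) (fun ω : c.CodeSample K => ω.1 i) -
        entropy (c.codeLaw pS p) (fun ω => c.observed h ω i)) := by
  rw [← c.law_codeLaw hpS h hp hM i]
  simp only [gpGain, condEntropy, entropy_law, observed]
  ring

/-- The single-letter gains add up to at least the information that the decoder has about the
messages. -/
lemma le_sum_gain_auxLaw :
    K * (Real.log M / Real.log 2) - condEntropy (c.codeLaw pS p)
      (fun ω : c.CodeSample K => ω.2.2.1) (fun ω => (ω.2.1, c.observed h ω)) ≤
      ∑ i, gpGain h ((c.auxLaw hpS h hp hM i).out p) := by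
  have hP := c.codeLaw_mem hpS hp hM
  simp only [c.gain_auxLaw hpS h hp hM, Finset.sum_sub_distrib]
  have h1 := sum_entropy_pastFuture_sub (c.codeLaw pS p)
    (fun ω : c.CodeSample K => (ω.2.2.1, ω.2.1)) (fun ω => ω.1) (fun ω => c.observed h ω)
  rw [Finset.sum_sub_distrib, c.entropy_codeLaw_inputs hpS hp hM h] at h1
  have h2 := entropy_pi_le hP (fun ω => c.observed h ω)
  have h3 := entropy_pair_le hP (fun ω : c.CodeSample K => ω.2.1) (fun ω => c.observed h ω)
  have h4 : entropy (c.codeLaw pS p)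
      (fun ω : c.CodeSample K => ((ω.2.2.1, ω.2.1), c.observed h ω)) =
      entropy (c.codeLaw pS p)
        (fun ω : c.CodeSample K => (ω.2.2.1, ω.2.1, c.observed h ω)) :=
    entropy_congr _ fun ω ω' => by simp [and_assoc]
  simp only [condEntropy]
  unfold auxVar
  linarith

end FPCode

end Converse

/-! ### Error probabilities -/

section Errors

variable {S Sd X Y : Type*} [Fintype S] [Fintype Y] {N M K : ℕ}

namespace FPCode

variable (c : FPCode S Sd X Y N M) {pS : S → ℝ} (hpS : pS ∈ stdSimplex ℝ S) (h : S → Sd)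
  {𝒲 : Set ((Fin K → X) → Y → ℝ)}

include hpS

lemma outputProb_nonneg (m : Fin K ↪ Fin M) {q : (Fin K → Fin N → X) → (Fin N → Y) → ℝ}
    (hq : IsChannel q) (E : Set (Finset (Fin M))) : 0 ≤ c.outputProb pS h m q E := by
  refine Finset.sum_nonneg fun s _ => Finset.sum_nonneg fun v _ => Finset.sum_nonneg fun y _ => ?_
  split_ifs
  · exact mul_nonneg (mul_nonneg (Finset.prod_nonneg fun i _ => hpS.1 _) (c.keyLaw_mem.1 _))
      ((hq _).1 _)
  · exact le_rfl

lemma outputProb_le_one (m : Fin K ↪ Fin M) {q : (Fin K → Fin N → X) → (Fin N → Y) → ℝ}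
    (hq : IsChannel q) (E : Set (Finset (Fin M))) : c.outputProb pS h m q E ≤ 1 := by
  calc _ ≤ ∑ s : Fin N → S, ∑ v, ∑ y, (∏ i, pS (s i)) * c.keyLaw v *
        q (fun k => c.enc s v (m k)) y := by
        refine Finset.sum_le_sum fun s _ => Finset.sum_le_sum fun v _ =>
          Finset.sum_le_sum fun y _ => ?_
        split_ifs
        · exact le_rfl
        · exact mul_nonneg (mul_nonneg (Finset.prod_nonneg fun i _ => hpS.1 _)
            (c.keyLaw_mem.1 _)) ((hq _).1 _)
    _ = 1 := by
        simp only [← Finset.mul_sum, (hq _).2, mul_one, c.keyLaw_mem.2]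
        exact sum_prod_eq_one (fun _ s => pS s) fun _ => hpS.2

lemma outputProb_le_iSup (m : Fin K ↪ Fin M) {q : (Fin K → Fin N → X) → (Fin N → Y) → ℝ}
    (hq : IsFeasibleAttack 𝒲 q) (E : (Fin K ↪ Fin M) → Set (Finset (Fin M))) :
    c.outputProb pS h m q (E m) ≤ ⨆ (m : Fin K ↪ Fin M)
      (q : {q : (Fin K → Fin N → X) → (Fin N → Y) → ℝ // IsFeasibleAttack 𝒲 q}),
      c.outputProb pS h m q.1 (E m) := by
  have hb : ∀ m, BddAbove (Set.range fun q : {q : (Fin K → Fin N → X) → (Fin N → Y) → ℝ //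
      IsFeasibleAttack 𝒲 q} => c.outputProb pS h m q.1 (E m)) := fun m =>
    ⟨1, by rintro _ ⟨q, rfl⟩; exact c.outputProb_le_one hpS h m q.2.1 _⟩
  exact (le_ciSup (hb m) ⟨q, hq⟩).trans
    (le_ciSup (f := fun m : Fin K ↪ Fin M => ⨆ q : {q : (Fin K → Fin N → X) → (Fin N → Y) → ℝ //
      IsFeasibleAttack 𝒲 q}, c.outputProb pS h m q.1 (E m)) (Set.finite_range _).bddAbove m)

lemma errAll_nonneg : 0 ≤ c.errAll pS h 𝒲 :=
  Real.iSup_nonneg fun m => Real.iSup_nonneg fun q => c.outputProb_nonneg hpS h m q.2.1 _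

lemma errFP_nonneg : 0 ≤ c.errFP pS h 𝒲 :=
  Real.iSup_nonneg fun m => Real.iSup_nonneg fun q => c.outputProb_nonneg hpS h m q.2.1 _

end FPCode

end Errors

/-- Uniform messages coincide with probability at most `K² / M`. -/
lemma sum_not_injective_le {K M : ℕ} (hM : 0 < M) [DecidablePred (Function.Injective :
    (Fin K → Fin M) → Prop)] :
    ∑ m : Fin K → Fin M, (1 / (M : ℝ)) ^ K * (if Function.Injective m then 0 else 1) ≤
      (K : ℝ) ^ 2 / M := by
  have h1 : ∀ m : Fin K → Fin M, (if Function.Injective m then (0 : ℝ) else 1) ≤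
      ∑ k, ∑ l, if k ≠ l ∧ m k = m l then 1 else 0 := by
    intro m
    have hnn : ∀ k l : Fin K, (0 : ℝ) ≤ if k ≠ l ∧ m k = m l then 1 else 0 := fun k l => by
      split_ifs <;> norm_num
    split_ifs with hm
    · exact Finset.sum_nonneg fun k _ => Finset.sum_nonneg fun l _ => hnn k l
    · rw [Function.not_injective_iff] at hm
      obtain ⟨k, l, he, hne⟩ := hm
      calc (1 : ℝ) = if k ≠ l ∧ m k = m l then 1 else 0 := by simp [hne, he]
        _ ≤ ∑ l, if k ≠ l ∧ m k = m l then 1 else 0 :=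
          Finset.single_le_sum (fun l _ => hnn k l) (Finset.mem_univ l)
        _ ≤ _ := Finset.single_le_sum (f := fun k => ∑ l, if k ≠ l ∧ m k = m l then (1 : ℝ) else 0)
          (fun k _ => Finset.sum_nonneg fun l _ => hnn k l) (Finset.mem_univ k)
  have h2 : ∀ k l : Fin K, ∑ m : Fin K → Fin M, (1 / (M : ℝ)) ^ K *
      (if k ≠ l ∧ m k = m l then 1 else 0) ≤ 1 / M := by
    intro k l
    by_cases hkl : k = l
    · simp [hkl]
    have := sum_prod_mul_resample (fun (_ : Fin K) (_ : Fin M) => 1 / (M : ℝ)) k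
      (FPCode.uniform_mem hM).2 (fun m => if k ≠ l ∧ m k = m l then 1 else 0)
    simp only [Finset.prod_const, Finset.card_univ, Fintype.card_fin] at this
    rw [this]
    have e2 : ∀ m : Fin K → Fin M, ∑ b : Fin M, 1 / (M : ℝ) *
        (if k ≠ l ∧ Function.update m k b k = Function.update m k b l then 1 else 0) = 1 / M := by
      intro m
      simp [hkl, Function.update_of_ne (Ne.symm hkl)]
    simp only [e2]
    rw [← Finset.sum_mul, FPCode.sum_messages hM, one_mul]
  calc _ ≤ ∑ m : Fin K → Fin M, (1 / (M : ℝ)) ^ K *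
        ∑ k, ∑ l, (if k ≠ l ∧ m k = m l then 1 else 0) :=
        Finset.sum_le_sum fun m _ => mul_le_mul_of_nonneg_left (h1 m) (by positivity)
    _ = ∑ k, ∑ l, ∑ m : Fin K → Fin M, (1 / (M : ℝ)) ^ K *
        (if k ≠ l ∧ m k = m l then 1 else 0) := by
        simp only [Finset.mul_sum]
        rw [Finset.sum_comm]
        exact Finset.sum_congr rfl fun k _ => Finset.sum_comm
    _ ≤ ∑ _k : Fin K, ∑ _l : Fin K, 1 / (M : ℝ) :=
        Finset.sum_le_sum fun k _ => Finset.sum_le_sum fun l _ => h2 k l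
    _ = _ := by simp; ring

section Fano

variable {S Sd X Y : Type*} [Fintype S] [Fintype Sd] [Fintype X] [Fintype Y] {N M K : ℕ}

namespace FPCode

variable (c : FPCode S Sd X Y N M) {pS : S → ℝ} (hpS : pS ∈ stdSimplex ℝ S) (h : S → Sd)
  {p : (Fin K → X) → Y → ℝ} (hp : IsChannel p) (hM : 0 < M)
  {𝒲 : Set ((Fin K → X) → Y → ℝ)}
  {φ : (Fin K → Fin N → X) → (Fin N → Y) → (Fin N → Y)}

/-- The accusations after the memoryless output has been turned into a feasible one by `φ`. -/
def accused (c : FPCode S Sd X Y N M) (h : S → Sd)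
    (φ : (Fin K → Fin N → X) → (Fin N → Y) → (Fin N → Y)) (ω : c.CodeSample K) : Finset (Fin M) :=
  c.dec (φ (fun k => c.enc ω.1 ω.2.1 (ω.2.2.1 k)) ω.2.2.2) (fun i => h (ω.1 i)) ω.2.1

/-- The memoryless channel `p` followed by the alteration `φ` of its output is a feasible attack. -/
lemma isFeasibleAttack_law (hp : IsChannel p) (hφ : ∀ x z, CondTypeMem 𝒲 x (φ x z)) :
    IsFeasibleAttack 𝒲 fun x => law (fun z : Fin N → Y => ∏ i, p (fun k => x k i) (z i)) (φ x) := by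
  classical
  refine ⟨fun x => law_mem_stdSimplex ⟨fun z => Finset.prod_nonneg fun i _ => (hp _).1 _,
    sum_prod_eq_one (fun (i : Fin N) b => p (fun k => x k i) b) fun i => (hp _).2⟩ _,
    fun x y hy => ?_⟩
  change 0 < law _ _ _ at hy
  rw [law_eq_sum_ite] at hy
  obtain ⟨z, -, hz⟩ := Finset.exists_ne_zero_of_sum_ne_zero hy.ne'
  have : φ x z = y := by
    by_contra hne
    exact hz (if_neg hne)
  exact this ▸ hφ x z

open scoped Classical in
lemma outputProb_law (m : Fin K ↪ Fin M) (E : Set (Finset (Fin M))) :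
    c.outputProb pS h m
      (fun x => law (fun z : Fin N → Y => ∏ i, p (fun k => x k i) (z i)) (φ x)) E =
      ∑ s : Fin N → S, ∑ v, ∑ z : Fin N → Y, (∏ i, pS (s i)) * c.keyLaw v *
        (∏ i, p (c.letters s v m i) (z i)) *
          if c.accused h φ (s, v, m, z) ∈ E then 1 else 0 := by
  unfold outputProb
  refine Finset.sum_congr rfl fun s _ => Finset.sum_congr rfl fun v _ => ?_
  have := sum_law_mul (fun z : Fin N → Y => ∏ i, p (fun k => c.enc s v (m k) i) (z i))
    (φ fun k => c.enc s v (m k))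
    (fun y => if c.dec y (fun i => h (s i)) v ∈ E then (∏ i, pS (s i)) * c.keyLaw v else 0)
  refine Eq.trans (Finset.sum_congr rfl fun y _ => ?_) (this.trans
    (Finset.sum_congr rfl fun z _ => ?_))
  · split_ifs <;> ring
  · change (∏ i, p (c.letters s v m i) (z i)) * (if c.accused h φ (s, v, m, z) ∈ E then
      (∏ i, pS (s i)) * c.keyLaw v else 0) = _
    split_ifs <;> ring

open scoped Classical in
include hpS hp hM in
/-- Against the feasible attack obtained from the memoryless channel, the decoder misidentifies a
random coalition only if one of its two errors occurs or two messages coincide. -/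
lemma sum_codeLaw_error_le (hφ : ∀ x z, CondTypeMem 𝒲 x (φ x z)) :
    ∑ ω : c.CodeSample K, c.codeLaw pS p ω *
      (if Finset.univ.image ω.2.2.1 = c.accused h φ ω then 0 else 1) ≤
      c.errAll pS h 𝒲 + c.errFP pS h 𝒲 + (K : ℝ) ^ 2 / M := by
  set e := c.errAll pS h 𝒲 + c.errFP pS h 𝒲 with he
  have he0 : 0 ≤ e := add_nonneg (c.errAll_nonneg hpS h) (c.errFP_nonneg hpS h)
  set F : (Fin K → Fin M) → ℝ := fun m => ∑ s : Fin N → S, ∑ v, ∑ z : Fin N → Y,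
    (∏ i, pS (s i)) * c.keyLaw v * (∏ i, p (c.letters s v m i) (z i)) *
      if Finset.univ.image m = c.accused h φ (s, v, m, z) then 0 else 1 with hF
  have hw0 : ∀ (m : Fin K → Fin M) s v (z : Fin N → Y), 0 ≤ (∏ i, pS (s i)) * c.keyLaw v *
      (∏ i, p (c.letters s v m i) (z i)) := fun m s v z =>
    mul_nonneg (mul_nonneg (Finset.prod_nonneg fun i _ => hpS.1 _) (c.keyLaw_mem.1 _))
      (Finset.prod_nonneg fun i _ => (hp _).1 _)
  have hFle : ∀ m, F m ≤ e + if Function.Injective m then 0 else 1 := by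
    intro m
    split_ifs with hm
    · set m' : Fin K ↪ Fin M := ⟨m, hm⟩
      have hA := c.outputProb_le_iSup hpS h m' (isFeasibleAttack_law hp hφ)
        (fun m => {J | ¬ coalition m ⊆ J})
      have hB := c.outputProb_le_iSup hpS h m' (isFeasibleAttack_law hp hφ)
        (fun m => {J | (J \ coalition m).Nonempty})
      rw [outputProb_law] at hA hB
      rw [add_zero]
      refine le_trans ?_ (add_le_add hA hB)
      simp only [← Finset.sum_add_distrib]
      refine Finset.sum_le_sum fun s _ => Finset.sum_le_sum fun v _ =>
        Finset.sum_le_sum fun z _ => ?_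
      rw [← mul_add]
      refine mul_le_mul_of_nonneg_left ?_ (hw0 _ _ _ _)
      have hco : coalition m' = Finset.univ.image m := by
        ext; simp [coalition, m']
      have hn : ∀ P : Prop, (0 : ℝ) ≤ if P then 1 else 0 := fun P => by split_ifs <;> norm_num
      by_cases h1 : Finset.univ.image m = c.accused h φ (s, v, m, z)
      · rw [if_pos h1]
        exact add_nonneg (hn _) (hn _)
      rw [if_neg h1]
      by_cases h2 : coalition m' ⊆ c.accused h φ (s, v, m, z)
      · have h3 : (c.accused h φ (s, v, m, z) \ coalition m').Nonempty := by
          rw [Finset.sdiff_nonempty]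
          exact fun h3 => h1 (hco ▸ Finset.Subset.antisymm h2 h3)
        refine le_trans (le_of_eq ?_) (le_add_of_nonneg_left (hn _))
        exact (if_pos h3).symm
      · refine le_trans (le_of_eq ?_) (le_add_of_nonneg_right (hn _))
        exact (if_pos h2).symm
    · have : F m ≤ 1 := by
        calc F m ≤ ∑ s : Fin N → S, ∑ v, ∑ z : Fin N → Y, (∏ i, pS (s i)) * c.keyLaw v *
              (∏ i, p (c.letters s v m i) (z i)) := by
              refine Finset.sum_le_sum fun s _ => Finset.sum_le_sum fun v _ =>
                Finset.sum_le_sum fun z _ => mul_le_of_le_one_right (hw0 _ _ _ _) ?_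
              split_ifs <;> norm_num
          _ = 1 := by
              simp only [← Finset.mul_sum,
                sum_prod_eq_one (fun i b => p (c.letters _ _ m i) b) fun i => (hp _).2, mul_one,
                c.keyLaw_mem.2]
              exact sum_prod_eq_one (fun _ s => pS s) fun _ => hpS.2
      linarith
  have hsum : ∑ ω : c.CodeSample K, c.codeLaw pS p ω *
      (if Finset.univ.image ω.2.2.1 = c.accused h φ ω then 0 else 1) =
      ∑ m, (1 / (M : ℝ)) ^ K * F m := by
    simp only [Fintype.sum_prod_type, hF, Finset.mul_sum, codeLaw]
    rw [Finset.sum_congr rfl fun s _ => Finset.sum_comm, Finset.sum_comm]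
    refine Finset.sum_congr rfl fun m _ => Finset.sum_congr rfl fun s _ =>
      Finset.sum_congr rfl fun v _ => Finset.sum_congr rfl fun z _ => by ring
  rw [hsum]
  calc _ ≤ ∑ m : Fin K → Fin M, (1 / (M : ℝ)) ^ K *
        (e + if Function.Injective m then 0 else 1) :=
        Finset.sum_le_sum fun m _ => mul_le_mul_of_nonneg_left (hFle m) (by positivity)
    _ ≤ _ := by
        simp only [mul_add, Finset.sum_add_distrib, ← Finset.sum_mul, sum_messages hM, one_mul]
        exact add_le_add le_rfl (sum_not_injective_le hM)

end FPCode

end Fano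

/-! ### Guessing kernels -/

section Guessing

/-- A guess of the `K` messages from the accused set `J`: with probability `1/2` they are uniform
among the (at most `K ^ K`) tuples with set of values `J`, otherwise uniform among all tuples. -/
def guessMessages {K M : ℕ} (m : Fin K → Fin M) (J : Finset (Fin M)) : ℝ :=
  1 / 2 * (if Finset.univ.image m = J then 1 / (K : ℝ) ^ K else 0) + 1 / 2 * (1 / (M : ℝ)) ^ K

lemma sum_guessMessages_le {K M : ℕ} (hM : 0 < M) (J : Finset (Fin M)) :
    ∑ m : Fin K → Fin M, guessMessages m J ≤ 1 := by
  have h1 : ∑ m : Fin K → Fin M, (if Finset.univ.image m = J then 1 / (K : ℝ) ^ K else 0) ≤ 1 := by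
    rw [← Finset.sum_filter, Finset.sum_const, nsmul_eq_mul]
    rcases Finset.eq_empty_or_nonempty
      (Finset.univ.filter fun m : Fin K → Fin M => Finset.univ.image m = J) with he | ⟨m₀, hm₀⟩
    · rw [he]; simp
    have hJ : J.card ≤ K := by
      rw [← (Finset.mem_filter.1 hm₀).2]
      simpa using Finset.card_image_le (s := Finset.univ) (f := m₀)
    have hcard : (Finset.univ.filter fun m : Fin K → Fin M => Finset.univ.image m = J).card ≤
        K ^ K := by
      calc _ ≤ (Fintype.piFinset fun _ : Fin K => J).card := by
            refine Finset.card_le_card fun m hm => Fintype.mem_piFinset.2 fun k => ?_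
            rw [← (Finset.mem_filter.1 hm).2]
            exact Finset.mem_image_of_mem _ (Finset.mem_univ _)
        _ = J.card ^ K := by simp
        _ ≤ _ := Nat.pow_le_pow_left hJ K
    rw [mul_one_div]
    refine div_le_one_of_le₀ ?_ (by positivity)
    exact_mod_cast hcard
  simp only [guessMessages, Finset.sum_add_distrib, ← Finset.mul_sum, FPCode.sum_messages hM]
  linarith

lemma guessMessages_pos {K M : ℕ} (hM : 0 < M) (m : Fin K → Fin M) (J : Finset (Fin M)) :
    0 < guessMessages m J := by
  have : (0 : ℝ) < 1 / M := by positivity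
  exact add_pos_of_nonneg_of_pos (by positivity) (by positivity)

lemma neg_log_guessMessages_le {K M : ℕ} (hK : 1 ≤ K) (hM : 0 < M) (m : Fin K → Fin M)
    (J : Finset (Fin M)) :
    -Real.log (guessMessages m J) ≤ Real.log 2 + K * Real.log K +
      K * Real.log M * (if Finset.univ.image m = J then 0 else 1) := by
  have hK0 : (0 : ℝ) < K := by exact_mod_cast hK
  have hM0 : (0 : ℝ) < M := by exact_mod_cast hM
  have hlogK : 0 ≤ Real.log K := Real.log_natCast_nonneg K
  by_cases hJ : Finset.univ.image m = J
  · have h1 : 1 / 2 * (1 / (K : ℝ) ^ K) ≤ guessMessages m J := by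
      rw [guessMessages, if_pos hJ]
      exact le_add_of_nonneg_right (by positivity)
    have h2 := Real.log_le_log (by positivity) h1
    rw [Real.log_mul (by norm_num) (by positivity), one_div, one_div, Real.log_inv, Real.log_inv,
      Real.log_pow] at h2
    rw [if_pos hJ]
    linarith
  · have h1 : 1 / 2 * (1 / (M : ℝ)) ^ K ≤ guessMessages m J := by
      rw [guessMessages, if_neg hJ]
      simp
    have h2 := Real.log_le_log (by positivity) h1
    rw [Real.log_mul (by norm_num) (by positivity), Real.log_pow, one_div, one_div, Real.log_inv,
      Real.log_inv] at h2
    rw [if_neg hJ]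
    nlinarith [mul_nonneg hK0.le hlogK]

/-- A guess of the sequence `y` from a noisy version `z`: each letter is kept with probability
`1 - δ` and redrawn uniformly otherwise. -/
def guessSequence {Y : Type*} [Fintype Y] [DecidableEq Y] {N : ℕ} (δ : ℝ) (y z : Fin N → Y) : ℝ :=
  ∏ i, ((if y i = z i then 1 - δ else 0) + δ / Fintype.card Y)

variable {Y : Type*} [Fintype Y] [DecidableEq Y] {N : ℕ} {δ : ℝ} (hδ0 : 0 < δ) (hδ1 : δ < 1)

lemma sum_guessSequence [Nonempty Y] (δ : ℝ) (z : Fin N → Y) :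
    ∑ y : Fin N → Y, guessSequence δ y z = 1 := by
  unfold guessSequence
  refine sum_prod_eq_one
    (fun i b => (if b = z i then 1 - δ else 0) + δ / Fintype.card Y) fun i => ?_
  rw [Finset.sum_add_distrib]
  simp
  field_simp
  ring

include hδ0 hδ1 in
lemma guessSequence_pos [Nonempty Y] (y z : Fin N → Y) : 0 < guessSequence δ y z :=
  Finset.prod_pos fun i _ => add_pos_of_nonneg_of_pos (by split_ifs <;> linarith) (by positivity)

include hδ0 hδ1 in
lemma neg_log_guessSequence_le [Nonempty Y] (y z : Fin N → Y) :
    -Real.log (guessSequence δ y z) ≤ N * -Real.log (1 - δ) +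
      hammingDist y z * Real.log (Fintype.card Y / δ) := by
  have hY : (1 : ℝ) ≤ Fintype.card Y := by exact_mod_cast Fintype.card_pos
  have hpos : ∀ i, 0 < (if y i = z i then 1 - δ else 0) + δ / Fintype.card Y := fun i =>
    add_pos_of_nonneg_of_pos (by split_ifs <;> linarith) (by positivity)
  unfold guessSequence
  rw [Real.log_prod fun i _ => (hpos i).ne', ← Finset.sum_neg_distrib]
  have hterm : ∀ i, -Real.log ((if y i = z i then 1 - δ else 0) + δ / Fintype.card Y) ≤
      -Real.log (1 - δ) + (if y i ≠ z i then 1 else 0) * Real.log (Fintype.card Y / δ) := by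
    intro i
    have hl : Real.log (1 - δ) ≤ 0 := Real.log_nonpos (by linarith) (by linarith)
    by_cases hi : y i = z i
    · simp only [hi, if_true, ne_eq, not_true, if_false, zero_mul, add_zero]
      exact neg_le_neg (Real.log_le_log (by linarith) (le_add_of_nonneg_right (by positivity)))
    · simp only [hi, if_false, ne_eq, not_false_eq_true, if_true, zero_add, one_mul]
      rw [← Real.log_inv, inv_div]
      linarith
  refine (Finset.sum_le_sum fun i _ => hterm i).trans (le_of_eq ?_)
  rw [Finset.sum_add_distrib, ← Finset.sum_mul]
  simp [hammingDist, Finset.card_filter]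

end Guessing

lemma sum_mul_affine {Ω : Type*} [Fintype Ω] {P : Ω → ℝ} (hP : ∑ ω, P ω = 1) (B E : Ω → ℝ)
    (a l t : ℝ) : ∑ ω, P ω * (a + B ω * l + t * E ω) =
      a + (∑ ω, P ω * B ω) * l + t * ∑ ω, P ω * E ω := by
  simp only [mul_add, Finset.sum_add_distrib]
  rw [← Finset.sum_mul, hP, one_mul, Finset.sum_mul, Finset.mul_sum]
  simp only [mul_assoc, mul_left_comm t]

/-! ### Equivocation of the messages -/

section Fano

variable {S Sd X Y : Type*} [Fintype S] [Fintype Sd] [Fintype X] [Fintype Y] {N M K : ℕ}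

namespace FPCode

variable (c : FPCode S Sd X Y N M) {pS : S → ℝ} (hpS : pS ∈ stdSimplex ℝ S) (h : S → Sd)
  {p : (Fin K → X) → Y → ℝ} (hp : IsChannel p) (hM : 0 < M)
  {𝒲 : Set ((Fin K → X) → Y → ℝ)}
  {φ : (Fin K → Fin N → X) → (Fin N → Y) → (Fin N → Y)}

include hpS hp hM in
/-- The expected number of letters that `φ` alters, averaged over the inputs of the channel. -/
lemma sum_codeLaw_mul_le [DecidableEq Y] {D : ℝ}
    (hD : ∀ x, ∑ z : Fin N → Y, (∏ i, p (fun k => x k i) (z i)) *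
      (hammingDist (φ x z) z : ℝ) ≤ D) :
    ∑ ω : c.CodeSample K, c.codeLaw pS p ω *
      (hammingDist (φ (fun k => c.enc ω.1 ω.2.1 (ω.2.2.1 k)) ω.2.2.2) ω.2.2.2 : ℝ) ≤ D := by
  simp only [Fintype.sum_prod_type, codeLaw]
  calc _ ≤ ∑ s : Fin N → S, ∑ v, ∑ _m : Fin K → Fin M,
        (∏ i, pS (s i)) * (c.keyLaw v * (1 / (M : ℝ)) ^ K) * D := by
        refine Finset.sum_le_sum fun s _ => Finset.sum_le_sum fun v _ =>
          Finset.sum_le_sum fun m _ => ?_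
        simp only [mul_assoc _ (∏ i, p (c.letters s v m i) _) _]
        rw [← Finset.mul_sum]
        refine mul_le_mul_of_nonneg_left (hD fun k => c.enc s v (m k)) ?_
        exact mul_nonneg (Finset.prod_nonneg fun i _ => hpS.1 _)
          (mul_nonneg (c.keyLaw_mem.1 _) (by positivity))
    _ = D := by
        have e : ∀ (s : Fin N → S) (v : Fin c.keyCard), ∑ _m : Fin K → Fin M,
            (∏ i, pS (s i)) * (c.keyLaw v * (1 / (M : ℝ)) ^ K) * D =
            (∏ i, pS (s i)) * c.keyLaw v * D := fun s v => by
          rw [← Finset.sum_mul, ← Finset.mul_sum, ← Finset.mul_sum, sum_messages hM, mul_one]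
        simp only [e, ← Finset.sum_mul, ← Finset.mul_sum, c.keyLaw_mem.2, mul_one,
          sum_prod_eq_one (fun _ s => pS s) fun _ => hpS.2, one_mul]

open scoped Classical in
include hpS hp hM in
/-- A Fano inequality for the memoryless output `z`: guess the feasible output `φ x z` from `z`,
and the messages from the accusations made on that guess. -/
lemma condEntropy_messages_le [Nonempty Y] (hK : 1 ≤ K) {δ : ℝ} (hδ0 : 0 < δ) (hδ1 : δ < 1)
    {D e : ℝ}
    (hD : ∀ x, ∑ z : Fin N → Y, (∏ i, p (fun k => x k i) (z i)) *
      (hammingDist (φ x z) z : ℝ) ≤ D)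
    (he : ∑ ω : c.CodeSample K, c.codeLaw pS p ω *
      (if Finset.univ.image ω.2.2.1 = c.accused h φ ω then 0 else 1) ≤ e) :
    condEntropy (c.codeLaw pS p) (fun ω : c.CodeSample K => ω.2.2.1)
      (fun ω => (ω.2.1, c.observed h ω)) ≤
      (N * -Real.log (1 - δ) + D * Real.log (Fintype.card Y / δ) + (Real.log 2 + K * Real.log K) +
        K * Real.log M * e) / Real.log 2 := by
  have hP := c.codeLaw_mem hpS hp hM
  have hY : (1 : ℝ) ≤ Fintype.card Y := by exact_mod_cast Fintype.card_pos
  set Q : (Fin K → Fin M) → (Fin c.keyCard × (Fin N → Y × Sd)) → ℝ := fun m w =>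
    ∑ y : Fin N → Y, guessSequence δ y (fun i => (w.2 i).1) *
      guessMessages m (c.dec y (fun i => (w.2 i).2) w.1) with hQ
  have hterm0 : ∀ (m : Fin K → Fin M) (w : Fin c.keyCard × (Fin N → Y × Sd)) (y : Fin N → Y),
      0 < guessSequence δ y (fun i => (w.2 i).1) *
      guessMessages m (c.dec y (fun i => (w.2 i).2) w.1) := fun m w y =>
    mul_pos (guessSequence_pos hδ0 hδ1 _ _) (guessMessages_pos hM _ _)
  have hle : ∀ m w y, guessSequence δ y (fun i => (w.2 i).1) *
      guessMessages m (c.dec y (fun i => (w.2 i).2) w.1) ≤ Q m w := fun m w y =>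
    Finset.single_le_sum (f := fun y => guessSequence δ y (fun i => (w.2 i).1) *
      guessMessages m (c.dec y (fun i => (w.2 i).2) w.1)) (fun y _ => (hterm0 m w y).le)
      (Finset.mem_univ y)
  have hQ1 : ∀ w, ∑ m, Q m w ≤ 1 := by
    intro w
    simp only [hQ]
    rw [Finset.sum_comm]
    calc _ ≤ ∑ y : Fin N → Y, guessSequence δ y (fun i => (w.2 i).1) := by
          refine Finset.sum_le_sum fun y _ => ?_
          rw [← Finset.mul_sum]
          exact mul_le_of_le_one_right (guessSequence_pos hδ0 hδ1 _ _).le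
            (sum_guessMessages_le hM _)
      _ = 1 := sum_guessSequence δ _
  have hQpos : ∀ m w, 0 < Q m w := fun m w =>
    (hterm0 m w fun i => (w.2 i).1).trans_le (hle m w _)
  refine (condEntropy_le_cross hP.1 _ _ Q (fun m w => (hQpos m w).le) hQ1
    (fun ω _ => hQpos _ _)).trans (div_le_div_of_nonneg_right ?_ log_two_pos.le)
  have hpt : ∀ ω : c.CodeSample K, -Real.log (Q ω.2.2.1 (ω.2.1, c.observed h ω)) ≤
      (N * -Real.log (1 - δ) + (Real.log 2 + K * Real.log K)) +
      (hammingDist (φ (fun k => c.enc ω.1 ω.2.1 (ω.2.2.1 k)) ω.2.2.2) ω.2.2.2 : ℝ) *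
        Real.log (Fintype.card Y / δ) +
      K * Real.log M * (if Finset.univ.image ω.2.2.1 = c.accused h φ ω then 0 else 1) := by
    intro ω
    have h1 := Real.log_le_log (hterm0 ω.2.2.1 (ω.2.1, c.observed h ω) _)
      (hle ω.2.2.1 (ω.2.1, c.observed h ω) (φ (fun k => c.enc ω.1 ω.2.1 (ω.2.2.1 k)) ω.2.2.2))
    rw [Real.log_mul (guessSequence_pos hδ0 hδ1 _ _).ne' (guessMessages_pos hM _ _).ne'] at h1
    have h2 := neg_log_guessSequence_le hδ0 hδ1
      (φ (fun k => c.enc ω.1 ω.2.1 (ω.2.2.1 k)) ω.2.2.2) ω.2.2.2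
    have h3 := neg_log_guessMessages_le hK hM ω.2.2.1 (c.accused h φ ω)
    simp only [observed, accused] at h1 h3 ⊢
    linarith
  have hDa := c.sum_codeLaw_mul_le hpS hp hM hD
  rw [← Finset.sum_neg_distrib]
  calc _ = ∑ ω, c.codeLaw pS p ω * -Real.log (Q ω.2.2.1 (ω.2.1, c.observed h ω)) :=
        Finset.sum_congr rfl fun ω _ => by ring
    _ ≤ _ := Finset.sum_le_sum fun ω _ => mul_le_mul_of_nonneg_left (hpt ω) (hP.1 ω)
    _ = (N * -Real.log (1 - δ) + (Real.log 2 + K * Real.log K)) +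
        (∑ ω : c.CodeSample K, c.codeLaw pS p ω *
          (hammingDist (φ (fun k => c.enc ω.1 ω.2.1 (ω.2.2.1 k)) ω.2.2.2) ω.2.2.2 : ℝ)) *
          Real.log (Fintype.card Y / δ) +
        K * Real.log M * ∑ ω : c.CodeSample K, c.codeLaw pS p ω *
          (if Finset.univ.image ω.2.2.1 = c.accused h φ ω then 0 else 1) := by
        exact sum_mul_affine hP.2 _ _ _ _ _
    _ ≤ _ := by
        have hl : 0 ≤ Real.log (Fintype.card Y / δ) := Real.log_nonneg (by
          rw [le_div_iff₀ hδ0]; linarith)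
        have hl' : 0 ≤ K * Real.log M := mul_nonneg (by positivity) (Real.log_natCast_nonneg M)
        have := mul_le_mul_of_nonneg_right hDa hl
        have := mul_le_mul_of_nonneg_left he hl'
        linarith

end FPCode

end Fano

/-! ### The converse for one channel -/

section Converse

variable {S Sd X Y : Type*} [Fintype S] [Fintype Sd] [Fintype X] [Fintype Y] {K : ℕ}
  {pS : S → ℝ}

/-- Time sharing over the positions of a code. -/
lemma FPCode.exists_auxLaw_of_code {N M : ℕ} (c : FPCode S Sd X Y N M)
    (hpS : pS ∈ stdSimplex ℝ S) (h : S → Sd) {p : (Fin K → X) → Y → ℝ} (hp : IsChannel p)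
    (hM : 0 < M) (hN : 0 < N) {d : S → X → NNReal} {D₁ : ℝ} (hd : c.HasDistortion d D₁) :
    ∃ (a b : ℕ) (q : AuxLaw pS X K (Fin a) (Fin b)), q.distortion d ≤ D₁ ∧
      1 / (N : ℝ) * (K * (Real.log M / Real.log 2) - condEntropy (c.codeLaw pS p)
        (fun ω : c.CodeSample K => ω.2.2.1) (fun ω => (ω.2.1, c.observed h ω))) ≤
        gpGain h (q.out p) := by
  set m := AuxLaw.mix (fun _ : Fin N => 1 / (N : ℝ)) (uniform_mem hN)
    (c.auxLaw hpS h hp hM) with hm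
  have hW := m.nonempty_W
  refine ⟨_, _, m.relabel (Fintype.equivFin _).toEmbedding (Fintype.equivFin _).toEmbedding,
    ?_, ?_⟩
  · rw [m.relabel_distortion, AuxLaw.mix_distortion]
    exact c.sum_distortion_auxLaw_le hpS h hp hM d hd
  · rw [m.relabel_gain]
    refine le_trans ?_ (AuxLaw.le_mix_gain _ (uniform_mem hN) (c.auxLaw hpS h hp hM) hpS h hp)
    rw [← Finset.mul_sum]
    exact mul_le_mul_of_nonneg_left (c.le_sum_gain_auxLaw hpS h hp hM) (by positivity)

lemma userCount_pos (N : ℕ) (R : ℝ) : 0 < ⌈(2 : ℝ) ^ ((N : ℝ) * R)⌉₊ :=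
  Nat.ceil_pos.2 (by positivity)

lemma mul_log_two_le_log_userCount (N : ℕ) (R : ℝ) :
    N * R ≤ Real.log ⌈(2 : ℝ) ^ ((N : ℝ) * R)⌉₊ / Real.log 2 := by
  rw [le_div_iff₀ log_two_pos, ← Real.log_rpow (by norm_num)]
  exact Real.log_le_log (by positivity) (Nat.le_ceil _)

lemma log_userCount_le (N : ℕ) {R : ℝ} (hR : 0 < R) :
    Real.log ⌈(2 : ℝ) ^ ((N : ℝ) * R)⌉₊ / Real.log 2 ≤ N * R + 1 := by
  have h1 : (1 : ℝ) ≤ (2 : ℝ) ^ ((N : ℝ) * R) :=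
    Real.one_le_rpow (by norm_num) (by positivity)
  have h2 : (⌈(2 : ℝ) ^ ((N : ℝ) * R)⌉₊ : ℝ) ≤ (2 : ℝ) ^ ((N : ℝ) * R + 1) := by
    rw [Real.rpow_add (by norm_num), Real.rpow_one]
    have := (Nat.ceil_lt_add_one (by positivity : 0 ≤ (2 : ℝ) ^ ((N : ℝ) * R))).le
    linarith
  rw [div_le_iff₀ log_two_pos, ← Real.log_rpow (by norm_num)]
  exact Real.log_le_log (by exact_mod_cast userCount_pos N R) h2

lemma tendsto_userCount {R : ℝ} (hR : 0 < R) :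
    Tendsto (fun N : ℕ => (⌈(2 : ℝ) ^ ((N : ℝ) * R)⌉₊ : ℝ)) atTop atTop := by
  refine tendsto_atTop_mono (fun N => Nat.le_ceil _) ?_
  have := tendsto_pow_atTop_atTop_of_one_lt (Real.one_lt_rpow (by norm_num : (1 : ℝ) < 2) hR)
  refine this.congr fun N => ?_
  rw [mul_comm, Real.rpow_mul (by norm_num), Real.rpow_natCast]

/-- The converse for one channel: at an achievable rate `R > 0`, some law gains almost `K R`
against any given channel in the closure of the class. -/
lemma exists_auxLaw_of_achievable (hK : 1 ≤ K) (hpS : pS ∈ stdSimplex ℝ S) {h : S → Sd}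
    {d : S → X → NNReal} {D₁ : ℝ} {𝒲 : Set ((Fin K → X) → Y → ℝ)} (h𝒲 : ∀ p ∈ 𝒲, IsChannel p)
    (htypes : TypeApproximable 𝒲) {R : ℝ} (hR : 0 < R) (hach : AchievableAll pS h d D₁ 𝒲 R)
    {p : (Fin K → X) → Y → ℝ} (hp : p ∈ closure 𝒲) {η : ℝ} (hη : 0 < η) :
    ∃ (a b : ℕ) (q : AuxLaw pS X K (Fin a) (Fin b)), q.distortion d ≤ D₁ ∧
      K * R - η < gpGain h (q.out p) := by
  classical
  obtain ⟨c, hcd, hcA, hcF⟩ := hach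
  have hpc := isChannel_of_mem_closure h𝒲 hp
  -- `Y` is nonempty because some letter tuple occurs as an input of the channel.
  have hYne : Nonempty Y := by
    obtain ⟨s⟩ : Nonempty S := by
      by_contra hSe
      rw [not_nonempty_iff] at hSe
      simpa using hpS.2
    have hv : 0 < (c 1).keyCard := by
      by_contra h0
      have := (c 1).keyLaw_mem.2
      have hE : IsEmpty (Fin (c 1).keyCard) := by
        rw [Nat.eq_zero_of_not_pos h0]; infer_instance
      simp at this
    by_contra hYe
    rw [not_nonempty_iff] at hYe
    simpa using (hpc fun _ => (c 1).enc (fun _ => s) ⟨0, hv⟩ ⟨0, userCount_pos 1 R⟩ 0).2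
  have hY : (1 : ℝ) ≤ Fintype.card Y := by exact_mod_cast Fintype.card_pos
  set L := Real.log 2 with hL
  have hL0 : 0 < L := log_two_pos
  -- The share `δ` of redrawn letters makes `-log (1 - δ)` equal to `η / 8` bits.
  set δ := 1 - Real.exp (-(η / 8 * L)) with hδ
  have hδ0 : 0 < δ := sub_pos.2 (Real.exp_lt_one_iff.2 (by have := mul_pos hη hL0; linarith))
  have hδ1 : δ < 1 := sub_lt_self _ (Real.exp_pos _)
  have hδlog : -Real.log (1 - δ) = η / 8 * L := by
    rw [hδ, sub_sub_cancel, Real.log_exp, neg_neg]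
  set l := Real.log (Fintype.card Y / δ) with hl
  have hl0 : 0 ≤ l := Real.log_nonneg (by rw [le_div_iff₀ hδ0]; linarith)
  set B : ℝ := Fintype.card (Fin K → X) * Fintype.card Y * l with hB
  have hB0 : 0 ≤ B := by positivity
  -- The share `ε` of altered letters costs at most `η / 8` bits per letter.
  set ε := η * L / (8 * (B + 1)) with hε
  have hε0 : 0 < ε := by positivity
  have hεB : B * ε / L ≤ η / 8 := by
    rw [div_le_iff₀ hL0, hε, mul_div_assoc', div_le_iff₀ (by positivity)]
    have := mul_pos hη hL0
    nlinarith
  obtain ⟨N₀, hN₀⟩ := exists_feasible_coupling h𝒲 htypes hp hε0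
  set M : ℕ → ℕ := fun N => ⌈(2 : ℝ) ^ ((N : ℝ) * R)⌉₊ with hMdef
  set e : ℕ → ℝ := fun N => (c N).errAll pS h 𝒲 + (c N).errFP pS h 𝒲 + (K : ℝ) ^ 2 / M N with he
  have hetend : Tendsto e atTop (𝓝 0) := by
    simpa using (hcA.add hcF).add ((tendsto_userCount hR).const_div_atTop ((K : ℝ) ^ 2))
  have he0 : ∀ N, 0 ≤ e N := fun N => add_nonneg
    (add_nonneg ((c N).errAll_nonneg hpS h) ((c N).errFP_nonneg hpS h)) (by positivity)
  set c₀ : ℝ := L + K * Real.log K with hc₀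
  have hrest : Tendsto (fun N : ℕ => B / L * (√(N : ℝ))⁻¹ + c₀ / L / N + K * (R + 1 / N) * e N)
      atTop (𝓝 0) := by
    have h1 : Tendsto (fun N : ℕ => (√(N : ℝ))⁻¹) atTop (𝓝 0) :=
      tendsto_inv_atTop_zero.comp (Real.tendsto_sqrt_atTop.comp tendsto_natCast_atTop_atTop)
    have h2 := tendsto_const_div_atTop_nhds_zero_nat (c₀ / L)
    have h3 := tendsto_const_div_atTop_nhds_zero_nat (1 : ℝ)
    simpa using ((h1.const_mul (B / L)).add h2).add
      (((h3.const_add R).const_mul (K : ℝ)).mul hetend)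
  obtain ⟨N, hNrest, hNN₀, hN1⟩ := ((hrest.eventually_lt_const (show 0 < η / 4 by positivity)).and
    ((eventually_ge_atTop N₀).and (eventually_ge_atTop 1))).exists
  obtain ⟨φ, hφ, hφD⟩ := hN₀ N hNN₀
  have hM : 0 < M N := userCount_pos N R
  obtain ⟨a, b, q, hqd, hq⟩ := (c N).exists_auxLaw_of_code hpS h hpc hM hN1 (hcd N)
  refine ⟨a, b, q, hqd, lt_of_lt_of_le ?_ hq⟩
  have hfano := (c N).condEntropy_messages_le hpS h hpc hM hK hδ0 hδ1 hφD
    ((c N).sum_codeLaw_error_le hpS h hpc hM hφ)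
  have hNpos : (0 : ℝ) < N := by exact_mod_cast hN1
  have hlog1 := mul_log_two_le_log_userCount N R
  have hlog2 := log_userCount_le N hR
  have hK0 : (0 : ℝ) ≤ K := by positivity
  rw [hδlog] at hfano
  change _ ≤ (_ + _ + _ + K * Real.log (M N) * e N) / L at hfano
  set lM := Real.log (M N) / L with hlM
  set H := condEntropy ((c N).codeLaw pS p) (fun ω : (c N).CodeSample K => ω.2.2.1)
    (fun ω => (ω.2.1, (c N).observed h ω))
  have hsqrt : √(N : ℝ) / N = (√(N : ℝ))⁻¹ := Real.sqrt_div_self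
  have hH : 1 / (N : ℝ) * H ≤ η / 8 + (B / L * (√(N : ℝ))⁻¹ + B * ε / L) + c₀ / L / N +
      K * (R + 1 / N) * e N := by
    have e1 : ((N : ℝ) * (η / 8 * L) + Fintype.card (Fin K → X) * (Fintype.card Y *
        (√N + ε * N)) * l + c₀ + K * Real.log (M N) * e N) / L =
        N * (η / 8 + (B / L * (√(N : ℝ) / N) + B * ε / L) + c₀ / L / N) + K * lM * e N := by
      rw [hlM, hB]
      field_simp
    rw [e1] at hfano
    have h2 : K * lM * e N ≤ N * (K * (R + 1 / N) * e N) := by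
      have : K * lM * e N ≤ K * (N * R + 1) * e N :=
        mul_le_mul_of_nonneg_right (mul_le_mul_of_nonneg_left hlog2 hK0) (he0 N)
      refine this.trans (le_of_eq ?_)
      field_simp
    rw [one_div_mul_eq_div, div_le_iff₀ hNpos, ← hsqrt]
    linarith
  have hmain : K * R ≤ 1 / (N : ℝ) * (K * lM) := by
    rw [one_div_mul_eq_div, le_div_iff₀ hNpos]
    have := mul_le_mul_of_nonneg_left hlog1 hK0
    linarith
  rw [mul_sub]
  linarith

end Converse

end

end BlindFP

theorem mainTheorem3 {S Sd X Y : Type*} [Fintype S] [Fintype Sd] [Fintype X] [Fintype Y]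
    (pS : S → ℝ) (hpS : pS ∈ stdSimplex ℝ S) (h : S → Sd)
    (d : S → X → NNReal) (D₁ : ℝ) (K : ℕ) (hK : 1 ≤ K)
    (𝒲 : Set ((Fin K → X) → Y → ℝ)) (h𝒲_channel : ∀ p ∈ 𝒲, BlindFP.IsChannel p)
    (h𝒲_nonempty : 𝒲.Nonempty) (h𝒲_convex : Convex ℝ 𝒲)
    (h𝒲_types : BlindFP.TypeApproximable 𝒲) :
    ∃ C : ℝ,
      Filter.Tendsto (fun L : ℕ × ℕ => BlindFP.outerBound pS h d D₁ 𝒲 L.1 L.2)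
        Filter.atTop (nhds C) ∧
      BlindFP.capacityAll pS h d D₁ 𝒲 ≤ (C : EReal) := by
  obtain ⟨C, hC, hC0, hCle⟩ :=
    BlindFP.exists_tendsto_outerBound hK hpS h d D₁ h𝒲_channel h𝒲_nonempty
  refine ⟨C, hC, iSup₂_le fun R hR => EReal.coe_le_coe_iff.2 ?_⟩
  rcases le_or_gt R 0 with hR0 | hR0
  · exact hR0.trans hC0
  refine le_of_forall_sub_le fun η hη => ?_
  rcases le_or_gt (R - η) 0 with h0 | h0
  · exact h0.trans hC0
  have hK0 : (0 : ℝ) < K := by exact_mod_cast hK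
  obtain ⟨a, b, q, hqd, hq⟩ := BlindFP.exists_auxLaw_forall_channel hpS h d D₁
    (BlindFP.isCompact_closure_class h𝒲_channel) h𝒲_convex.closure h𝒲_nonempty.closure
    (fun p hp => BlindFP.isChannel_of_mem_closure h𝒲_channel hp) (K * R - K * η)
    (fun p hp => BlindFP.exists_auxLaw_of_achievable hK hpS h𝒲_channel h𝒲_types hR0 hR hp
      (mul_pos hK0 hη))
  have := BlindFP.le_outerBound hK hpS h d D₁ h𝒲_channel h𝒲_nonempty q hqd
    (by rw [← mul_sub]; exact (mul_pos hK0 h0).le) (fun p hp => hq p (subset_closure hp))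
    (Lw := a) (Lu := b) (by simp) (by simp)
  rw [← mul_sub, mul_div_cancel_left₀ _ hK0.ne'] at this
  exact this.trans (hCle (a, b))
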